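/- Let $T$ be an infinite, locally finite tree rooted at a vertex $o$, with no leaves except possibly $o$. Write $|v|$ for the distance of $v$ from $o$, $v\to w$ if $v$ is the parent of $w$ (the neighbour of $w$ closer to $o$), and $y\le w$ (resp. $y<w$) if $y$ lies on the path from $o$ to $w$ (resp. and $y\ne w$). Let $\beta>0$ and let $\{J_v : v\neq o\}$ be interaction strengths with $0<J_{\min}\le J_v\le J_{\max}<\infty$ for all $v\ne o$; $J_w$ is the interaction strength of the edge $v\to w$. Let $T^{(N)}$ be the subtree induced on $\{v:|v|\le N\}$, with boundary $\partial T^{(N)}=\{v:|v|=N\}$, and let $\mathbf P^{(N)}$ be the free-boundary Ising measure on $\{\pm1\}^{V(T^{(N)})}$, given by $\mathbf P^{(N)}(\eta)\propto\prod_{v\to w,\,|w|\le N}\exp(\beta J_w\eta(v)\eta(w))$. The free-boundary Gibbs measure $\mathbf P$ on $\{\pm1\}^{V(T)}$ is the tree-indexed Markov chain in which $\eta(o)=\pm1$ with probability $1/2$ each and every $v\neq o$, independently, copies the spin of its parent with probability $(1+\tanh\beta J_v)/2$ and reverses it with probability $(1-\tanh\beta J_v)/2$. A Gibbs measure is a probability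 measure on $\{\pm1\}^{V(T)}$ that satisfies the DLR equations of the Ising model with interactions $J$ at inverse temperature $\beta$, and it is extremal if it is an extreme point of the convex set of all Gibbs measures. Let $X_o^{(N)}$ be the root log-likelihood ratio $$X_o^{(N)}(\eta)=\log\frac{\mathbf P^{(N)}(\zeta(o)=+1\mid \zeta=\eta\text{ on }\partial T^{(N)})}{\mathbf P^{(N)}(\zeta(o)=-1\mid \zeta=\eta\text{ on }\partial T^{(N)})},$$ where $\zeta$ denotes the random configuration with law $\mathbf P^{(N)}$, and $X_o^{(N)}$ is regarded as a random variable under $\mathbf P^{(N)}$. Give the edge $e=vw$, $v\to w$, the resistance $R(e)=\prod_{o<y\le w}(\tanh\beta J_y)^{-2}$. A flow on $T$ is a nonnegative function $\mu$ on the edges with $\mu(vw)=\sum_{y:\,w\to y}\mu(wy)$ whenever $v\to w$; its mass is $|\mu|=\sum_{w:\,o\to w}\mu(ow)$. Put $V(\mu)=\sup_y\sum_{e\in y}\mu(e)R(e)$, the supremum being over the infinite paths $y$ starting at $o$ and oriented away from $o$, and let $\mathrm{cap}_2(T)=\sup\{|\mu|:\mu\text{ a flow on }T\text{ with }V(\mu)=1\}$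 (with $\sup\emptyset=0$). **Theorem.** For every $N$ the restriction of $\mathbf P$ to $T^{(N)}$ is $\mathbf P^{(N)}$. Moreover, $\mathbf P$ is extremal if and only if $\mathrm{cap}_2(T)=0$; and $X_o^{(N)}$ converges in law to $0$ as $N\to\infty$ if and only if $\mathrm{cap}_2(T)=0$. -/

import Mathlib

open MeasureTheory ProbabilityTheory Filter
open scoped NNReal ENNReal

namespace IsingTree

section Combinatorics

variable {V : Type*} (G : SimpleGraph V) [G.LocallyFinite] (o : V)

/-- `v → w`: the vertex `v` is the parent of `w` in the tree `G` rooted at `o`, that is, `v` is the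
neighbour of `w` that is closer to the root. -/
def IsParent (v w : V) : Prop := G.Adj v w ∧ G.dist o v < G.dist o w

open Classical in
/-- The (finite) set of children of `v` in the tree `G` rooted at `o`. -/
noncomputable def children (v : V) : Finset V :=
  (G.neighborFinset v).filter fun w => IsParent G o v w

open Classical in
/-- The closed ball of radius `N` around the root, built by adding neighbours `N` times: the vertex
set of the truncation `T^(N)`. See `mem_ball`. -/
noncomputable def ball : ℕ → Finset V
  | 0 => {o}
  | N + 1 => ball N ∪ (ball N).biUnion fun v => G.neighborFinset v

theorem mem_ball {G : SimpleGraph V} [G.LocallyFinite] {o : V} (hG : G.Connected) (N : ℕ) (v : V) :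
    v ∈ ball G o N ↔ G.dist o v ≤ N := by
  induction N generalizing v with
  | zero =>
    simp only [ball, Finset.mem_singleton, Nat.le_zero, hG.dist_eq_zero_iff]
    exact eq_comm
  | succ N ih =>
    simp only [ball, Finset.mem_union, Finset.mem_biUnion, SimpleGraph.mem_neighborFinset, ih]
    constructor
    · rintro (h | ⟨u, hu, huv⟩)
      · omega
      · have h1 := hG.dist_triangle (u := o) (v := u) (w := v)
        have h2 : G.dist u v = 1 := SimpleGraph.dist_eq_one_iff_adj.2 huv
        omega
    · intro h
      by_cases h0 : G.dist o v ≤ N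
      · exact Or.inl h0
      · right
        obtain ⟨p, hp⟩ := (hG.preconnected o v).exists_walk_length_eq_dist
        have hnil : ¬ p.Nil := by
          intro hn
          have := SimpleGraph.Walk.length_eq_zero_iff.2 hn
          omega
        refine ⟨p.penultimate, ?_, p.adj_penultimate hnil⟩
        have h3 := SimpleGraph.dist_le p.dropLast
        have h4 : p.dropLast.length = p.length - 1 := by simp
        omega

/-- `y ≤ w`: the vertex `y` lies on the path from the root `o` to `w`. -/
def OnPath (y w : V) : Prop := ∃ p : G.Walk o w, p.IsPath ∧ y ∈ p.support

open Classical in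
/-- The (finite) set of the vertices `y` with `y ≤ w`. See `mem_ancestors`. -/
noncomputable def ancestors (w : V) : Finset V :=
  (ball G o (G.dist o w)).filter fun y => OnPath G o y w

theorem mem_ancestors {G : SimpleGraph V} [G.LocallyFinite] {o : V} (hG : G.IsTree) (y w : V) :
    y ∈ ancestors G o w ↔ OnPath G o y w := by
  classical
  simp only [ancestors, Finset.mem_filter, and_iff_right_iff_imp, mem_ball hG.connected]
  rintro ⟨p, hp, hy⟩
  obtain ⟨q, hq, hl⟩ := hG.connected.exists_path_of_dist o w
  have hpq : p = q := (hG.existsUnique_path o w).unique hp hq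
  subst hpq
  exact (SimpleGraph.dist_le _).trans ((p.length_takeUntil_le_length hy).trans hl.le)

/-! ### Flows and capacities

An edge `v → w` is represented by its endpoint `w ≠ o`; the value at `o` of a function that stands
for a function on the edges is never used. Throughout, the tree is infinite and has no
leaves except possibly the root. -/

/-- A flow: a nonnegative function on the edges such that inflow equals outflow at every vertex
other than the root. -/
def IsFlow (μ : V → ℝ≥0) : Prop := ∀ w, w ≠ o → μ w = ∑ y ∈ children G o w, μ y

/-- The mass of a flow: the outflow from the root. -/
noncomputable def flowMass (μ : V → ℝ≥0) : ℝ≥0∞ := ∑ w ∈ children G o o, (μ w : ℝ≥0∞)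

/-- The boundary of the tree: infinite paths from the root, oriented away from the root. -/
def IsRay (y : ℕ → V) : Prop := y 0 = o ∧ ∀ n, IsParent G o (y n) (y (n + 1))

/-- The potential `V_μ(y) = ∑_{e ∈ y} (μ(e) R(e))^s` along a ray `y`. -/
noncomputable def rayPotential (R : V → ℝ≥0) (s : ℝ) (μ : V → ℝ≥0) (y : ℕ → V) : ℝ≥0∞ :=
  ∑' n : ℕ, ((μ (y (n + 1)) : ℝ≥0∞) * (R (y (n + 1)) : ℝ≥0∞)) ^ s

/-- `V(μ)`, the supremum of `V_μ(y)` over the boundary of the tree. -/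
noncomputable def potential (R : V → ℝ≥0) (s : ℝ) (μ : V → ℝ≥0) : ℝ≥0∞ :=
  ⨆ (y : ℕ → V) (_ : IsRay G o y), rayPotential R s μ y

/-- The `L^p` capacity of the tree with edge resistances `R`: the supremum of the masses of the
flows `μ` with `V(μ) = 1`, where `s = p - 1`. -/
noncomputable def capacity (R : V → ℝ≥0) (p : ℝ) : ℝ≥0∞ :=
  ⨆ (μ : V → ℝ≥0) (_ : IsFlow G o μ) (_ : potential G o R (p - 1) μ = 1), flowMass G o μ

open Classical in
/-- The resistance `∏_{o < y ≤ w} (tanh (β J_y))^{-2}` of the edge into `w`. -/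
noncomputable def resistance (J : V → ℝ) (β : ℝ) (w : V) : ℝ≥0 :=
  ∏ y ∈ (ancestors G o w).erase o, Real.toNNReal ((Real.tanh (β * J y) ^ 2)⁻¹)

end Combinatorics

/-! ### The Ising model

Spins are elements of `ℤˣ = {1, -1}`. The interaction strength `J(vw)` of an edge `v → w` is written
`J w`, so that `J o` is never used. -/

/-- All sets of spins are measurable. -/
instance : MeasurableSingletonClass ℤˣ where
  measurableSet_singleton u :=
    ⟨{(u : ℤ)}, measurableSet_singleton _, by ext v; simp [Units.ext_iff]⟩

/-- The probability on a finite set with weights proportional to `exp (H a)`. -/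
noncomputable def boltzmann {α : Type*} [Finite α] [Nonempty α] (H : α → ℝ) : PMF α :=
  PMF.normalize (fun a => ENNReal.ofReal (Real.exp (H a)))
    (by
      intro h
      have := ENNReal.tsum_eq_zero.1 h (Classical.arbitrary α)
      simp only [ENNReal.ofReal_eq_zero] at this
      exact absurd (Real.exp_pos (H (Classical.arbitrary α))) (not_lt.2 this))
    (by
      have := Fintype.ofFinite α
      rw [tsum_fintype]
      exact ENNReal.sum_ne_top.2 fun a _ => ENNReal.ofReal_ne_top)

section Ising

variable {V : Type*} (G : SimpleGraph V) [G.LocallyFinite] (o : V) (J : V → ℝ) (β : ℝ)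

open Classical in
/-- The exponent `∑_{v → w} β J_w η(v) η(w)` of the weight `W(η)` of a configuration on `T^(N)`; the
sum runs over the edges of `T^(N)`. -/
noncomputable def finiteExponent (N : ℕ) (η : ball G o N → ℤˣ) : ℝ :=
  ∑ v : ball G o N, ∑ w : ball G o N,
    if IsParent G o v w then β * J w * ((η v : ℤ) : ℝ) * ((η w : ℤ) : ℝ) else 0

/-- The Ising model `P^(N)` on `T^(N)` with free boundary: `P(η)` is proportional to `W(η)`. -/
noncomputable def freeIsing (N : ℕ) : Measure (ball G o N → ℤˣ) :=
  (boltzmann (finiteExponent G o J β N)).toMeasure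

instance (N : ℕ) : IsProbabilityMeasure (freeIsing G o J β N) := by
  unfold freeIsing
  infer_instance

/-- The event that a configuration on `T^(N)` agrees with `η` on the boundary of `T^(N)`, which
is the set of vertices at distance `N` from the root. -/
def agreeOnBoundary (N : ℕ) (η : ball G o N → ℤˣ) : Set (ball G o N → ℤˣ) :=
  {ζ | ∀ v : ball G o N, G.dist o v = N → ζ v = η v}

/-- The event that the spin at the root is `s`. -/
def rootSpin (N : ℕ) (s : ℤˣ) : Set (ball G o N → ℤˣ) :=
  {ζ | ∀ v : ball G o N, (v : V) = o → ζ v = s}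

/-- The log-likelihood ratio `X_o^(N)` of plus to minus at the root given the boundary values, as a
random variable on the configurations on `T^(N)`. -/
noncomputable def rootLogLikelihood (N : ℕ) (η : ball G o N → ℤˣ) : ℝ :=
  Real.log
    ((freeIsing G o J β N)[|agreeOnBoundary G o N η].real (rootSpin G o N 1) /
      (freeIsing G o J β N)[|agreeOnBoundary G o N η].real (rootSpin G o N (-1)))

open Classical in
/-- The configuration equal to `σ` on `Λ` and to `ω` off `Λ`. -/
noncomputable def glue (Λ : Finset V) (ω : V → ℤˣ) (σ : Λ → ℤˣ) : V → ℤˣ :=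
  fun v => if h : v ∈ Λ then σ ⟨v, h⟩ else ω v

open Classical in
/-- The exponent `∑ β J_w η(v) η(w)` over the edges `v → w` that have an endpoint in `Λ`. -/
noncomputable def localExponent (Λ : Finset V) (η : V → ℤˣ) : ℝ :=
  ∑ v ∈ Λ ∪ Λ.biUnion (fun u => G.neighborFinset u), ∑ w ∈ children G o v,
    if v ∈ Λ ∨ w ∈ Λ then β * J w * ((η v : ℤ) : ℝ) * ((η w : ℤ) : ℝ) else 0

/-- The Ising model in the finite volume `Λ` with boundary condition `ω` off `Λ`, as a measure
on the configurations on the whole tree. -/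
noncomputable def specification (Λ : Finset V) (ω : V → ℤˣ) : Measure (V → ℤˣ) :=
  (boltzmann fun σ : Λ → ℤˣ => localExponent G o J β Λ (glue Λ ω σ)).toMeasure.map (glue Λ ω)

/-- The Gibbs measures of the Ising model on the tree at inverse temperature `β`: the probability
measures that satisfy the DLR equations. -/
def gibbsMeasures : Set (Measure (V → ℤˣ)) :=
  {μ | IsProbabilityMeasure μ ∧ ∀ (Λ : Finset V) (A : Set (V → ℤˣ)), MeasurableSet A →
    μ A = ∫⁻ ω, specification G o J β Λ ω A ∂μ}

/-- The law of the sign that equals `s` with probability `exp (h s) / (exp h + exp (-h))`, which is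
`(1 + s tanh h) / 2`. -/
noncomputable def signLaw (h : ℝ) : Measure ℤˣ :=
  (boltzmann fun s : ℤˣ => h * ((s : ℤ) : ℝ)).toMeasure

instance (h : ℝ) : IsProbabilityMeasure (signLaw h) := by
  unfold signLaw
  infer_instance

open Classical in
/-- The free boundary Gibbs measure, as a tree-indexed Markov chain: the spin at the root
is a fair sign, and each other vertex `v` independently copies the spin of its parent with
probability `(1 + tanh (β J_v)) / 2` and reverses it otherwise. In terms of independent
signs `ε_v` (`ε_v = 1` means copying, `ε_o` is the spin at the root), the spin at `v` is the product
of the `ε_y` over the vertices `y` on the path from the root to `v`. -/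
noncomputable def freeGibbs : Measure (V → ℤˣ) :=
  (Measure.infinitePi fun v : V => signLaw (if v = o then 0 else β * J v)).map
    fun ε v => ∏ y ∈ ancestors G o v, ε y

/-- A measure is extremal if it is an extreme point of the convex set of Gibbs measures. -/
def IsExtremal (μ : Measure (V → ℤˣ)) : Prop :=
  μ ∈ Set.extremePoints ℝ≥0 (gibbsMeasures G o J β)

end Ising

end IsingTree

namespace IsingTree

open scoped Classical

section Tree

variable {V : Type*} {G : SimpleGraph V} [G.LocallyFinite] {o : V}

theorem mem_children {v w : V} : w ∈ children G o v ↔ IsParent G o v w := by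
  simp only [children, Finset.mem_filter, SimpleGraph.mem_neighborFinset, and_iff_right_iff_imp]
  exact fun h => h.1

omit [G.LocallyFinite] in
theorem IsParent.dist_eq (hT : G.IsTree) {v w : V} (h : IsParent G o v w) :
    G.dist o w = G.dist o v + 1 := by
  have := hT.dist_eq_dist_add_one_of_adj o h.1
  have := h.2
  omega

omit [G.LocallyFinite] in
theorem isParent_or_isParent (hT : G.IsTree) {v w : V} (h : G.Adj v w) :
    IsParent G o v w ∨ IsParent G o w v := by
  rcases hT.dist_eq_dist_add_one_of_adj o h with h1 | h1
  · exact Or.inr ⟨h.symm, by omega⟩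
  · exact Or.inl ⟨h, by omega⟩

omit [G.LocallyFinite] in
theorem IsParent.mem_support (hT : G.IsTree) {v w : V} (h : IsParent G o v w) {p : G.Walk o w}
    (hp : p.IsPath) : v ∈ p.support := by
  obtain ⟨q, hq, hl⟩ := hT.connected.exists_path_of_dist o v
  refine hT.isAcyclic.mem_support_of_ne_mem_support_of_adj_of_isPath hp hq h.1.symm fun hw => ?_
  have h1 := (SimpleGraph.dist_le (q.takeUntil w hw)).trans (q.length_takeUntil_le_length hw)
  have := h.2
  omega

omit [G.LocallyFinite] in
theorem IsParent.unique (hT : G.IsTree) {v v' w : V} (h : IsParent G o v w)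
    (h' : IsParent G o v' w) : v = v' := by
  obtain ⟨p, hp, -⟩ := hT.connected.exists_path_of_dist o w
  rw [hT.isAcyclic.eq_penultimate_of_adj_end hp h.1.symm (h.mem_support hT hp),
    hT.isAcyclic.eq_penultimate_of_adj_end hp h'.1.symm (h'.mem_support hT hp)]

omit [G.LocallyFinite] in
theorem exists_isParent (hT : G.IsTree) {w : V} (hw : w ≠ o) : ∃ v, IsParent G o v w := by
  obtain ⟨p, hp, hl⟩ := hT.connected.exists_path_of_dist o w
  have hnil : ¬ p.Nil := fun hn => hw hn.eq.symm
  refine ⟨p.penultimate, p.adj_penultimate hnil, ?_⟩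
  have h3 := SimpleGraph.dist_le p.dropLast
  have h4 : p.dropLast.length = p.length - 1 := by simp
  have h5 : 0 < G.dist o w := hT.connected.pos_dist_of_ne hw.symm
  omega

omit [G.LocallyFinite] in
theorem IsParent.ne_root {v w : V} (h : IsParent G o v w) : w ≠ o := by
  rintro rfl
  have := h.2
  simp at this

variable (G o) in
/-- The parent of a vertex (and the root itself for the root). -/
noncomputable def parent (w : V) : V :=
  if h : ∃ v, IsParent G o v w then h.choose else w

omit [G.LocallyFinite] in
theorem isParent_parent (hT : G.IsTree) {w : V} (hw : w ≠ o) : IsParent G o (parent G o w) w := by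
  have h := exists_isParent hT hw
  rw [parent, dif_pos h]
  exact h.choose_spec

omit [G.LocallyFinite] in
theorem IsParent.parent_eq (hT : G.IsTree) {v w : V} (h : IsParent G o v w) :
    parent G o w = v :=
  (isParent_parent hT h.ne_root).unique hT h

omit [G.LocallyFinite] in
theorem parent_root : parent G o o = o := by
  rw [parent, dif_neg]
  rintro ⟨v, hv⟩
  exact hv.ne_root rfl

theorem children_disjoint (hT : G.IsTree) {v v' : V} (h : v ≠ v') :
    Disjoint (children G o v) (children G o v') := by
  rw [Finset.disjoint_left]
  intro w h1 h2
  exact h ((mem_children.1 h1).unique hT (mem_children.1 h2))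

theorem children_nonempty [Infinite V] (hT : G.IsTree) (hleaf : ∀ v, v ≠ o → G.degree v ≠ 1)
    (v : V) : (children G o v).Nonempty := by
  by_contra hne
  rw [Finset.not_nonempty_iff_eq_empty] at hne
  have hch : ∀ w, ¬ IsParent G o v w := fun w hw => by
    simpa [hne] using mem_children.2 hw
  by_cases hv : v = o
  · subst hv
    obtain ⟨w, hw⟩ := exists_ne v
    have : Nontrivial V := ⟨w, v, hw⟩
    obtain ⟨u, hu⟩ := hT.connected.preconnected.exists_adj_of_nontrivial v
    rcases isParent_or_isParent (o := v) hT hu with h | h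
    · exact hch _ h
    · exact h.ne_root rfl
  · apply hleaf v hv
    rw [← SimpleGraph.card_neighborFinset_eq_degree, Finset.card_eq_one]
    refine ⟨parent G o v, ?_⟩
    ext u
    simp only [SimpleGraph.mem_neighborFinset, Finset.mem_singleton]
    constructor
    · intro hu
      rcases isParent_or_isParent (o := o) hT hu with h | h
      · exact absurd h (hch _)
      · exact (h.parent_eq hT).symm
    · rintro rfl
      exact (isParent_parent hT hv).1.symm

theorem ancestors_root (hT : G.IsTree) : ancestors G o o = {o} := by
  ext y
  rw [mem_ancestors hT, Finset.mem_singleton]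
  constructor
  · rintro ⟨p, hp, hy⟩
    obtain rfl : p = SimpleGraph.Walk.nil :=
      (hT.existsUnique_path o o).unique hp SimpleGraph.Walk.IsPath.nil
    simpa using hy
  · rintro rfl
    exact ⟨SimpleGraph.Walk.nil, SimpleGraph.Walk.IsPath.nil, by simp⟩

theorem notMem_ancestors (hT : G.IsTree) {v w : V} (h : IsParent G o v w) :
    w ∉ ancestors G o v := by
  rw [mem_ancestors hT]
  rintro ⟨q, hq, hw⟩
  obtain ⟨q', hq', hl⟩ := hT.connected.exists_path_of_dist o v
  obtain rfl : q = q' := (hT.existsUnique_path o v).unique hq hq'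
  have h1 := (SimpleGraph.dist_le (q.takeUntil w hw)).trans (q.length_takeUntil_le_length hw)
  have := h.2
  omega

theorem ancestors_child (hT : G.IsTree) {v w : V} (h : IsParent G o v w) :
    ancestors G o w = insert w (ancestors G o v) := by
  ext y
  rw [Finset.mem_insert, mem_ancestors hT, mem_ancestors hT]
  constructor
  · rintro ⟨p, hp, hy⟩
    obtain ⟨q, hq, -⟩ := hT.connected.exists_path_of_dist o v
    rw [hT.isAcyclic.path_concat hq hp h.1 (h.mem_support hT hp),
      SimpleGraph.Walk.support_concat] at hy
    simp only [List.mem_append, List.mem_singleton] at hy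
    rcases hy with hy | hy
    · exact Or.inr ⟨q, hq, hy⟩
    · exact Or.inl hy
  · rintro (rfl | ⟨q, hq, hy⟩)
    · obtain ⟨p, hp, -⟩ := hT.connected.exists_path_of_dist o y
      exact ⟨p, hp, p.end_mem_support⟩
    · obtain ⟨p, hp, -⟩ := hT.connected.exists_path_of_dist o w
      refine ⟨p, hp, ?_⟩
      rw [hT.isAcyclic.path_concat hq hp h.1 (h.mem_support hT hp),
        SimpleGraph.Walk.support_concat]
      simp [hy]

theorem prod_ancestors_child {M : Type*} [CommMonoid M] (hT : G.IsTree) {v w : V}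
    (h : IsParent G o v w) (f : V → M) :
    ∏ y ∈ (ancestors G o w).erase o, f y = f w * ∏ y ∈ (ancestors G o v).erase o, f y := by
  rw [ancestors_child hT h, Finset.erase_insert_of_ne h.ne_root, Finset.prod_insert]
  exact fun hw => notMem_ancestors hT h (Finset.mem_of_mem_erase hw)

/-! ### Levels and rays -/

variable (G o) in
/-- The vertices at distance `n` from the root. -/
noncomputable def level (n : ℕ) : Finset V := (ball G o n).filter fun v => G.dist o v = n

theorem mem_level (hT : G.IsTree) {n : ℕ} {v : V} : v ∈ level G o n ↔ G.dist o v = n := by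
  rw [level, Finset.mem_filter, mem_ball hT.connected, and_iff_right_iff_imp]
  exact fun h => h.le

theorem level_zero (hT : G.IsTree) : level G o 0 = {o} := by
  ext v
  rw [mem_level hT, hT.connected.dist_eq_zero_iff, Finset.mem_singleton, eq_comm]

theorem level_succ (hT : G.IsTree) (n : ℕ) :
    level G o (n + 1) = (level G o n).biUnion (children G o) := by
  ext w
  simp only [mem_level hT, Finset.mem_biUnion, mem_children]
  constructor
  · intro h
    have hw : w ≠ o := by rintro rfl; simp at h
    have h1 := isParent_parent hT hw
    have := h1.dist_eq hT
    exact ⟨_, by omega, h1⟩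
  · rintro ⟨v, hv, h⟩
    rw [h.dist_eq hT, hv]

theorem prod_level_succ {M : Type*} [CommMonoid M] (hT : G.IsTree) (n : ℕ) (f : V → M) :
    ∏ w ∈ level G o (n + 1), f w = ∏ v ∈ level G o n, ∏ w ∈ children G o v, f w := by
  rw [level_succ hT, Finset.prod_biUnion]
  exact fun v _ v' _ h => children_disjoint hT h

theorem sum_level_succ {M : Type*} [AddCommMonoid M] (hT : G.IsTree) (n : ℕ) (f : V → M) :
    ∑ w ∈ level G o (n + 1), f w = ∑ v ∈ level G o n, ∑ w ∈ children G o v, f w := by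
  rw [level_succ hT, Finset.sum_biUnion]
  exact fun v _ v' _ h => children_disjoint hT h

theorem ball_subset_ball (hT : G.IsTree) {m n : ℕ} (h : m ≤ n) : ball G o m ⊆ ball G o n := by
  intro v
  rw [mem_ball hT.connected, mem_ball hT.connected]
  omega

theorem level_subset_ball {n : ℕ} : level G o n ⊆ ball G o n := Finset.filter_subset _ _

theorem root_mem_ball (hT : G.IsTree) (n : ℕ) : o ∈ ball G o n := by
  simp [mem_ball hT.connected]

theorem ball_erase_succ (hT : G.IsTree) (n : ℕ) :
    (ball G o (n + 1)).erase o = (ball G o n).erase o ∪ level G o (n + 1) := by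
  ext v
  simp only [Finset.mem_erase, Finset.mem_union, mem_ball hT.connected, mem_level hT]
  constructor
  · rintro ⟨h1, h2⟩
    by_cases h : G.dist o v ≤ n
    · exact Or.inl ⟨h1, h⟩
    · exact Or.inr (by omega)
  · rintro (⟨h1, h2⟩ | h)
    · exact ⟨h1, by omega⟩
    · exact ⟨by rintro rfl; simp at h, by omega⟩

theorem disjoint_ball_level (hT : G.IsTree) {m n : ℕ} (h : m < n) :
    Disjoint (ball G o m) (level G o n) := by
  rw [Finset.disjoint_left]
  intro v
  rw [mem_ball hT.connected, mem_level hT]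
  omega

theorem prod_ball_erase_succ {M : Type*} [CommMonoid M] (hT : G.IsTree) (n : ℕ) (f : V → M) :
    ∏ w ∈ (ball G o (n + 1)).erase o, f w =
      (∏ w ∈ (ball G o n).erase o, f w) * ∏ w ∈ level G o (n + 1), f w := by
  rw [ball_erase_succ hT, Finset.prod_union]
  exact (disjoint_ball_level hT n.lt_succ_self).mono_left (Finset.erase_subset _ _)

theorem ball_erase_zero (hT : G.IsTree) : (ball G o 0).erase o = ∅ := by
  ext v
  simp only [Finset.mem_erase, mem_ball hT.connected, Nat.le_zero,
    hT.connected.dist_eq_zero_iff, Finset.notMem_empty, iff_false]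
  rintro ⟨h1, h2⟩
  exact h1 h2.symm

theorem exists_ball_superset (hT : G.IsTree) (s : Finset V) : ∃ n, s ⊆ ball G o n := by
  refine ⟨s.sup (G.dist o), fun v hv => ?_⟩
  rw [mem_ball hT.connected]
  exact Finset.le_sup (f := G.dist o) hv

theorem parent_mem_ball (hT : G.IsTree) {n : ℕ} {w : V} (hw : w ∈ ball G o (n + 1)) :
    parent G o w ∈ ball G o n := by
  by_cases h : w = o
  · rw [h, parent_root]
    exact root_mem_ball hT n
  · have h1 := (isParent_parent hT h).dist_eq hT
    rw [mem_ball hT.connected] at hw ⊢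
    omega

theorem parent_mem_ball' (hT : G.IsTree) {n : ℕ} {w : V} (hw : w ∈ ball G o n) :
    parent G o w ∈ ball G o n :=
  parent_mem_ball hT (ball_subset_ball hT n.le_succ hw)

theorem exists_isRay [Infinite V] (hT : G.IsTree) (hleaf : ∀ v, v ≠ o → G.degree v ≠ 1) (x : V) :
    ∃ y, IsRay G o y ∧ y (G.dist o x) = x := by
  choose c hc using fun v => children_nonempty (o := o) hT hleaf v
  induction hn : G.dist o x generalizing x with
  | zero =>
    rw [hT.connected.dist_eq_zero_iff] at hn
    subst hn
    refine ⟨fun n => c^[n] o, ⟨rfl, fun n => ?_⟩, rfl⟩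
    beta_reduce
    rw [Function.iterate_succ_apply']
    exact mem_children.1 (hc _)
  | succ n ih =>
    have hx : x ≠ o := by rintro rfl; simp at hn
    have hp := isParent_parent hT hx
    have hd := hp.dist_eq hT
    obtain ⟨y, hy, hyn⟩ := ih (parent G o x) (by omega)
    refine ⟨fun k => if k ≤ n then y k else c^[k - (n + 1)] x, ⟨by simp [hy.1], fun k => ?_⟩,
      by simp⟩
    rcases lt_trichotomy k n with h | h | h
    · simp only [h.le, if_true, Nat.succ_le_of_lt h]
      exact hy.2 k
    · subst h
      simpa [hyn] using hp
    · have h1 : k + 1 - (n + 1) = (k - (n + 1)) + 1 := by omega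
      simp only [not_le.2 h, if_false, show ¬ k + 1 ≤ n by omega, h1,
        Function.iterate_succ_apply']
      exact mem_children.1 (hc _)

variable (G o) in
/-- The descendants of `v` that are `k` generations below `v`. -/
noncomputable def desc : ℕ → V → Finset V
  | 0, v => {v}
  | k + 1, v => (children G o v).biUnion (desc k)

theorem iterate_parent_of_mem_desc (hT : G.IsTree) {k : ℕ} {v x : V} (h : x ∈ desc G o k v) :
    (parent G o)^[k] x = v := by
  induction k generalizing v with
  | zero => simpa [desc] using h
  | succ k ih =>
    simp only [desc, Finset.mem_biUnion, mem_children] at h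
    obtain ⟨w, hw, hx⟩ := h
    rw [Function.iterate_succ_apply', ih hx, hw.parent_eq hT]

theorem dist_of_mem_desc (hT : G.IsTree) {k : ℕ} {v x : V} (h : x ∈ desc G o k v) :
    G.dist o x = G.dist o v + k := by
  induction k generalizing v with
  | zero =>
    simp only [desc, Finset.mem_singleton] at h
    simp [h]
  | succ k ih =>
    simp only [desc, Finset.mem_biUnion, mem_children] at h
    obtain ⟨w, hw, hx⟩ := h
    have := ih hx
    have := hw.dist_eq hT
    omega

theorem desc_disjoint (hT : G.IsTree) {k : ℕ} {v v' : V} (h : v ≠ v') :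
    Disjoint (desc G o k v) (desc G o k v') := by
  rw [Finset.disjoint_left]
  intro x h1 h2
  exact h ((iterate_parent_of_mem_desc hT h1).symm.trans (iterate_parent_of_mem_desc hT h2))

theorem desc_subset_of_mem_children {k : ℕ} {v w : V} (h : w ∈ children G o v) :
    desc G o k w ⊆ desc G o (k + 1) v :=
  Finset.subset_biUnion_of_mem (desc G o k) h

theorem desc_subset_level (hT : G.IsTree) {k n : ℕ} {v : V} (h : v ∈ level G o n) :
    desc G o k v ⊆ level G o (n + k) := by
  intro x hx
  rw [mem_level hT] at h ⊢
  rw [dist_of_mem_desc hT hx, h]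

end Tree

section Spins

/-- The value of a spin as a real number. -/
def spin (u : ℤˣ) : ℝ := ((u : ℤ) : ℝ)

@[simp] theorem spin_one : spin 1 = 1 := by simp [spin]

@[simp] theorem spin_neg (u : ℤˣ) : spin (-u) = -spin u := by simp [spin]

theorem spin_mul (u v : ℤˣ) : spin (u * v) = spin u * spin v := by simp [spin]

@[simp] theorem spin_mul_self (u : ℤˣ) : spin u * spin u = 1 := by
  rw [← spin_mul, Int.units_mul_self, spin_one]

theorem sum_spin {M : Type*} [AddCommMonoid M] (f : ℤˣ → M) : ∑ t, f t = f 1 + f (-1) := by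
  rw [show (Finset.univ : Finset ℤˣ) = {1, -1} from rfl, Finset.sum_pair (by decide)]

theorem abs_spin (u : ℤˣ) : |spin u| = 1 := by
  rcases Int.units_eq_one_or u with rfl | rfl <;> simp

theorem one_add_spin_mul_spin (u v : ℤˣ) : 1 + spin u * spin v = if u = v then 2 else 0 := by
  rcases Int.units_eq_one_or u with rfl | rfl <;> rcases Int.units_eq_one_or v with rfl | rfl <;>
    norm_num

end Spins

section Boltzmann

variable {α : Type*} [Finite α] [Nonempty α] [MeasurableSpace α] [MeasurableSingletonClass α]

theorem boltzmann_toMeasure_singleton [Fintype α] (H : α → ℝ) (a : α) :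
    (boltzmann H).toMeasure {a} = ENNReal.ofReal (Real.exp (H a) / ∑ b, Real.exp (H b)) := by
  rw [PMF.toMeasure_apply_singleton _ _ (measurableSet_singleton a), boltzmann,
    PMF.normalize_apply, tsum_fintype, ← ENNReal.ofReal_sum_of_nonneg fun _ _ => (Real.exp_pos _).le,
    ENNReal.ofReal_div_of_pos, div_eq_mul_inv]
  exact Finset.sum_pos (fun _ _ => Real.exp_pos _) Finset.univ_nonempty

theorem eq_boltzmann_toMeasure (H : α → ℝ) (ν : Measure α) [IsProbabilityMeasure ν] (c : ℝ)
    (hν : ∀ a, ν {a} = ENNReal.ofReal (c * Real.exp (H a))) : ν = (boltzmann H).toMeasure := by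
  have := Fintype.ofFinite α
  have hZ : 0 < ∑ b, Real.exp (H b) :=
    Finset.sum_pos (fun _ _ => Real.exp_pos _) Finset.univ_nonempty
  have hc : 0 ≤ c := by
    by_contra hc
    have h0 : ∀ a, ν {a} = 0 := fun a => by
      rw [hν, ENNReal.ofReal_eq_zero]
      exact mul_nonpos_of_nonpos_of_nonneg (not_le.1 hc).le (Real.exp_pos _).le
    have : ν = 0 := Measure.ext_of_singleton fun a => by simp [h0]
    exact IsProbabilityMeasure.ne_zero ν this
  have h1 : ∑ a, ν.real {a} = 1 := by
    rw [sum_measureReal_singleton, Finset.coe_univ, probReal_univ]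
  have h2 : c * ∑ b, Real.exp (H b) = 1 := by
    rw [← h1, Finset.mul_sum]
    refine Finset.sum_congr rfl fun a _ => ?_
    rw [measureReal_def, hν, ENNReal.toReal_ofReal (mul_nonneg hc (Real.exp_pos _).le)]
  refine Measure.ext_of_singleton fun a => ?_
  rw [hν, boltzmann_toMeasure_singleton]
  congr 1
  rw [eq_div_iff hZ.ne', mul_right_comm, h2, one_mul]

theorem signLaw_singleton (h : ℝ) (s : ℤˣ) :
    signLaw h {s} = ENNReal.ofReal ((1 + Real.tanh h * spin s) / 2) := by
  rw [signLaw, boltzmann_toMeasure_singleton, sum_spin]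
  congr 1
  have h1 := Real.exp_pos h
  have h2 := Real.exp_pos (-h)
  rw [Real.tanh_eq_sinh_div_cosh, Real.sinh_eq, Real.cosh_eq]
  rcases Int.units_eq_one_or s with rfl | rfl
  · simp
    field_simp
    ring
  · simp
    field_simp
    ring

end Boltzmann

section Local

variable {V : Type*}

theorem dependsOn_measurable {β : Type*} [MeasurableSpace β] {f : (V → ℤˣ) → β} {B : Finset V}
    (hf : DependsOn f B) : Measurable f := by
  have : f = (fun σ : B → ℤˣ => f (glue B 1 σ)) ∘ B.restrict := by
    funext η
    refine hf fun i hi => ?_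
    simp [glue, Finset.mem_coe.1 hi]
  rw [this]
  exact (measurable_of_finite _).comp (Finset.measurable_restrict B)

/-- A real function of the configuration is local if it depends on finitely many spins. -/
def IsLocal (f : (V → ℤˣ) → ℝ) : Prop := ∃ B : Finset V, DependsOn f B

theorem _root_.DependsOn.isLocal {f : (V → ℤˣ) → ℝ} {B : Finset V} (h : DependsOn f B) :
    IsLocal f := ⟨B, h⟩

theorem IsLocal.measurable {f : (V → ℤˣ) → ℝ} (hf : IsLocal f) : Measurable f := by
  obtain ⟨B, hB⟩ := hf
  exact dependsOn_measurable hB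

theorem IsLocal.bounded {f : (V → ℤˣ) → ℝ} (hf : IsLocal f) : ∃ C, ∀ η, |f η| ≤ C := by
  obtain ⟨B, hB⟩ := hf
  refine ⟨∑ σ : B → ℤˣ, |f (glue B 1 σ)|, fun η => ?_⟩
  have : f η = f (glue B 1 (B.restrict η)) := by
    refine hB fun i hi => ?_
    simp [glue, Finset.mem_coe.1 hi]
  rw [this]
  exact Finset.single_le_sum (f := fun σ : B → ℤˣ => |f (glue B 1 σ)|)
    (fun _ _ => abs_nonneg _) (Finset.mem_univ _)

theorem IsLocal.integrable {f : (V → ℤˣ) → ℝ} (hf : IsLocal f) (μ : Measure (V → ℤˣ))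
    [IsFiniteMeasure μ] : Integrable f μ := by
  obtain ⟨C, hC⟩ := hf.bounded
  exact Integrable.of_bound hf.measurable.aestronglyMeasurable C (Eventually.of_forall hC)

theorem IsLocal.comp₂ {f g : (V → ℤˣ) → ℝ} (hf : IsLocal f) (hg : IsLocal g) (F : ℝ → ℝ → ℝ) :
    IsLocal fun η => F (f η) (g η) := by
  obtain ⟨B, hB⟩ := hf
  obtain ⟨C, hC⟩ := hg
  refine ⟨B ∪ C, fun x y h => ?_⟩
  beta_reduce
  rw [hB fun i hi => h i (by simp [Finset.mem_coe.1 hi]),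
    hC fun i hi => h i (by simp [Finset.mem_coe.1 hi])]

theorem isLocal_const (c : ℝ) : IsLocal fun _ : V → ℤˣ => c := ⟨∅, fun _ _ _ => rfl⟩

theorem IsLocal.comp {f : (V → ℤˣ) → ℝ} (hf : IsLocal f) (F : ℝ → ℝ) :
    IsLocal fun η => F (f η) := hf.comp₂ (isLocal_const 0) fun x _ => F x

theorem IsLocal.mul {f g : (V → ℤˣ) → ℝ} (hf : IsLocal f) (hg : IsLocal g) :
    IsLocal fun η => f η * g η := hf.comp₂ hg _

theorem IsLocal.add {f g : (V → ℤˣ) → ℝ} (hf : IsLocal f) (hg : IsLocal g) :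
    IsLocal fun η => f η + g η := hf.comp₂ hg _

theorem IsLocal.sub {f g : (V → ℤˣ) → ℝ} (hf : IsLocal f) (hg : IsLocal g) :
    IsLocal fun η => f η - g η := hf.comp₂ hg _

theorem IsLocal.sum {ι : Type*} {s : Finset ι} {f : ι → (V → ℤˣ) → ℝ}
    (hf : ∀ i ∈ s, IsLocal (f i)) : IsLocal fun η => ∑ i ∈ s, f i η := by
  induction s using Finset.induction_on with
  | empty => simpa using isLocal_const 0
  | insert a s ha ih =>
    simp only [Finset.sum_insert ha]
    exact (hf a (Finset.mem_insert_self a s)).add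
      (ih fun i hi => hf i (Finset.mem_insert_of_mem hi))

theorem IsLocal.prod {ι : Type*} {s : Finset ι} {f : ι → (V → ℤˣ) → ℝ}
    (hf : ∀ i ∈ s, IsLocal (f i)) : IsLocal fun η => ∏ i ∈ s, f i η := by
  induction s using Finset.induction_on with
  | empty => simpa using isLocal_const 1
  | insert a s ha ih =>
    simp only [Finset.prod_insert ha]
    exact (hf a (Finset.mem_insert_self a s)).mul
      (ih fun i hi => hf i (Finset.mem_insert_of_mem hi))

theorem isLocal_eval (F : ℤˣ → ℝ) (v : V) : IsLocal fun η : V → ℤˣ => F (η v) :=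
  ⟨{v}, fun x y h => by simp [h v (by simp)]⟩

theorem integral_eq_sum_of_dependsOn {f : (V → ℤˣ) → ℝ} {B : Finset V} (hf : DependsOn f B)
    (μ : Measure (V → ℤˣ)) [IsFiniteMeasure μ] :
    ∫ η, f η ∂μ = ∑ σ : B → ℤˣ, (μ.map B.restrict).real {σ} * f (glue B 1 σ) := by
  have h : f = (fun σ : B → ℤˣ => f (glue B 1 σ)) ∘ B.restrict := by
    funext η
    refine hf fun i hi => ?_
    simp [glue, Finset.mem_coe.1 hi]
  conv_lhs => rw [h]
  have h2 := integral_map (μ := μ) (Finset.measurable_restrict B).aemeasurable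
    (f := fun σ : B → ℤˣ => f (glue B 1 σ)) (measurable_of_finite _).aestronglyMeasurable
  simp only [Function.comp]
  rw [← h2, integral_fintype (Integrable.of_finite)]
  rfl

end Local

/-! ### Resampling finitely many fair spins -/

section Uniform

variable {V : Type*}

variable (V) in
/-- The law of independent fair spins. -/
noncomputable def fairSpins : Measure (V → ℤˣ) := Measure.infinitePi fun _ => signLaw 0

instance : IsProbabilityMeasure (fairSpins V) := by
  unfold fairSpins
  infer_instance

theorem glue_of_mem {Λ : Finset V} {v : V} (h : v ∈ Λ) (ω : V → ℤˣ) (σ : Λ → ℤˣ) :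
    glue Λ ω σ v = σ ⟨v, h⟩ := by simp [glue, h]

theorem glue_of_notMem {Λ : Finset V} {v : V} (h : v ∉ Λ) (ω : V → ℤˣ) (σ : Λ → ℤˣ) :
    glue Λ ω σ v = ω v := by simp [glue, h]

/-- The average of a function over fair spins in a finite set. -/
noncomputable def avgOver (Λ : Finset V) (f : (V → ℤˣ) → ℝ) (η : V → ℤˣ) : ℝ :=
  (∑ σ : Λ → ℤˣ, f (glue Λ η σ)) / 2 ^ Λ.card

theorem measurable_glue (Λ : Finset V) (σ : Λ → ℤˣ) : Measurable fun η => glue Λ η σ := by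
  refine measurable_pi_lambda _ fun v => ?_
  by_cases h : v ∈ Λ
  · simp only [glue_of_mem h, measurable_const]
  · simp only [glue_of_notMem h]
    exact measurable_pi_apply v

theorem signLaw_zero_singleton (s : ℤˣ) : signLaw 0 {s} = 2⁻¹ := by
  rw [signLaw_singleton, Real.tanh_zero, zero_mul, add_zero, one_div,
    ENNReal.ofReal_inv_of_pos two_pos]
  simp

theorem signLaw_zero_apply (t : Set ℤˣ) :
    signLaw 0 t = ∑ a : ℤˣ, 2⁻¹ * t.indicator 1 a := by
  rw [← lintegral_indicator_one (Set.toFinite t).measurableSet, lintegral_fintype]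
  refine Finset.sum_congr rfl fun a _ => ?_
  rw [signLaw_zero_singleton, mul_comm]

theorem fairSpins_eq_sum_map_glue (Λ : Finset V) :
    fairSpins V = ∑ σ : Λ → ℤˣ, (2⁻¹ : ℝ≥0∞) ^ Λ.card • (fairSpins V).map fun η => glue Λ η σ := by
  symm
  apply Measure.eq_infinitePi
  intro s t ht
  have hm : MeasurableSet (Set.pi (s : Set V) t) :=
    MeasurableSet.pi s.countable_toSet fun i _ => ht i
  have key : ∀ σ : Λ → ℤˣ, (fairSpins V).map (fun η => glue Λ η σ) (Set.pi s t) =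
      (∏ i ∈ s \ Λ, signLaw 0 (t i)) *
        ∏ i : Λ, if (i : V) ∈ s then (t i).indicator (1 : ℤˣ → ℝ≥0∞) (σ i) else 1 := by
    intro σ
    rw [Measure.map_apply (measurable_glue Λ σ) hm]
    by_cases hσ : ∀ i : Λ, (i : V) ∈ s → σ i ∈ t i
    · have h1 : (fun η => glue Λ η σ) ⁻¹' Set.pi s t = Set.pi ↑(s \ Λ) t := by
        ext η
        simp only [Set.mem_preimage, Set.mem_pi, Finset.mem_coe, Finset.mem_sdiff]
        constructor
        · rintro h i ⟨hi, hi'⟩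
          simpa [glue_of_notMem hi'] using h i hi
        · intro h i hi
          by_cases hi' : i ∈ Λ
          · rw [glue_of_mem hi']
            exact hσ ⟨i, hi'⟩ hi
          · rw [glue_of_notMem hi']
            exact h i ⟨hi, hi'⟩
      rw [h1, fairSpins, Measure.infinitePi_pi _ fun i _ => ht i, Finset.prod_eq_one (s := Finset.univ),
        mul_one]
      intro i _
      split_ifs with hi
      · simp [hσ i hi]
      · rfl
    · push Not at hσ
      obtain ⟨i, hi, hi'⟩ := hσ
      have h1 : (fun η => glue Λ η σ) ⁻¹' Set.pi s t = ∅ := by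
        rw [Set.eq_empty_iff_forall_notMem]
        intro η hη
        have := hη i hi
        simp only [glue_of_mem i.2] at this
        exact hi' this
      rw [h1, measure_empty, Finset.prod_eq_zero (Finset.mem_univ i), mul_zero]
      simp [hi, hi']
  rw [Measure.finsetSum_apply]
  simp only [Measure.smul_apply, key, smul_eq_mul]
  simp only [mul_left_comm _ (∏ i ∈ s \ Λ, signLaw 0 (t i))]
  rw [← Finset.mul_sum, ← Finset.sdiff_union_inter s Λ,
    Finset.prod_union (Finset.disjoint_sdiff_inter s Λ)]
  simp only [Finset.sdiff_union_inter]
  congr 1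
  have h2 : ∀ σ : Λ → ℤˣ, (2⁻¹ : ℝ≥0∞) ^ Λ.card *
      (∏ i : Λ, if (i : V) ∈ s then (t i).indicator (1 : ℤˣ → ℝ≥0∞) (σ i) else 1) =
      ∏ i : Λ, 2⁻¹ * (if (i : V) ∈ s then (t i).indicator (1 : ℤˣ → ℝ≥0∞) (σ i) else 1) := by
    intro σ
    rw [Finset.prod_mul_distrib]
    simp
  simp only [h2]
  rw [← Fintype.prod_sum (fun (i : Λ) (a : ℤˣ) =>
    2⁻¹ * (if (i : V) ∈ s then (t i).indicator (1 : ℤˣ → ℝ≥0∞) a else 1))]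
  have h3 : ∀ i : Λ, ∑ a : ℤˣ, (2⁻¹ : ℝ≥0∞) *
      (if (i : V) ∈ s then (t i).indicator (1 : ℤˣ → ℝ≥0∞) a else 1) =
      if (i : V) ∈ s then signLaw 0 (t i) else 1 := by
    intro i
    split_ifs with hi
    · rw [signLaw_zero_apply]
    · rw [sum_spin, mul_one, ENNReal.inv_two_add_inv_two]
  simp only [h3]
  rw [Finset.univ_eq_attach, Finset.prod_attach Λ fun i => if i ∈ s then signLaw 0 (t i) else 1,
    ← Finset.prod_filter, Finset.filter_mem_eq_inter, Finset.inter_comm]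

theorem IsLocal.glue {f : (V → ℤˣ) → ℝ} (hf : IsLocal f) (Λ : Finset V) (σ : Λ → ℤˣ) :
    IsLocal fun η => f (glue Λ η σ) := by
  obtain ⟨B, hB⟩ := hf
  refine ⟨B, fun x y h => hB fun i hi => ?_⟩
  by_cases hi' : i ∈ Λ
  · rw [glue_of_mem hi', glue_of_mem hi']
  · rw [glue_of_notMem hi', glue_of_notMem hi', h i hi]

theorem integral_avgOver {f : (V → ℤˣ) → ℝ} (hf : IsLocal f) (Λ : Finset V) :
    ∫ η, avgOver Λ f η ∂fairSpins V = ∫ η, f η ∂fairSpins V := by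
  conv_rhs => rw [fairSpins_eq_sum_map_glue Λ]
  rw [integral_finsetSum_measure]
  · simp only [avgOver]
    rw [integral_div, integral_finsetSum _ fun σ _ => (hf.glue Λ σ).integrable _, Finset.sum_div]
    refine Finset.sum_congr rfl fun σ _ => ?_
    rw [integral_smul_measure, integral_map (measurable_glue Λ σ).aemeasurable
      hf.measurable.aestronglyMeasurable]
    simp [div_eq_inv_mul]
  · intro σ _
    have := Measure.isProbabilityMeasure_map (μ := fairSpins V) (measurable_glue Λ σ).aemeasurable
    exact (hf.integrable _).smul_measure (by finiteness)

theorem avgOver_mul_left {f g : (V → ℤˣ) → ℝ} {Λ : Finset V} (hf : DependsOn f (Λ : Set V)ᶜ)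
    (η : V → ℤˣ) : avgOver Λ (fun ζ => f ζ * g ζ) η = f η * avgOver Λ g η := by
  have : ∀ σ : Λ → ℤˣ, f (glue Λ η σ) = f η := fun σ => hf fun i hi => glue_of_notMem hi _ _
  simp only [avgOver, this, ← Finset.mul_sum, mul_div_assoc]

theorem avgOver_eq_integral {f : (V → ℤˣ) → ℝ} {Λ : Finset V} (hf : DependsOn f Λ) (η : V → ℤˣ) :
    avgOver Λ f η = ∫ ζ, f ζ ∂fairSpins V := by
  have h : ∀ ζ, avgOver Λ f ζ = avgOver Λ f η := by
    intro ζ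
    simp only [avgOver]
    congr 1
    refine Finset.sum_congr rfl fun σ _ => hf fun i hi => ?_
    rw [glue_of_mem (Finset.mem_coe.1 hi), glue_of_mem (Finset.mem_coe.1 hi)]
  rw [← integral_avgOver hf.isLocal Λ]
  simp [h]

theorem integral_mul_of_disjoint {f g : (V → ℤˣ) → ℝ} {S : Finset V} (hf : DependsOn f S)
    (hg : DependsOn g (S : Set V)ᶜ) (hg' : IsLocal g) :
    ∫ η, g η * f η ∂fairSpins V = (∫ η, g η ∂fairSpins V) * ∫ η, f η ∂fairSpins V := by
  rw [← integral_avgOver (hg'.mul hf.isLocal) S]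
  simp only [avgOver_mul_left hg, avgOver_eq_integral hf]
  rw [integral_mul_const]

theorem dependsOn_prod {ι : Type*} {I : Finset ι} {f : ι → (V → ℤˣ) → ℝ} {S : Set V}
    (hf : ∀ i ∈ I, DependsOn (f i) S) : DependsOn (fun η => ∏ i ∈ I, f i η) S :=
  fun _ _ h => Finset.prod_congr rfl fun i hi => hf i hi h

theorem integral_prod_of_disjoint {ι : Type*} {I : Finset ι} {f : ι → (V → ℤˣ) → ℝ}
    {S : ι → Finset V} (hf : ∀ i ∈ I, DependsOn (f i) (S i))
    (hS : ∀ i ∈ I, ∀ j ∈ I, i ≠ j → Disjoint (S i) (S j)) :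
    ∫ η, ∏ i ∈ I, f i η ∂fairSpins V = ∏ i ∈ I, ∫ η, f i η ∂fairSpins V := by
  induction I using Finset.induction_on with
  | empty => simp
  | insert a I ha ih =>
    simp only [Finset.prod_insert ha]
    simp only [Finset.forall_mem_insert] at hf hS
    rw [← ih hf.2 fun i hi j hj => (hS.2 i hi).2 j hj, mul_comm]
    simp only [mul_comm (f a _)]
    rw [integral_mul_of_disjoint hf.1 _ (IsLocal.prod fun i hi => (hf.2 i hi).isLocal)]
    refine dependsOn_prod fun i hi => (hf.2 i hi).mono ?_
    have hai : a ≠ i := fun h => ha (h ▸ hi)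
    rw [Set.subset_compl_iff_disjoint_right, Finset.disjoint_coe]
    exact (hS.1.2 i hi hai).symm

theorem avgOver_prod {g : (V → ℤˣ) → ℝ} {F : V → (V → ℤˣ) → ℤˣ → ℝ} {S : Finset V}
    (hg : DependsOn g (S : Set V)ᶜ) (hF : ∀ w ∈ S, ∀ t, DependsOn (fun η => F w η t) (S : Set V)ᶜ)
    (η : V → ℤˣ) :
    avgOver S (fun ζ => g ζ * ∏ w ∈ S, F w ζ (ζ w)) η =
      g η * ∏ w ∈ S, (∑ t, F w η t) / 2 := by
  rw [avgOver_mul_left hg]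
  congr 1
  have h : ∀ σ : S → ℤˣ, ∏ w ∈ S, F w (glue S η σ) (glue S η σ w) = ∏ w : S, F w η (σ w) := by
    intro σ
    rw [← Finset.prod_coe_sort]
    refine Finset.prod_congr rfl fun w _ => ?_
    rw [glue_of_mem w.2]
    exact hF w w.2 _ fun i hi => glue_of_notMem hi _ _
  simp only [avgOver, h]
  rw [← Fintype.prod_sum (fun (w : S) (t : ℤˣ) => F w η t), Finset.prod_div_distrib,
    Finset.prod_const, ← Finset.prod_coe_sort S fun w => ∑ t, F w η t]

end Uniform

section FreeGibbs

variable {V : Type*} {G : SimpleGraph V} [G.LocallyFinite] {o : V} {J : V → ℝ} {β : ℝ}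

variable (G o J β) in
/-- The correlation `tanh (β J_w) η(v) η(w)` over the edge `v → w` from the parent of `w`. -/
noncomputable def edgeCorr (η : V → ℤˣ) (w : V) : ℝ :=
  Real.tanh (β * J w) * spin (η (parent G o w)) * spin (η w)

variable (G o J β) in
/-- The density of the free Ising model on the first `N` levels with respect to fair spins. -/
noncomputable def isingDensity (N : ℕ) (η : V → ℤˣ) : ℝ :=
  ∏ w ∈ (ball G o N).erase o, (1 + edgeCorr G o J β η w)

omit [G.LocallyFinite] in
theorem dependsOn_edgeCorr (w : V) :
    DependsOn (fun η => edgeCorr G o J β η w) {w, parent G o w} := by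
  intro x y h
  simp [edgeCorr, h w, h (parent G o w)]

theorem dependsOn_isingDensity (hT : G.IsTree) (N : ℕ) :
    DependsOn (isingDensity G o J β N) (ball G o N) := by
  refine dependsOn_prod fun w hw => ?_
  have hw' := Finset.mem_of_mem_erase hw
  refine DependsOn.mono ?_ (f := fun η => 1 + edgeCorr G o J β η w) (s := {w, parent G o w})
    (fun x y h => by simp only [dependsOn_edgeCorr w h])
  rintro v (rfl | rfl)
  · exact hw'
  · exact parent_mem_ball' hT hw'

theorem abs_tanh_lt_one (x : ℝ) : |Real.tanh x| < 1 :=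
  abs_lt.2 ⟨Real.neg_one_lt_tanh x, Real.tanh_lt_one x⟩

omit [G.LocallyFinite] in
theorem edgeCorr_lt (η : V → ℤˣ) (w : V) : |edgeCorr G o J β η w| < 1 := by
  rw [edgeCorr, abs_mul, abs_mul, abs_spin, abs_spin, mul_one, mul_one]
  exact abs_tanh_lt_one _

omit [G.LocallyFinite] in
theorem one_add_edgeCorr_pos (η : V → ℤˣ) (w : V) : 0 < 1 + edgeCorr G o J β η w := by
  have := (abs_lt.1 (edgeCorr_lt (G := G) (o := o) (J := J) (β := β) η w)).1
  linarith

theorem isingDensity_pos (N : ℕ) (η : V → ℤˣ) : 0 < isingDensity G o J β N η :=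
  Finset.prod_pos fun w _ => one_add_edgeCorr_pos η w

omit [G.LocallyFinite] in
theorem one_add_edgeCorr_eq (η : V → ℤˣ) (w : V) :
    1 + edgeCorr G o J β η w =
      Real.exp (β * J w * spin (η (parent G o w)) * spin (η w)) / Real.cosh (β * J w) := by
  have hc := (Real.cosh_pos (β * J w)).ne'
  rw [edgeCorr, Real.tanh_eq_sinh_div_cosh]
  have h : spin (η (parent G o w)) * spin (η w) = 1 ∨
      spin (η (parent G o w)) * spin (η w) = -1 := by
    rw [← spin_mul]
    rcases Int.units_eq_one_or (η (parent G o w) * η w) with h | h <;> simp [h]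
  simp only [mul_assoc]
  rw [eq_div_iff hc, add_mul, div_mul_eq_mul_div, div_mul_cancel₀ _ hc]
  rcases h with h | h <;> rw [h]
  · rw [mul_one, mul_one, Real.sinh_eq, Real.cosh_eq]; ring
  · rw [mul_neg_one, mul_neg_one, Real.sinh_eq, Real.cosh_eq, mul_neg]; ring

variable (G o) in
/-- The configuration determined by the copying signs. -/
noncomputable def chainMap (ε : V → ℤˣ) (v : V) : ℤˣ := ∏ y ∈ ancestors G o v, ε y

theorem measurable_chainMap : Measurable (chainMap G o) := by
  refine measurable_pi_lambda _ fun v => ?_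
  refine dependsOn_measurable (B := ancestors G o v) fun x y h => ?_
  exact Finset.prod_congr rfl fun i hi => h i hi

instance : IsProbabilityMeasure (freeGibbs G o J β) := by
  unfold freeGibbs
  exact Measure.isProbabilityMeasure_map (measurable_chainMap (G := G) (o := o)).aemeasurable

theorem chainMap_eq_iff (hT : G.IsTree) (N : ℕ) (ε η : V → ℤˣ) :
    (∀ v ∈ ball G o N, chainMap G o ε v = η v) ↔
      ∀ v ∈ ball G o N, ε v = if v = o then η o else η (parent G o v) * η v := by
  have hroot : chainMap G o ε o = ε o := by simp [chainMap, ancestors_root hT]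
  have hstep : ∀ v, v ≠ o → chainMap G o ε v = ε v * chainMap G o ε (parent G o v) := by
    intro v hv
    rw [chainMap, ancestors_child hT (isParent_parent hT hv),
      Finset.prod_insert (notMem_ancestors hT (isParent_parent hT hv))]
    rfl
  constructor
  · intro h v hv
    split_ifs with h1
    · rw [h1, ← hroot, h o (root_mem_ball hT N)]
    · rw [← h v hv, ← h _ (parent_mem_ball' hT hv), hstep v h1, mul_left_comm, Int.units_mul_self,
        mul_one]
  · intro h v hv
    induction hn : G.dist o v generalizing v with
    | zero =>
      rw [hT.connected.dist_eq_zero_iff] at hn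
      subst hn
      rw [hroot, h _ hv, if_pos rfl]
    | succ n ih =>
      have hv0 : v ≠ o := by rintro rfl; simp at hn
      have := (isParent_parent hT hv0).dist_eq hT
      rw [hstep v hv0, h v hv, if_neg hv0, ih _ (parent_mem_ball' hT hv) (by omega), mul_right_comm,
        Int.units_mul_self, one_mul]

theorem freeGibbs_map_restrict_singleton (hT : G.IsTree) (N : ℕ) (η : V → ℤˣ) :
    (freeGibbs G o J β).map (ball G o N).restrict {(ball G o N).restrict η} =
      ENNReal.ofReal (isingDensity G o J β N η / 2 ^ (ball G o N).card) := by
  rw [Measure.map_apply (Finset.measurable_restrict _) (measurableSet_singleton _), freeGibbs]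
  change (Measure.map (chainMap G o) _) _ = _
  rw [Measure.map_apply measurable_chainMap
    ((Finset.measurable_restrict _) (measurableSet_singleton _))]
  have h1 : chainMap G o ⁻¹' ((ball G o N).restrict ⁻¹' {(ball G o N).restrict η}) =
      Set.pi (ball G o N) fun v => {if v = o then η o else η (parent G o v) * η v} := by
    ext ε
    simp only [Set.mem_preimage, Set.mem_singleton_iff, Set.mem_pi, Finset.mem_coe,
      ← chainMap_eq_iff hT, funext_iff, Finset.restrict, Subtype.forall]
  rw [h1, Measure.infinitePi_pi _ fun i _ => measurableSet_singleton _]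
  have h2 : ∀ v, signLaw (if v = o then 0 else β * J v)
      {if v = o then η o else η (parent G o v) * η v} =
      ENNReal.ofReal ((if v = o then 1 else 1 + edgeCorr G o J β η v) / 2) := by
    intro v
    split_ifs with h
    · rw [signLaw_singleton, Real.tanh_zero, zero_mul, add_zero]
    · rw [signLaw_singleton, spin_mul, edgeCorr, mul_assoc]
  simp only [h2]
  rw [← ENNReal.ofReal_prod_of_nonneg]
  · rw [Finset.prod_div_distrib, Finset.prod_const, isingDensity,
      ← Finset.mul_prod_erase _ _ (root_mem_ball hT N), if_pos rfl, one_mul]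
    congr 2
    exact Finset.prod_congr rfl fun w hw => if_neg (Finset.ne_of_mem_erase hw)
  · intro v _
    split_ifs
    · norm_num
    · linarith [one_add_edgeCorr_pos (G := G) (o := o) (J := J) (β := β) η v]

theorem integral_freeGibbs (hT : G.IsTree) {N : ℕ} {f : (V → ℤˣ) → ℝ}
    (hf : DependsOn f (ball G o N)) :
    ∫ η, f η ∂freeGibbs G o J β = ∫ η, f η * isingDensity G o J β N η ∂fairSpins V := by
  have hd : DependsOn (fun η => f η * isingDensity G o J β N η) (ball G o N) :=
    fun x y h => by simp only [hf h, dependsOn_isingDensity hT N h]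
  rw [integral_eq_sum_of_dependsOn hf, ← avgOver_eq_integral hd 1, avgOver, Finset.sum_div]
  refine Finset.sum_congr rfl fun σ _ => ?_
  have hσ : (ball G o N).restrict (glue (ball G o N) 1 σ) = σ := by
    funext v
    exact glue_of_mem v.2 _ _
  have := freeGibbs_map_restrict_singleton (o := o) (J := J) (β := β) hT N (glue (ball G o N) 1 σ)
  rw [hσ] at this
  rw [measureReal_def, this, ENNReal.toReal_ofReal
    (div_nonneg (isingDensity_pos _ _).le (by positivity)), div_mul_eq_mul_div, mul_comm]

theorem finiteExponent_eq (hT : G.IsTree) (N : ℕ) (η : V → ℤˣ) :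
    finiteExponent G o J β N ((ball G o N).restrict η) =
      ∑ w ∈ (ball G o N).erase o, β * J w * spin (η (parent G o w)) * spin (η w) := by
  rw [finiteExponent, Finset.sum_comm]
  have h1 : ∀ w : ball G o N, (∑ v : ball G o N, if IsParent G o v w then
      β * J w * (((ball G o N).restrict η v : ℤ) : ℝ) * (((ball G o N).restrict η w : ℤ) : ℝ)
        else 0) =
      if (w : V) = o then 0 else β * J w * spin (η (parent G o w)) * spin (η w) := by
    intro w
    split_ifs with hw
    · refine Finset.sum_eq_zero fun v _ => if_neg fun h => h.ne_root hw
    · rw [Finset.sum_eq_single ⟨parent G o w, parent_mem_ball' hT w.2⟩]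
      · rw [if_pos (isParent_parent hT hw)]
        rfl
      · intro v _ hv
        refine if_neg fun h => hv ?_
        exact Subtype.ext (h.parent_eq hT).symm
      · simp
  simp only [h1]
  rw [Finset.sum_coe_sort (ball G o N)
    fun w => if w = o then 0 else β * J w * spin (η (parent G o w)) * spin (η w),
    ← Finset.add_sum_erase _ _ (root_mem_ball hT N), if_pos rfl, zero_add]
  exact Finset.sum_congr rfl fun w hw => if_neg (Finset.ne_of_mem_erase hw)

theorem isingDensity_eq (hT : G.IsTree) (N : ℕ) (η : V → ℤˣ) :
    isingDensity G o J β N η =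
      Real.exp (finiteExponent G o J β N ((ball G o N).restrict η)) /
        ∏ w ∈ (ball G o N).erase o, Real.cosh (β * J w) := by
  simp only [isingDensity, one_add_edgeCorr_eq, Finset.prod_div_distrib, finiteExponent_eq hT,
    Real.exp_sum]

/-- The free boundary Gibbs measure restricts to the free Ising model on the first `N` levels. -/
theorem freeGibbs_map_restrict (hT : G.IsTree) (N : ℕ) :
    (freeGibbs G o J β).map (ball G o N).restrict = freeIsing G o J β N := by
  have := Measure.isProbabilityMeasure_map (μ := freeGibbs G o J β)
    (Finset.measurable_restrict (ball G o N)).aemeasurable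
  refine eq_boltzmann_toMeasure _ _
    ((∏ w ∈ (ball G o N).erase o, Real.cosh (β * J w))⁻¹ / 2 ^ (ball G o N).card) fun σ => ?_
  have hσ : (ball G o N).restrict (glue (ball G o N) 1 σ) = σ := by
    funext v
    exact glue_of_mem v.2 _ _
  have h := freeGibbs_map_restrict_singleton (o := o) (J := J) (β := β) hT N (glue (ball G o N) 1 σ)
  rw [isingDensity_eq hT, hσ] at h
  rw [h]
  congr 1
  ring

/-- The Markov property of the free boundary Gibbs measure: averaging over a level. -/
theorem integral_freeGibbs_level (hT : G.IsTree) {n : ℕ} {f : (V → ℤˣ) → ℝ}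
    (hf : DependsOn f (ball G o n)) (g : V → ℤˣ → ℝ) :
    ∫ η, f η * ∏ w ∈ level G o (n + 1), g w (η w) ∂freeGibbs G o J β =
      ∫ η, f η * ∏ v ∈ level G o n, ∏ w ∈ children G o v,
        (∑ t, (1 + Real.tanh (β * J w) * spin (η v) * spin t) * g w t) / 2
          ∂freeGibbs G o J β := by
  have hsub := ball_subset_ball (o := o) hT n.le_succ
  have hcompl : (ball G o n : Set V) ⊆ (level G o (n + 1) : Set V)ᶜ := by
    rw [Set.subset_compl_iff_disjoint_right, Finset.disjoint_coe]
    exact disjoint_ball_level hT n.lt_succ_self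
  have hd1 : DependsOn (fun η => f η * ∏ w ∈ level G o (n + 1), g w (η w)) (ball G o (n + 1)) := by
    intro x y h
    beta_reduce
    rw [hf fun i hi => h i (hsub hi)]
    congr 1
    exact Finset.prod_congr rfl fun w hw => by rw [h w (level_subset_ball hw)]
  have hd2 : DependsOn (fun η => f η * ∏ v ∈ level G o n, ∏ w ∈ children G o v,
      (∑ t, (1 + Real.tanh (β * J w) * spin (η v) * spin t) * g w t) / 2) (ball G o n) := by
    intro x y h
    beta_reduce
    rw [hf h]
    congr 1
    exact Finset.prod_congr rfl fun v hv => by rw [h v (level_subset_ball hv)]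
  rw [integral_freeGibbs hT hd1, integral_freeGibbs hT hd2,
    ← integral_avgOver (hd1.isLocal.mul (dependsOn_isingDensity hT (n + 1)).isLocal)
      (level G o (n + 1))]
  congr 1
  funext η
  have h1 : (fun ζ => f ζ * (∏ w ∈ level G o (n + 1), g w (ζ w)) * isingDensity G o J β (n + 1) ζ) =
      fun ζ => (f ζ * isingDensity G o J β n ζ) * ∏ w ∈ level G o (n + 1),
        (1 + Real.tanh (β * J w) * spin (ζ (parent G o w)) * spin (ζ w)) * g w (ζ w) := by
    funext ζ
    rw [isingDensity, prod_ball_erase_succ hT, Finset.prod_mul_distrib]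
    simp only [isingDensity, edgeCorr]
    ring
  rw [h1, avgOver_prod (F := fun w ζ t =>
    (1 + Real.tanh (β * J w) * spin (ζ (parent G o w)) * spin t) * g w t), prod_level_succ hT]
  · rw [mul_right_comm]
    congr 2
    refine Finset.prod_congr rfl fun v _ => Finset.prod_congr rfl fun w hw => ?_
    rw [(mem_children.1 hw).parent_eq hT]
  · intro x y h
    beta_reduce
    rw [hf fun i hi => h i (hcompl hi),
      dependsOn_isingDensity hT n fun i hi => h i (hcompl hi)]
  · intro w hw t x y h
    beta_reduce
    rw [h _ (hcompl (parent_mem_ball hT (level_subset_ball hw)))]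

end FreeGibbs

section Likelihood

variable {V : Type*} {G : SimpleGraph V} [G.LocallyFinite] {o : V} {J : V → ℝ} {β : ℝ}

variable (G o J β) in
/-- The likelihood of the spins `τ` of the descendants of `v`, `k` generations below `v`, when the
spin at `v` is `s`, relative to fair spins. -/
noncomputable def likelihood : ℕ → V → ℤˣ → (V → ℤˣ) → ℝ
  | 0, v, s, τ => 1 + spin s * spin (τ v)
  | k + 1, v, s, τ => ∏ w ∈ children G o v,
      (∑ t, (1 + Real.tanh (β * J w) * spin s * spin t) * likelihood k w t τ) / 2

local notation "ℒ" => likelihood G o J β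

theorem dependsOn_likelihood (k : ℕ) (v : V) (s : ℤˣ) : DependsOn (ℒ k v s) (desc G o k v) := by
  induction k generalizing v s with
  | zero =>
    intro x y h
    simp only [likelihood, h v (by simp [desc])]
  | succ k ih =>
    intro x y h
    simp only [likelihood]
    refine Finset.prod_congr rfl fun w hw => ?_
    congr 1
    refine Finset.sum_congr rfl fun t _ => ?_
    rw [ih w t fun i hi => h i (desc_subset_of_mem_children hw hi)]

theorem isLocal_likelihood (k : ℕ) (v : V) (s : ℤˣ) : IsLocal (ℒ k v s) :=
  (dependsOn_likelihood k v s).isLocal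

theorem one_add_tanh_mul_spin_pos (x : ℝ) (s t : ℤˣ) :
    0 < 1 + Real.tanh x * spin s * spin t := by
  have : |Real.tanh x * spin s * spin t| < 1 := by
    rw [abs_mul, abs_mul, abs_spin, abs_spin, mul_one, mul_one]
    exact abs_tanh_lt_one x
  linarith [(abs_lt.1 this).1]

theorem likelihood_nonneg (k : ℕ) (v : V) (s : ℤˣ) (τ : V → ℤˣ) : 0 ≤ ℒ k v s τ := by
  induction k generalizing v s with
  | zero =>
    rw [likelihood, one_add_spin_mul_spin]
    split_ifs <;> norm_num
  | succ k ih =>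
    refine Finset.prod_nonneg fun w _ => div_nonneg (Finset.sum_nonneg fun t _ => ?_) two_pos.le
    exact mul_nonneg (one_add_tanh_mul_spin_pos _ _ _).le (ih w t)

theorem likelihood_add_pos (k : ℕ) (v : V) (τ : V → ℤˣ) :
    0 < ℒ k v 1 τ + ℒ k v (-1) τ ∧ ∀ s, 0 < ℒ (k + 1) v s τ := by
  induction k generalizing v with
  | zero =>
    have h0 : ∀ w, 0 < ℒ 0 w 1 τ + ℒ 0 w (-1) τ := fun w => by
      simp only [likelihood, spin_neg, spin_one]
      linarith
    refine ⟨h0 v, fun s => Finset.prod_pos fun w _ => div_pos ?_ two_pos⟩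
    refine Finset.sum_pos' (fun t _ => mul_nonneg (one_add_tanh_mul_spin_pos _ _ _).le
      (likelihood_nonneg _ _ _ _)) ?_
    by_contra! h
    have h1 := h 1 (Finset.mem_univ _)
    have h2 := h (-1) (Finset.mem_univ _)
    have h3 := nonpos_of_mul_nonpos_right h1 (one_add_tanh_mul_spin_pos _ _ _)
    have h4 := nonpos_of_mul_nonpos_right h2 (one_add_tanh_mul_spin_pos _ _ _)
    linarith [h0 w]
  | succ k ih =>
    refine ⟨add_pos ((ih v).2 1) ((ih v).2 (-1)), fun s => Finset.prod_pos fun w _ =>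
      div_pos (Finset.sum_pos (fun t _ => ?_) Finset.univ_nonempty) two_pos⟩
    exact mul_pos (one_add_tanh_mul_spin_pos _ _ _) ((ih w).2 t)

theorem likelihood_succ (k : ℕ) (v : V) (s : ℤˣ) (τ : V → ℤˣ) :
    ℒ (k + 1) v s τ = ∏ w ∈ children G o v,
      ((ℒ k w 1 τ + ℒ k w (-1) τ) / 2 +
        Real.tanh (β * J w) * spin s * ((ℒ k w 1 τ - ℒ k w (-1) τ) / 2)) := by
  rw [likelihood]
  refine Finset.prod_congr rfl fun w _ => ?_
  rw [sum_spin, spin_neg, spin_one]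
  ring

theorem dependsOn_likelihood_comp₂ (k : ℕ) (v : V) (F : ℝ → ℝ → ℝ) :
    DependsOn (fun τ => F (ℒ k v 1 τ) (ℒ k v (-1) τ)) (desc G o k v) :=
  fun x y h => by simp only [dependsOn_likelihood k v _ h]

theorem integral_likelihood (hT : G.IsTree) (k : ℕ) (v : V) (s : ℤˣ) :
    ∫ τ, ℒ k v s τ ∂fairSpins V = 1 := by
  induction k generalizing v s with
  | zero =>
    rw [← avgOver_eq_integral (dependsOn_likelihood 0 v s) 1]
    have := avgOver_prod (S := {v}) (g := fun _ => 1) (F := fun _ _ t => 1 + spin s * spin t)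
      (fun _ _ _ => rfl) (fun _ _ _ _ _ _ => rfl) 1
    simp only [one_mul, Finset.prod_singleton] at this
    simp only [desc, likelihood]
    refine this.trans ?_
    rw [sum_spin, spin_neg, spin_one]
    ring
  | succ k ih =>
    simp only [likelihood_succ]
    have hi : ∀ w s, Integrable (ℒ k w s) (fairSpins V) := fun w s =>
      (isLocal_likelihood k w s).integrable _
    rw [integral_prod_of_disjoint
      (f := fun w τ => (ℒ k w 1 τ + ℒ k w (-1) τ) / 2 +
        Real.tanh (β * J w) * spin s * ((ℒ k w 1 τ - ℒ k w (-1) τ) / 2))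
      (fun w _ => dependsOn_likelihood_comp₂ k w
        fun a b => (a + b) / 2 + Real.tanh (β * J w) * spin s * ((a - b) / 2))
      fun i _ j _ hij => desc_disjoint hT hij]
    refine Finset.prod_eq_one fun w _ => ?_
    have h1 : ∀ τ, (ℒ k w 1 τ + ℒ k w (-1) τ) / 2 +
        Real.tanh (β * J w) * spin s * ((ℒ k w 1 τ - ℒ k w (-1) τ) / 2) =
        (1 + Real.tanh (β * J w) * spin s) / 2 * ℒ k w 1 τ +
          (1 - Real.tanh (β * J w) * spin s) / 2 * ℒ k w (-1) τ := fun τ => by ring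
    simp only [h1]
    rw [integral_add ((hi w 1).const_mul _) ((hi w (-1)).const_mul _), integral_const_mul,
      integral_const_mul, ih, ih]
    ring

variable (G o J β) in
/-- The density with respect to fair spins of the law of the spins on level `n + k`, under the
measure with density `f` with respect to the free boundary Gibbs measure, when `f` depends on the
spins on the first `n` levels. -/
noncomputable def levelDensity (n k : ℕ) (f : (V → ℤˣ) → ℝ) (τ : V → ℤˣ) : ℝ :=
  ∫ η, f η * ∏ v ∈ level G o n, ℒ k v (η v) τ ∂freeGibbs G o J β

theorem levelDensity_add (hT : G.IsTree) {n : ℕ} {f : (V → ℤˣ) → ℝ}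
    (hf : DependsOn f (ball G o n)) (k j : ℕ) (τ : V → ℤˣ) :
    levelDensity G o J β (n + k) j f τ = levelDensity G o J β n (j + k) f τ := by
  induction k generalizing j with
  | zero => rfl
  | succ k ih =>
    rw [← Nat.succ_add_eq_add_succ j k, ← ih (j + 1), levelDensity, levelDensity]
    exact integral_freeGibbs_level hT (hf.mono
      (Finset.coe_subset.2 (ball_subset_ball hT (Nat.le_add_right n k)))) fun w t => ℒ j w t τ

theorem avgOver_mul_isingDensity (hT : G.IsTree) {n k : ℕ} {f : (V → ℤˣ) → ℝ}
    (hf : DependsOn f (ball G o n)) (τ : V → ℤˣ) :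
    avgOver (ball G o (n + k)) (fun ζ => f ζ * isingDensity G o J β (n + k + 1) ζ) τ =
      levelDensity G o J β n (k + 1) f τ := by
  have hsub : (ball G o n : Set V) ⊆ ball G o (n + k) :=
    Finset.coe_subset.2 (ball_subset_ball hT (Nat.le_add_right n k))
  have hF : DependsOn (fun ζ => f ζ * ∏ v ∈ level G o (n + k), ℒ 1 v (ζ v) τ)
      (ball G o (n + k)) := by
    intro x y hxy
    beta_reduce
    rw [hf.mono hsub hxy]
    congr 1
    exact Finset.prod_congr rfl fun v hv => by rw [hxy v (level_subset_ball hv)]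
  have hFD : DependsOn (fun ζ => (f ζ * ∏ v ∈ level G o (n + k), ℒ 1 v (ζ v) τ) *
      isingDensity G o J β (n + k) ζ) (ball G o (n + k)) := fun x y hxy => by
    simp only [hF hxy, dependsOn_isingDensity hT _ hxy]
  rw [Nat.add_comm k 1, ← levelDensity_add hT hf, levelDensity, integral_freeGibbs hT hF,
    ← avgOver_eq_integral hFD τ, avgOver, avgOver]
  congr 1
  refine Finset.sum_congr rfl fun σ _ => ?_
  set ζ := glue (ball G o (n + k)) τ σ with hζ
  have h2 : ∏ v ∈ level G o (n + k), ℒ 1 v (ζ v) τ =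
      ∏ w ∈ level G o (n + k + 1), (1 + edgeCorr G o J β ζ w) := by
    rw [prod_level_succ hT]
    refine Finset.prod_congr rfl fun v hv => ?_
    rw [likelihood_succ]
    refine Finset.prod_congr rfl fun w hw => ?_
    have hw' : w ∈ level G o (n + k + 1) := by
      rw [level_succ hT]
      exact Finset.mem_biUnion.2 ⟨v, hv, hw⟩
    have h3 : ζ w = τ w := glue_of_notMem
      (Finset.disjoint_right.1 (disjoint_ball_level hT (Nat.lt_succ_self _)) hw') _ _
    simp only [likelihood, edgeCorr, (mem_children.1 hw).parent_eq hT, h3, spin_neg, spin_one]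
    ring
  rw [h2, isingDensity, prod_ball_erase_succ hT, isingDensity]
  ring

/-- The joint law of the first `n` levels and a later level. -/
theorem integral_freeGibbs_mul (hT : G.IsTree) {n k : ℕ} {f h : (V → ℤˣ) → ℝ}
    (hf : DependsOn f (ball G o n)) (hh : DependsOn h (level G o (n + (k + 1)))) :
    ∫ η, f η * h η ∂freeGibbs G o J β =
      ∫ τ, h τ * levelDensity G o J β n (k + 1) f τ ∂fairSpins V := by
  have hsub : (ball G o n : Set V) ⊆ ball G o (n + k + 1) :=
    Finset.coe_subset.2 (ball_subset_ball hT (by omega))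
  have hh' : DependsOn h (ball G o (n + k) : Set V)ᶜ := by
    refine hh.mono ?_
    rw [Set.subset_compl_iff_disjoint_right, Finset.disjoint_coe]
    exact (disjoint_ball_level hT (Nat.lt_succ_self _)).symm
  have hd : DependsOn (fun η => f η * h η) (ball G o (n + k + 1)) := fun x y hxy => by
    beta_reduce
    rw [hf fun i hi => hxy i (hsub hi), hh fun i hi => hxy i (level_subset_ball hi)]
  rw [integral_freeGibbs hT hd,
    ← integral_avgOver (hd.isLocal.mul (dependsOn_isingDensity hT _).isLocal) (ball G o (n + k))]
  congr 1
  funext τ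
  have h1 : (fun ζ => f ζ * h ζ * isingDensity G o J β (n + k + 1) ζ) =
      fun ζ => h ζ * (f ζ * isingDensity G o J β (n + k + 1) ζ) := by
    funext ζ
    ring
  rw [h1, avgOver_mul_left hh', avgOver_mul_isingDensity hT hf]

theorem integral_freeGibbs_root (hT : G.IsTree) (f : ℤˣ → ℝ) :
    ∫ η, f (η o) ∂freeGibbs G o J β = (f 1 + f (-1)) / 2 := by
  have hd : DependsOn (fun η : V → ℤˣ => f (η o)) (ball G o 0) := fun x y h => by
    simp only [h o (root_mem_ball hT 0)]
  rw [integral_freeGibbs hT hd]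
  simp only [isingDensity, ball_erase_zero hT, Finset.prod_empty, mul_one]
  rw [← integral_avgOver (isLocal_eval f o) {o}]
  have := avgOver_prod (S := {o}) (g := fun _ => 1) (F := fun _ _ t => f t)
    (fun _ _ _ => rfl) (fun _ _ _ _ _ _ => rfl)
  simp only [one_mul, Finset.prod_singleton] at this
  simp [this]

theorem levelDensity_root (hT : G.IsTree) (k : ℕ) (f : ℤˣ → ℝ) (τ : V → ℤˣ) :
    levelDensity G o J β 0 k (fun η => f (η o)) τ =
      (f 1 * ℒ k o 1 τ + f (-1) * ℒ k o (-1) τ) / 2 := by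
  simp only [levelDensity, level_zero hT, Finset.prod_singleton]
  exact integral_freeGibbs_root hT fun s => f s * ℒ k o s τ

end Likelihood

theorem sqrt_sq_add_sq_le_integral {α : Type*} [MeasurableSpace α] {μ : Measure α} {f g : α → ℝ}
    (hf : Integrable f μ) (hg : Integrable g μ)
    (hfg : Integrable (fun x => √(f x ^ 2 + g x ^ 2)) μ) :
    √((∫ x, f x ∂μ) ^ 2 + (∫ x, g x ∂μ) ^ 2) ≤ ∫ x, √(f x ^ 2 + g x ^ 2) ∂μ := by
  set a := ∫ x, f x ∂μ
  set b := ∫ x, g x ∂μ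
  set r := √(a ^ 2 + b ^ 2) with hr
  have hr2 : r ^ 2 = a ^ 2 + b ^ 2 := Real.sq_sqrt (by positivity)
  rcases (Real.sqrt_nonneg (a ^ 2 + b ^ 2)).eq_or_lt with h0 | h0
  · rw [hr, ← h0]
    exact integral_nonneg fun x => Real.sqrt_nonneg _
  · rw [← hr] at h0
    refine le_of_mul_le_mul_left ?_ h0
    rw [← pow_two, hr2, ← integral_const_mul]
    have h1 : a ^ 2 + b ^ 2 = ∫ x, a * f x + b * g x ∂μ := by
      rw [integral_add (hf.const_mul a) (hg.const_mul b), integral_const_mul, integral_const_mul,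
        pow_two, pow_two]
    rw [h1]
    refine integral_mono ((hf.const_mul a).add (hg.const_mul b)) (hfg.const_mul r) fun x => ?_
    beta_reduce
    rw [hr, ← Real.sqrt_mul (by positivity)]
    refine Real.le_sqrt_of_sq_le ?_
    nlinarith [sq_nonneg (a * g x - b * f x)]

section Contraction

variable {V : Type*} {G : SimpleGraph V} [G.LocallyFinite] {o : V} {J : V → ℝ} {β : ℝ}

local notation "ℒ" => likelihood G o J β

variable (G o J β) in
/-- The Bhattacharyya coefficient of the laws of the spins `k` generations below `v` given the two
values of the spin at `v`. -/
noncomputable def affinity (k : ℕ) (v : V) : ℝ :=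
  ∫ τ, √(ℒ k v 1 τ * ℒ k v (-1) τ) ∂fairSpins V

variable (G o J β) in
/-- The total variation distance of the laws of the spins `k` generations below `v` given the two
values of the spin at `v`. -/
noncomputable def influence (k : ℕ) (v : V) : ℝ :=
  ∫ τ, |ℒ k v 1 τ - ℒ k v (-1) τ| / 2 ∂fairSpins V

theorem isLocal_likelihood_comp₂ (k : ℕ) (v : V) (F : ℝ → ℝ → ℝ) :
    IsLocal fun τ => F (ℒ k v 1 τ) (ℒ k v (-1) τ) :=
  (isLocal_likelihood k v 1).comp₂ (isLocal_likelihood k v (-1)) F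

theorem integral_half_likelihood (hT : G.IsTree) (k : ℕ) (v : V) :
    ∫ τ, (ℒ k v 1 τ + ℒ k v (-1) τ) / 2 ∂fairSpins V = 1 := by
  rw [integral_div, integral_add ((isLocal_likelihood k v _).integrable _)
    ((isLocal_likelihood k v _).integrable _), integral_likelihood hT, integral_likelihood hT]
  norm_num

theorem influence_nonneg (k : ℕ) (v : V) : 0 ≤ influence G o J β k v :=
  integral_nonneg fun _ => div_nonneg (abs_nonneg _) two_pos.le

theorem influence_sq_add_affinity_sq_le (hT : G.IsTree) (k : ℕ) (v : V) :
    influence G o J β k v ^ 2 + affinity G o J β k v ^ 2 ≤ 1 := by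
  have h1 : ∀ τ, √((|ℒ k v 1 τ - ℒ k v (-1) τ| / 2) ^ 2 +
      √(ℒ k v 1 τ * ℒ k v (-1) τ) ^ 2) = (ℒ k v 1 τ + ℒ k v (-1) τ) / 2 := fun τ => by
    have h2 := likelihood_nonneg (G := G) (o := o) (J := J) (β := β) k v 1 τ
    have h3 := likelihood_nonneg (G := G) (o := o) (J := J) (β := β) k v (-1) τ
    rw [Real.sq_sqrt (mul_nonneg h2 h3), div_pow, sq_abs,
      show (ℒ k v 1 τ - ℒ k v (-1) τ) ^ 2 / 2 ^ 2 + ℒ k v 1 τ * ℒ k v (-1) τ =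
        ((ℒ k v 1 τ + ℒ k v (-1) τ) / 2) ^ 2 by ring, Real.sqrt_sq (by positivity)]
  have h4 := sqrt_sq_add_sq_le_integral (μ := fairSpins V)
    ((isLocal_likelihood_comp₂ (G := G) (o := o) (J := J) (β := β) k v
      fun a b => |a - b| / 2).integrable _)
    ((isLocal_likelihood_comp₂ k v fun a b => √(a * b)).integrable _)
    ((isLocal_likelihood_comp₂ k v
      fun a b => √((|a - b| / 2) ^ 2 + √(a * b) ^ 2)).integrable _)
  simp only [h1, integral_half_likelihood hT] at h4
  exact ((Real.sqrt_le_iff.1 h4).2).trans_eq (one_pow 2)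

theorem prod_le_affinity_succ_sq (hT : G.IsTree) (k : ℕ) (v : V) :
    ∏ w ∈ children G o v, (1 - Real.tanh (β * J w) ^ 2 +
      Real.tanh (β * J w) ^ 2 * affinity G o J β k w ^ 2) ≤ affinity G o J β (k + 1) v ^ 2 := by
  set S : V → (V → ℤˣ) → ℝ := fun w τ => (ℒ k w 1 τ + ℒ k w (-1) τ) / 2 with hS
  set D : V → (V → ℤˣ) → ℝ := fun w τ => (ℒ k w 1 τ - ℒ k w (-1) τ) / 2 with hD
  have hth : ∀ w, 0 ≤ 1 - Real.tanh (β * J w) ^ 2 := fun w => by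
    have := (sq_lt_one_iff_abs_lt_one _).2 (abs_tanh_lt_one (β * J w))
    linarith
  have h1 : ∀ w τ, √((√(1 - Real.tanh (β * J w) ^ 2) * S w τ) ^ 2 +
      (Real.tanh (β * J w) * √(ℒ k w 1 τ * ℒ k w (-1) τ)) ^ 2) =
      √((S w τ + Real.tanh (β * J w) * D w τ) * (S w τ - Real.tanh (β * J w) * D w τ)) := by
    intro w τ
    congr 1
    rw [mul_pow, mul_pow, Real.sq_sqrt (hth w),
      Real.sq_sqrt (mul_nonneg (likelihood_nonneg _ _ _ _) (likelihood_nonneg _ _ _ _))]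
    simp only [hS, hD]
    ring
  have h2 : ∀ w, √(1 - Real.tanh (β * J w) ^ 2 +
      Real.tanh (β * J w) ^ 2 * affinity G o J β k w ^ 2) ≤
      ∫ τ, √((S w τ + Real.tanh (β * J w) * D w τ) * (S w τ - Real.tanh (β * J w) * D w τ))
        ∂fairSpins V := by
    intro w
    have := sqrt_sq_add_sq_le_integral (μ := fairSpins V)
      ((isLocal_likelihood_comp₂ (G := G) (o := o) (J := J) (β := β) k w
        fun a b => √(1 - Real.tanh (β * J w) ^ 2) * ((a + b) / 2)).integrable _)
      ((isLocal_likelihood_comp₂ k w fun a b => Real.tanh (β * J w) * √(a * b)).integrable _)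
      ((isLocal_likelihood_comp₂ k w fun a b => √((√(1 - Real.tanh (β * J w) ^ 2) *
        ((a + b) / 2)) ^ 2 + (Real.tanh (β * J w) * √(a * b)) ^ 2)).integrable _)
    rw [integral_const_mul, integral_const_mul, integral_half_likelihood hT, mul_one, mul_pow,
      Real.sq_sqrt (hth w)] at this
    refine this.trans_eq ?_
    congr 1
    funext τ
    exact h1 w τ
  have h3 : affinity G o J β (k + 1) v = ∏ w ∈ children G o v,
      ∫ τ, √((S w τ + Real.tanh (β * J w) * D w τ) * (S w τ - Real.tanh (β * J w) * D w τ))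
        ∂fairSpins V := by
    rw [← integral_prod_of_disjoint
      (f := fun w τ => √((S w τ + Real.tanh (β * J w) * D w τ) *
        (S w τ - Real.tanh (β * J w) * D w τ)))
      (fun w _ => dependsOn_likelihood_comp₂ k w
        fun a b => √(((a + b) / 2 + Real.tanh (β * J w) * ((a - b) / 2)) *
          ((a + b) / 2 - Real.tanh (β * J w) * ((a - b) / 2))))
      fun i _ j _ hij => desc_disjoint hT hij, affinity]
    congr 1
    funext τ
    have h4 : ∀ w s, 0 ≤ S w τ + Real.tanh (β * J w) * spin s * D w τ := by
      intro w s
      have h5 := one_add_tanh_mul_spin_pos (β * J w) s 1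
      have h6 := one_add_tanh_mul_spin_pos (β * J w) s (-1)
      have h7 := likelihood_nonneg (G := G) (o := o) (J := J) (β := β) k w 1 τ
      have h8 := likelihood_nonneg (G := G) (o := o) (J := J) (β := β) k w (-1) τ
      simp only [spin_one, spin_neg] at h5 h6
      have := add_nonneg (mul_nonneg h5.le h7) (mul_nonneg h6.le h8)
      simp only [hS, hD]
      linarith
    rw [← Real.sqrt_prod, likelihood_succ, likelihood_succ, ← Finset.prod_mul_distrib]
    · congr 1
      refine Finset.prod_congr rfl fun w _ => ?_
      simp only [hS, hD, spin_one, spin_neg]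
      ring
    · intro w _
      have h5 := h4 w 1
      have h6 := h4 w (-1)
      rw [spin_one, mul_one] at h5
      rw [spin_neg, spin_one, mul_neg_one, neg_mul, ← sub_eq_add_neg] at h6
      exact mul_nonneg h5 h6
  rw [h3, ← Finset.prod_pow]
  refine Finset.prod_le_prod (fun w _ => ?_) fun w _ => ?_
  · have := hth w
    positivity
  · have := hth w
    rw [← Real.sq_sqrt (show 0 ≤ 1 - Real.tanh (β * J w) ^ 2 +
      Real.tanh (β * J w) ^ 2 * affinity G o J β k w ^ 2 by positivity)]
    exact pow_le_pow_left₀ (Real.sqrt_nonneg _) (h2 w) 2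

end Contraction

/-! ### A concave recursion -/

section Cayley

/-- The involution `x ↦ (1 - x) / (1 + x)`. -/
noncomputable def cayley (x : ℝ) : ℝ := (1 - x) / (1 + x)

theorem cayley_nonneg {x : ℝ} (h0 : 0 ≤ x) (h1 : x ≤ 1) : 0 ≤ cayley x :=
  div_nonneg (by linarith) (by linarith)

theorem cayley_le_one {x : ℝ} (h0 : 0 ≤ x) : cayley x ≤ 1 := by
  rw [cayley, div_le_one (by linarith)]
  linarith

theorem cayley_antitone {x y : ℝ} (h0 : 0 ≤ x) (h : x ≤ y) : cayley y ≤ cayley x := by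
  rw [cayley, cayley, div_le_div_iff₀ (by linarith) (by linarith)]
  nlinarith

theorem cayley_mul_le {x y : ℝ} (hx : 0 ≤ x) (hx1 : x ≤ 1) (hy : 0 ≤ y) (hy1 : y ≤ 1) :
    cayley (x * y) ≤ cayley x + cayley y := by
  have hxy := mul_nonneg hx hy
  have : cayley x + cayley y = cayley (x * y) * (1 + cayley x * cayley y) := by
    simp only [cayley]
    field_simp
    ring
  rw [this]
  exact le_mul_of_one_le_right (cayley_nonneg hxy (mul_le_one₀ hx1 hy hy1))
    (by linarith [mul_nonneg (cayley_nonneg hx hx1) (cayley_nonneg hy hy1)])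

theorem cayley_prod_le {ι : Type*} {s : Finset ι} {x : ι → ℝ} (h0 : ∀ i ∈ s, 0 ≤ x i)
    (h1 : ∀ i ∈ s, x i ≤ 1) : cayley (∏ i ∈ s, x i) ≤ ∑ i ∈ s, cayley (x i) := by
  induction s using Finset.induction_on with
  | empty => simp [cayley]
  | insert a s ha ih =>
    rw [Finset.forall_mem_insert] at h0 h1
    rw [Finset.prod_insert ha, Finset.sum_insert ha]
    exact (cayley_mul_le h0.1 h1.1 (Finset.prod_nonneg h0.2)
      (Finset.prod_le_one h0.2 h1.2)).trans (add_le_add_right (ih h0.2 h1.2) _)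

theorem cayley_mix {b x c : ℝ} (hb : 0 ≤ b) (hc : 0 ≤ c) (hbc : c ≤ 1 - b) (h0 : 0 ≤ x)
    (h1 : x ≤ 1) : cayley (1 - b + b * x) ≤ b * (cayley x / (1 + c * cayley x)) := by
  have hb1 : b ≤ 1 := by linarith
  have hbx := mul_nonneg hb h0
  have h2 : 0 ≤ cayley x := cayley_nonneg h0 h1
  have h3 : cayley (1 - b + b * x) = b * (cayley x / (1 + (1 - b) * cayley x)) := by
    simp only [cayley]
    have h5 : 0 < 1 + x + (1 - b) * (1 - x) := by nlinarith
    have h6 : 0 < 1 + (1 - b + b * x) := by linarith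
    field_simp
    ring
  rw [h3]
  gcongr

end Cayley

/-! ### Voltages -/

section Network

variable {V : Type*} {G : SimpleGraph V} [G.LocallyFinite] {o : V}

/-- The conductance of a conductor of conductance `x` in series with a resistance `c`. -/
noncomputable def series (c x : ℝ) : ℝ := x / (1 + c * x)

theorem series_nonneg {c x : ℝ} (hc : 0 ≤ c) (hx : 0 ≤ x) : 0 ≤ series c x :=
  div_nonneg hx (by positivity)

theorem series_le {c x : ℝ} (hc : 0 < c) (hx : 0 ≤ x) : series c x ≤ c⁻¹ := by
  rw [series, div_le_iff₀ (by positivity), mul_add, inv_mul_cancel_left₀ hc.ne']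
  have := inv_pos.2 hc
  linarith

theorem series_mono {c x y : ℝ} (hc : 0 ≤ c) (hx : 0 ≤ x) (h : x ≤ y) :
    series c x ≤ series c y := by
  have hy := hx.trans h
  rw [series, series, div_le_div_iff₀ (by positivity) (by positivity)]
  linarith

variable (G o) in
/-- The conductance, seen through the edge above a vertex, of the next `k` generations when the
last of them is grounded. -/
noncomputable def conductance (b : V → ℝ) (c : ℝ) : ℕ → V → ℝ
  | 0, _ => c⁻¹
  | k + 1, v => series c (∑ w ∈ children G o v, b w * conductance b c k w)

variable {b : V → ℝ} {c : ℝ}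

theorem conductance_nonneg (hb : ∀ w, 0 ≤ b w) (hc : 0 < c) (k : ℕ) (v : V) :
    0 ≤ conductance G o b c k v := by
  induction k generalizing v with
  | zero => exact (inv_pos.2 hc).le
  | succ k ih => exact series_nonneg hc.le (Finset.sum_nonneg fun w _ => mul_nonneg (hb w) (ih w))

theorem conductance_antitone (hb : ∀ w, 0 ≤ b w) (hc : 0 < c) (v : V) :
    Antitone fun k => conductance G o b c k v := by
  refine antitone_nat_of_succ_le fun k => ?_
  have hs : ∀ k v, 0 ≤ ∑ w ∈ children G o v, b w * conductance G o b c k w := fun k v =>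
    Finset.sum_nonneg fun w _ => mul_nonneg (hb w) (conductance_nonneg hb hc k w)
  induction k generalizing v with
  | zero => exact series_le hc (hs 0 v)
  | succ k ih =>
    exact series_mono hc.le (hs _ v)
      (Finset.sum_le_sum fun w _ => mul_le_mul_of_nonneg_left (ih w) (hb w))

variable (G o) in
/-- The conductance, seen through the edge above a vertex, of the infinite tree below it. -/
noncomputable def conductanceLim (b : V → ℝ) (c : ℝ) (v : V) : ℝ :=
  ⨅ k, conductance G o b c k v

theorem tendsto_conductance (hb : ∀ w, 0 ≤ b w) (hc : 0 < c) (v : V) :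
    Tendsto (fun k => conductance G o b c k v) atTop (nhds (conductanceLim G o b c v)) :=
  tendsto_atTop_ciInf (conductance_antitone hb hc v)
    ⟨0, by rintro _ ⟨k, rfl⟩; exact conductance_nonneg hb hc k v⟩

variable (G o) in
/-- The conductance of the infinite tree below a vertex. -/
noncomputable def conductanceBelow (b : V → ℝ) (c : ℝ) (v : V) : ℝ :=
  ∑ w ∈ children G o v, b w * conductanceLim G o b c w

theorem conductanceLim_nonneg (hb : ∀ w, 0 ≤ b w) (hc : 0 < c) (v : V) :
    0 ≤ conductanceLim G o b c v :=
  le_ciInf fun k => conductance_nonneg hb hc k v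

theorem conductanceBelow_nonneg (hb : ∀ w, 0 ≤ b w) (hc : 0 < c) (v : V) :
    0 ≤ conductanceBelow G o b c v :=
  Finset.sum_nonneg fun w _ => mul_nonneg (hb w) (conductanceLim_nonneg hb hc w)

theorem conductanceLim_eq (hb : ∀ w, 0 ≤ b w) (hc : 0 < c) (v : V) :
    conductanceLim G o b c v = series c (conductanceBelow G o b c v) := by
  have h1 := (tendsto_conductance (G := G) (o := o) hb hc v).comp (tendsto_add_atTop_nat 1)
  have h2 : Tendsto (fun k => ∑ w ∈ children G o v, b w * conductance G o b c k w) atTop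
      (nhds (conductanceBelow G o b c v)) :=
    tendsto_finsetSum _ fun w _ => (tendsto_conductance hb hc w).const_mul _
  have h3 := h2.div ((h2.const_mul c).const_add 1)
    (by have := conductanceBelow_nonneg (G := G) (o := o) hb hc v; positivity)
  exact tendsto_nhds_unique h1 h3

theorem conductanceBelow_child_eq_zero (hb : ∀ w, 0 ≤ b w) (hc : 0 < c) {v w : V}
    (hw : w ∈ children G o v) (hbw : 0 < b w) (h : conductanceBelow G o b c v = 0) :
    conductanceBelow G o b c w = 0 := by
  rw [conductanceBelow, Finset.sum_eq_zero_iff_of_nonneg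
    fun w _ => mul_nonneg (hb w) (conductanceLim_nonneg hb hc w)] at h
  have h1 := (mul_eq_zero.1 (h w hw)).resolve_left hbw.ne'
  have h2 := conductanceBelow_nonneg (G := G) (o := o) hb hc w
  rw [conductanceLim_eq hb hc, series, div_eq_zero_iff] at h1
  exact h1.resolve_right (by positivity)

theorem conductanceBelow_eq_zero (hT : G.IsTree) (hb : ∀ w, 0 ≤ b w) (hb' : ∀ w, w ≠ o → 0 < b w)
    (hc : 0 < c) (h : conductanceBelow G o b c o = 0) (v : V) :
    conductanceBelow G o b c v = 0 := by
  induction hn : G.dist o v generalizing v with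
  | zero =>
    rw [hT.connected.dist_eq_zero_iff] at hn
    rwa [← hn]
  | succ n ih =>
    have hv : v ≠ o := by rintro rfl; simp at hn
    have hp := isParent_parent hT hv
    have := hp.dist_eq hT
    exact conductanceBelow_child_eq_zero hb hc (mem_children.2 hp) (hb' v hv)
      (ih _ (by omega))

end Network

section InfluenceBound

variable {V : Type*} {G : SimpleGraph V} [G.LocallyFinite] {o : V} {J : V → ℝ} {β c : ℝ}

theorem series_cayley_affinity_le (hT : G.IsTree) (hc : 0 < c)
    (hJ : ∀ w, w ≠ o → c ≤ 1 - Real.tanh (β * J w) ^ 2) (k : ℕ) (v : V) :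
    series c (cayley (affinity G o J β k v ^ 2)) ≤
      conductance G o (fun w => Real.tanh (β * J w) ^ 2) c k v := by
  have hZ0 : ∀ k v, 0 ≤ affinity G o J β k v ^ 2 := fun k v => sq_nonneg _
  have hZ1 : ∀ k v, affinity G o J β k v ^ 2 ≤ 1 := fun k v => by
    have := influence_sq_add_affinity_sq_le (J := J) (β := β) (o := o) hT k v
    nlinarith [sq_nonneg (influence G o J β k v)]
  induction k generalizing v with
  | zero => exact series_le hc (cayley_nonneg (hZ0 0 v) (hZ1 0 v))
  | succ k ih =>
    refine series_mono hc.le (cayley_nonneg (hZ0 _ v) (hZ1 _ v)) ?_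
    have hth : ∀ w, Real.tanh (β * J w) ^ 2 ≤ 1 := fun w =>
      ((sq_lt_one_iff_abs_lt_one _).2 (abs_tanh_lt_one (β * J w))).le
    have h0 : ∀ w, 0 ≤ 1 - Real.tanh (β * J w) ^ 2 +
        Real.tanh (β * J w) ^ 2 * affinity G o J β k w ^ 2 := fun w => by
      nlinarith [hth w, mul_nonneg (sq_nonneg (Real.tanh (β * J w))) (hZ0 k w)]
    refine (cayley_antitone (Finset.prod_nonneg fun w _ => h0 w)
      (prod_le_affinity_succ_sq hT k v)).trans ?_
    refine (cayley_prod_le (fun w _ => h0 w) fun w _ => ?_).trans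
      (Finset.sum_le_sum fun w hw => ?_)
    · nlinarith [hZ1 k w, sq_nonneg (Real.tanh (β * J w))]
    · exact (cayley_mix (sq_nonneg _) hc.le (hJ w (mem_children.1 hw).ne_root) (hZ0 k w)
        (hZ1 k w)).trans (mul_le_mul_of_nonneg_left (ih w) (sq_nonneg _))

theorem tendsto_influence (hT : G.IsTree) (hc : 0 < c)
    (hJ : ∀ w, w ≠ o → c ≤ 1 - Real.tanh (β * J w) ^ 2)
    (hJ' : ∀ w, w ≠ o → 0 < Real.tanh (β * J w) ^ 2)
    (h : conductanceBelow G o (fun w => Real.tanh (β * J w) ^ 2) c o = 0) (v : V) :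
    Tendsto (fun k => influence G o J β k v) atTop (nhds 0) := by
  have hb : ∀ w, 0 ≤ (fun w => Real.tanh (β * J w) ^ 2) w := fun w => sq_nonneg _
  have h1 : conductanceLim G o (fun w => Real.tanh (β * J w) ^ 2) c v = 0 := by
    rw [conductanceLim_eq hb hc, conductanceBelow_eq_zero hT hb hJ' hc h, series, zero_div]
  have h2 := tendsto_conductance (G := G) (o := o) hb hc v
  rw [h1] at h2
  have h3 : ∀ k, influence G o J β k v ^ 2 ≤
      2 * (1 + c) * conductance G o (fun w => Real.tanh (β * J w) ^ 2) c k v := by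
    intro k
    have h4 := series_cayley_affinity_le hT hc hJ k v
    have h5 := influence_sq_add_affinity_sq_le (J := J) (β := β) (o := o) hT k v
    set x := affinity G o J β k v ^ 2
    have hx0 : 0 ≤ x := sq_nonneg _
    have hx1 : x ≤ 1 := by nlinarith [sq_nonneg (influence G o J β k v)]
    have h6 : 1 - x ≤ 2 * cayley x := by
      rw [cayley, mul_div_assoc', le_div_iff₀ (by linarith)]
      nlinarith
    have h7 : cayley x ≤ (1 + c) * series c (cayley x) := by
      have h8 := cayley_nonneg hx0 hx1
      have h9 := cayley_le_one hx0
      rw [series, mul_div_assoc', le_div_iff₀ (by positivity), mul_comm]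
      gcongr
      nlinarith
    have h10 := mul_le_mul_of_nonneg_left h4 (show 0 ≤ 1 + c by linarith)
    linarith
  have h4 : Tendsto (fun k => influence G o J β k v ^ 2) atTop (nhds 0) := by
    refine squeeze_zero (fun k => sq_nonneg _) h3 ?_
    simpa using h2.const_mul (2 * (1 + c))
  have h5 := (Real.continuous_sqrt.tendsto 0).comp h4
  simpa [Function.comp_def, Real.sqrt_sq (influence_nonneg _ _)] using h5

end InfluenceBound

/-! ### Flows and the capacity -/

section Capacity

variable {V : Type*} {G : SimpleGraph V} [G.LocallyFinite] {o : V} {R : V → ℝ≥0}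

theorem rayPotential_one (μ : V → ℝ≥0) (y : ℕ → V) :
    rayPotential R 1 μ y = ∑' n, (μ (y (n + 1)) : ℝ≥0∞) * R (y (n + 1)) := by
  simp [rayPotential]

theorem capacity_two_ne_zero_iff :
    capacity G o R 2 ≠ 0 ↔
      ∃ μ, IsFlow G o μ ∧ potential G o R 1 μ = 1 ∧ flowMass G o μ ≠ 0 := by
  rw [capacity, show (2 : ℝ) - 1 = 1 by norm_num]
  simp only [ne_eq, ENNReal.iSup_eq_zero, not_forall, exists_prop]

theorem capacity_two_ne_zero [Infinite V] (hT : G.IsTree) (hleaf : ∀ v, v ≠ o → G.degree v ≠ 1)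
    (hR : ∀ w, R w ≠ 0) {μ : V → ℝ≥0} (hμ : IsFlow G o μ) (hm : flowMass G o μ ≠ 0)
    (hV : potential G o R 1 μ ≠ ⊤) : capacity G o R 2 ≠ 0 := by
  rw [capacity_two_ne_zero_iff]
  set p := potential G o R 1 μ with hp
  have hp0 : p ≠ 0 := by
    intro h0
    apply hm
    refine Finset.sum_eq_zero fun w hw => ?_
    obtain ⟨y, hy, hyw⟩ := exists_isRay (o := o) hT hleaf w
    have hd := (mem_children.1 hw).dist_eq hT
    rw [SimpleGraph.dist_self, zero_add] at hd
    rw [hd] at hyw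
    simp only [hp, potential, ENNReal.iSup_eq_zero] at h0
    have h1 := h0 y hy
    rw [rayPotential_one, ENNReal.tsum_eq_zero] at h1
    have h2 := h1 0
    rw [zero_add, hyw] at h2
    exact (mul_eq_zero.1 h2).resolve_right (by exact_mod_cast hR w)
  have hscale : ((p.toNNReal⁻¹ : ℝ≥0) : ℝ≥0∞) = p⁻¹ := by
    rw [ENNReal.coe_inv (by simp [ENNReal.toNNReal_eq_zero_iff, hp0, hV]), ENNReal.coe_toNNReal hV]
  refine ⟨fun w => p.toNNReal⁻¹ * μ w, fun w hw => ?_, ?_, ?_⟩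
  · simp only [← Finset.mul_sum, ← hμ w hw]
  · have h1 : ∀ y, rayPotential R 1 (fun w => p.toNNReal⁻¹ * μ w) y =
        p⁻¹ * rayPotential R 1 μ y := fun y => by
      rw [rayPotential_one, rayPotential_one, ← ENNReal.tsum_mul_left]
      simp only [ENNReal.coe_mul, hscale, mul_assoc]
    simp only [potential, h1, ← ENNReal.mul_iSup]
    exact ENNReal.inv_mul_cancel hp0 hV
  · simp only [flowMass, ENNReal.coe_mul, hscale, ← Finset.mul_sum]
    exact mul_ne_zero (ENNReal.inv_ne_zero.2 hV) hm

end Capacity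

section UnitVoltage

variable {V : Type*} {G : SimpleGraph V} [G.LocallyFinite] {o : V} {J : V → ℝ} {β c : ℝ}

variable (G o) in
/-- The voltage at a vertex when the root has unit voltage. -/
noncomputable def voltage (K : V → ℝ) (c : ℝ) (v : V) : ℝ :=
  ∏ y ∈ (ancestors G o v).erase o, (1 + c * K y)⁻¹

theorem resistance_pos (hJ : ∀ w, w ≠ o → 0 < Real.tanh (β * J w) ^ 2) (w : V) :
    0 < resistance G o J β w := by
  refine Finset.prod_pos fun y hy => ?_
  rw [Real.toNNReal_pos]
  exact inv_pos.2 (hJ y (Finset.ne_of_mem_erase hy))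

theorem resistance_child (hT : G.IsTree) {v w : V} (h : IsParent G o v w) :
    (resistance G o J β w : ℝ) = (Real.tanh (β * J w) ^ 2)⁻¹ * resistance G o J β v := by
  rw [resistance, prod_ancestors_child hT h, NNReal.coe_mul,
    Real.coe_toNNReal _ (inv_nonneg.2 (sq_nonneg _))]
  rfl

theorem voltage_child (hT : G.IsTree) {v w : V} (h : IsParent G o v w) (K : V → ℝ) :
    voltage G o K c w = (1 + c * K w)⁻¹ * voltage G o K c v := by
  rw [voltage, prod_ancestors_child hT h]
  rfl

theorem voltage_root (hT : G.IsTree) (K : V → ℝ) : voltage G o K c o = 1 := by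
  simp [voltage, ancestors_root hT]

theorem resistance_root (hT : G.IsTree) : resistance G o J β o = 1 := by
  simp [resistance, ancestors_root hT]

theorem capacity_ne_zero_of_conductanceBelow [Infinite V] (hT : G.IsTree)
    (hleaf : ∀ v, v ≠ o → G.degree v ≠ 1) (hc : 0 < c)
    (hJ : ∀ w, w ≠ o → 0 < Real.tanh (β * J w) ^ 2)
    (h : conductanceBelow G o (fun w => Real.tanh (β * J w) ^ 2) c o ≠ 0) :
    capacity G o (resistance G o J β) 2 ≠ 0 := by
  have hb : ∀ w, 0 ≤ (fun w => Real.tanh (β * J w) ^ 2) w := fun w => sq_nonneg _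
  set K := conductanceBelow G o (fun w => Real.tanh (β * J w) ^ 2) c with hK
  have hK0 : ∀ v, 0 ≤ K v := conductanceBelow_nonneg hb hc
  have hden : ∀ v, 0 < 1 + c * K v := fun v => by have := hK0 v; positivity
  set U := voltage G o K c with hU
  have hU0 : ∀ v, 0 ≤ U v := fun v =>
    Finset.prod_nonneg fun y _ => inv_nonneg.2 (hden y).le
  set R := resistance G o J β with hR
  have hR0 : ∀ v, 0 < (R v : ℝ) := fun v => NNReal.coe_pos.2 (resistance_pos hJ v)
  have hflow : ∀ v, U v * K v / R v = ∑ w ∈ children G o v, U w * K w / R w := by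
    intro v
    have h1 : K v = ∑ w ∈ children G o v, Real.tanh (β * J w) ^ 2 * (K w / (1 + c * K w)) := by
      conv_lhs => rw [hK, conductanceBelow]
      simp only [conductanceLim_eq hb hc]
      rfl
    conv_lhs => rw [h1]
    rw [Finset.mul_sum, Finset.sum_div]
    refine Finset.sum_congr rfl fun w hw => ?_
    have hp := mem_children.1 hw
    have h2 := (hJ w hp.ne_root).ne'
    rw [hU, voltage_child hT hp, hR, resistance_child hT hp]
    have h3 := (hR0 v).ne'
    have h4 := (hden w).ne'
    rw [hR] at h3
    field_simp
  set μ : V → ℝ≥0 := fun v => Real.toNNReal (U v * K v / R v) with hμ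
  have hμ0 : ∀ v, 0 ≤ U v * K v / R v := fun v => by
    have := hU0 v; have := hK0 v; have := hR0 v; positivity
  have hμc : ∀ v, (μ v : ℝ) = U v * K v / R v := fun v => Real.coe_toNNReal _ (hμ0 v)
  have hsum : ∀ v, μ v = ∑ w ∈ children G o v, μ w := by
    intro v
    rw [← NNReal.coe_inj, NNReal.coe_sum, hμc, hflow]
    simp only [hμc]
  refine capacity_two_ne_zero hT hleaf (fun w => (resistance_pos hJ w).ne') (μ := μ)
    (fun w _ => hsum w) ?_ (ne_top_of_le_ne_top (b := ENNReal.ofReal c⁻¹) ENNReal.ofReal_ne_top ?_)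
  · rw [flowMass, ← ENNReal.ofNNReal_finsetSum, ← hsum]
    simp only [hμ, hU, hR, voltage_root hT, resistance_root hT, ne_eq, ENNReal.coe_eq_zero,
      Real.toNNReal_eq_zero, not_le, NNReal.coe_one, div_one, one_mul]
    exact (hK0 o).lt_of_ne' h
  · refine iSup₂_le fun y hy => ?_
    rw [rayPotential_one]
    refine ENNReal.tsum_le_of_sum_range_le fun n => ?_
    have h1 : ∀ n, ∑ i ∈ Finset.range n, (μ (y (i + 1)) : ℝ) * R (y (i + 1)) =
        (1 - U (y n)) / c := by
      intro n
      induction n with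
      | zero => simp [hy.1, hU, voltage_root hT]
      | succ n ih =>
        rw [Finset.sum_range_succ, ih, hμc, div_mul_cancel₀ _ (hR0 _).ne', hU,
          voltage_child hT (hy.2 n)]
        have h4 := (hden (y (n + 1))).ne'
        field_simp
        ring
    have h2 : ∑ i ∈ Finset.range n, (μ (y (i + 1)) : ℝ≥0∞) * R (y (i + 1)) =
        ENNReal.ofReal (∑ i ∈ Finset.range n, (μ (y (i + 1)) : ℝ) * R (y (i + 1))) := by
      rw [ENNReal.ofReal_sum_of_nonneg fun i _ => by positivity]
      refine Finset.sum_congr rfl fun i _ => ?_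
      rw [ENNReal.ofReal_mul NNReal.zero_le_coe, ENNReal.ofReal_coe_nnreal,
        ENNReal.ofReal_coe_nnreal]
    rw [h2, h1, div_eq_mul_inv]
    apply ENNReal.ofReal_le_ofReal
    exact mul_le_of_le_one_left (inv_nonneg.2 hc.le) (by linarith [hU0 (y n)])

/-- If the tree has no capacity then distant spins have a vanishing influence on each vertex. -/
theorem tendsto_influence_of_capacity_eq_zero [Infinite V] (hT : G.IsTree)
    (hleaf : ∀ v, v ≠ o → G.degree v ≠ 1) (hc : 0 < c)
    (hJ : ∀ w, w ≠ o → c ≤ 1 - Real.tanh (β * J w) ^ 2)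
    (hJ' : ∀ w, w ≠ o → 0 < Real.tanh (β * J w) ^ 2)
    (h : capacity G o (resistance G o J β) 2 = 0) (v : V) :
    Tendsto (fun k => influence G o J β k v) atTop (nhds 0) := by
  refine tendsto_influence hT hc hJ hJ' ?_ v
  by_contra hne
  exact capacity_ne_zero_of_conductanceBelow hT hleaf hc hJ' hne h

end UnitVoltage

/-! ### Specifications -/

section Specification

variable {V : Type*} {G : SimpleGraph V} [G.LocallyFinite] {o : V} {J : V → ℝ} {β : ℝ}

theorem measure_ext_of_isLocal {μ ν : Measure (V → ℤˣ)} [IsFiniteMeasure μ] [IsFiniteMeasure ν]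
    (h : ∀ A : Set (V → ℤˣ), MeasurableSet A → IsLocal (A.indicator 1) → μ A = ν A) : μ = ν := by
  have h1 : ∀ I : Finset V, ν.map I.restrict = μ.map I.restrict := by
    intro I
    refine Measure.ext_of_singleton fun σ => ?_
    have hm : MeasurableSet (I.restrict ⁻¹' {σ} : Set (V → ℤˣ)) :=
      Finset.measurable_restrict I (measurableSet_singleton σ)
    rw [Measure.map_apply (Finset.measurable_restrict I) (measurableSet_singleton σ),
      Measure.map_apply (Finset.measurable_restrict I) (measurableSet_singleton σ)]
    refine (h _ hm ⟨I, fun x y hxy => ?_⟩).symm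
    have h2 : I.restrict x = I.restrict y := funext fun i => hxy i i.2
    simp only [Set.indicator, Set.mem_preimage, h2, Pi.one_apply]
  exact IsProjectiveLimit.unique (P := fun I : Finset V => μ.map I.restrict) (fun I => rfl) h1

variable (G o J β) in
/-- The probability that the Ising model in `Λ` with boundary condition `ω` gives to `σ`. -/
noncomputable def specWeight (Λ : Finset V) (σ : Λ → ℤˣ) (ω : V → ℤˣ) : ℝ :=
  Real.exp (localExponent G o J β Λ (glue Λ ω σ)) /
    ∑ σ' : Λ → ℤˣ, Real.exp (localExponent G o J β Λ (glue Λ ω σ'))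

theorem specification_apply (Λ : Finset V) (ω : V → ℤˣ) {A : Set (V → ℤˣ)}
    (hA : MeasurableSet A) :
    specification G o J β Λ ω A =
      ∑ σ : Λ → ℤˣ, ENNReal.ofReal (specWeight G o J β Λ σ ω) * A.indicator 1 (glue Λ ω σ) := by
  have hm : Measurable (glue Λ ω) := measurable_of_finite _
  rw [specification, Measure.map_apply hm hA, ← lintegral_indicator_one (hm hA), lintegral_fintype]
  refine Finset.sum_congr rfl fun σ _ => ?_
  rw [boltzmann_toMeasure_singleton, mul_comm]
  rfl

theorem localExponent_eq (hT : G.IsTree) {Λ : Finset V} {n : ℕ} (hΛ : Λ ⊆ ball G o n)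
    (η : V → ℤˣ) :
    localExponent G o J β Λ η = ∑ w ∈ (ball G o (n + 1)).erase o,
      if w ∈ Λ ∨ parent G o w ∈ Λ then β * J w * spin (η (parent G o w)) * spin (η w) else 0 := by
  set S := Λ ∪ Λ.biUnion fun u => G.neighborFinset u with hS
  have h1 : localExponent G o J β Λ η = ∑ w ∈ S.biUnion (children G o),
      if w ∈ Λ ∨ parent G o w ∈ Λ then
        β * J w * spin (η (parent G o w)) * spin (η w) else 0 := by
    rw [Finset.sum_biUnion fun v _ v' _ h => children_disjoint hT h, localExponent]
    refine Finset.sum_congr (by rw [hS]) fun v _ => Finset.sum_congr rfl fun w hw => ?_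
    simp only [(mem_children.1 hw).parent_eq hT, or_comm (a := v ∈ Λ) (b := w ∈ Λ)]
    rfl
  rw [h1, ← Finset.sum_filter, ← Finset.sum_filter]
  refine Finset.sum_congr ?_ fun _ _ => rfl
  ext w
  simp only [Finset.mem_filter, Finset.mem_biUnion, Finset.mem_erase, mem_children, hS,
    Finset.mem_union, SimpleGraph.mem_neighborFinset]
  constructor
  · rintro ⟨⟨v, -, hv⟩, h⟩
    refine ⟨⟨hv.ne_root, ?_⟩, h⟩
    rw [hv.parent_eq hT] at h
    have hd := hv.dist_eq hT
    rw [mem_ball hT.connected]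
    rcases h with h | h
    · have := (mem_ball hT.connected n w).1 (hΛ h)
      omega
    · have := (mem_ball hT.connected n v).1 (hΛ h)
      omega
  · rintro ⟨⟨hw, -⟩, h⟩
    have hp := isParent_parent hT hw
    refine ⟨⟨_, ?_, hp⟩, h⟩
    rcases h with h | h
    · exact Or.inr ⟨w, h, hp.1.symm⟩
    · exact Or.inl h

theorem dependsOn_isingDensity_div (hT : G.IsTree) {Λ : Finset V} {n : ℕ} (hΛ : Λ ⊆ ball G o n) :
    DependsOn (fun η => isingDensity G o J β (n + 1) η / Real.exp (localExponent G o J β Λ η))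
      (Λ : Set V)ᶜ := by
  intro x y h
  have h1 : ∀ η : V → ℤˣ,
      isingDensity G o J β (n + 1) η / Real.exp (localExponent G o J β Λ η) =
      Real.exp (∑ w ∈ (ball G o (n + 1)).erase o, if w ∈ Λ ∨ parent G o w ∈ Λ then 0 else
        β * J w * spin (η (parent G o w)) * spin (η w)) /
        ∏ w ∈ (ball G o (n + 1)).erase o, Real.cosh (β * J w) := by
    intro η
    rw [isingDensity_eq hT, div_right_comm, ← Real.exp_sub, finiteExponent_eq hT,
      localExponent_eq hT hΛ, ← Finset.sum_sub_distrib]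
    congr 2
    refine Finset.sum_congr rfl fun w _ => ?_
    split_ifs <;> simp
  beta_reduce
  rw [h1, h1]
  congr 2
  refine Finset.sum_congr rfl fun w _ => ?_
  split_ifs with hw
  · rfl
  · push Not at hw
    rw [h w hw.1, h _ hw.2]

theorem specWeight_eq (hT : G.IsTree) {Λ : Finset V} {n : ℕ} (hΛ : Λ ⊆ ball G o n) (σ : Λ → ℤˣ)
    (ω : V → ℤˣ) :
    specWeight G o J β Λ σ ω = isingDensity G o J β (n + 1) (glue Λ ω σ) /
      ∑ σ' : Λ → ℤˣ, isingDensity G o J β (n + 1) (glue Λ ω σ') := by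
  set c := isingDensity G o J β (n + 1) (glue Λ ω σ) /
    Real.exp (localExponent G o J β Λ (glue Λ ω σ)) with hc
  have h1 : ∀ σ', isingDensity G o J β (n + 1) (glue Λ ω σ') =
      c * Real.exp (localExponent G o J β Λ (glue Λ ω σ')) := by
    intro σ'
    have := dependsOn_isingDensity_div (o := o) (J := J) (β := β) hT hΛ
      (x := glue Λ ω σ) (y := glue Λ ω σ') fun i hi => by
        rw [glue_of_notMem hi, glue_of_notMem hi]
    beta_reduce at this
    rw [hc, this, div_mul_cancel₀ _ (Real.exp_pos _).ne']
  have hc0 : c ≠ 0 := (div_pos (isingDensity_pos _ _) (Real.exp_pos _)).ne'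
  simp only [h1, ← Finset.mul_sum]
  rw [mul_div_mul_left _ _ hc0]
  rfl

theorem specification_apply_eq (hT : G.IsTree) {Λ : Finset V} {n : ℕ} (hΛ : Λ ⊆ ball G o n)
    (ω : V → ℤˣ) {A : Set (V → ℤˣ)} (hA : MeasurableSet A) :
    specification G o J β Λ ω A = ENNReal.ofReal
      (avgOver Λ (fun ζ => A.indicator 1 ζ * isingDensity G o J β (n + 1) ζ) ω /
        avgOver Λ (isingDensity G o J β (n + 1)) ω) := by
  rw [specification_apply Λ ω hA, avgOver, avgOver, div_div_div_cancel_right₀ (by positivity),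
    Finset.sum_div, ENNReal.ofReal_sum_of_nonneg]
  · refine Finset.sum_congr rfl fun σ _ => ?_
    rw [specWeight_eq hT hΛ]
    by_cases h : glue Λ ω σ ∈ A <;> simp [h]
  · intro σ _
    refine div_nonneg (mul_nonneg ?_ (isingDensity_pos _ _).le)
      (Finset.sum_nonneg fun _ _ => (isingDensity_pos _ _).le)
    exact Set.indicator_nonneg (fun _ _ => zero_le_one) _

theorem isLocal_specWeight (hT : G.IsTree) (Λ : Finset V) (σ : Λ → ℤˣ) :
    IsLocal (specWeight G o J β Λ σ) := by
  obtain ⟨n, hn⟩ := exists_ball_superset (o := o) hT Λ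
  have h := (dependsOn_isingDensity (J := J) (β := β) (o := o) hT (n + 1)).isLocal
  rw [funext fun ω => specWeight_eq (J := J) (β := β) hT hn σ ω]
  exact (h.glue Λ σ).comp₂ (IsLocal.sum fun σ' _ => h.glue Λ σ') fun x y => x / y

theorem avgOver_pos {f : (V → ℤˣ) → ℝ} (hf : ∀ η, 0 < f η) (Λ : Finset V) (η : V → ℤˣ) :
    0 < avgOver Λ f η :=
  div_pos (Finset.sum_pos (fun _ _ => hf _) Finset.univ_nonempty) (by positivity)

theorem dependsOn_avgOver (f : (V → ℤˣ) → ℝ) (Λ : Finset V) :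
    DependsOn (avgOver Λ f) (Λ : Set V)ᶜ := by
  intro x y h
  simp only [avgOver]
  congr 1
  refine Finset.sum_congr rfl fun σ _ => ?_
  congr 1
  funext v
  by_cases hv : v ∈ Λ
  · rw [glue_of_mem hv, glue_of_mem hv]
  · rw [glue_of_notMem hv, glue_of_notMem hv, h v hv]

theorem DependsOn.avgOver {f : (V → ℤˣ) → ℝ} {S : Set V} (hf : DependsOn f S) (Λ : Finset V) :
    DependsOn (avgOver Λ f) S := by
  intro x y h
  simp only [IsingTree.avgOver]
  congr 1
  refine Finset.sum_congr rfl fun σ _ => hf fun v hv => ?_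
  by_cases hv' : v ∈ Λ
  · rw [glue_of_mem hv', glue_of_mem hv']
  · rw [glue_of_notMem hv', glue_of_notMem hv', h v hv]

variable (G o J β) in
/-- The measure obtained from `μ` by resampling the spins in `Λ`. -/
noncomputable def resample (Λ : Finset V) (μ : Measure (V → ℤˣ)) : Measure (V → ℤˣ) :=
  ∑ σ : Λ → ℤˣ, (μ.withDensity fun ω => ENNReal.ofReal (specWeight G o J β Λ σ ω)).map
    fun ω => glue Λ ω σ

theorem lintegral_specification (hT : G.IsTree) (Λ : Finset V) (μ : Measure (V → ℤˣ))
    {A : Set (V → ℤˣ)} (hA : MeasurableSet A) :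
    ∫⁻ ω, specification G o J β Λ ω A ∂μ = resample G o J β Λ μ A := by
  have hp : ∀ σ, Measurable fun ω => ENNReal.ofReal (specWeight G o J β Λ σ ω) := fun σ =>
    (isLocal_specWeight hT Λ σ).measurable.ennreal_ofReal
  have hi : ∀ σ, Measurable fun ω => A.indicator (1 : (V → ℤˣ) → ℝ≥0∞) (glue Λ ω σ) := fun σ =>
    (measurable_one.indicator hA).comp (measurable_glue Λ σ)
  simp only [specification_apply Λ _ hA]
  rw [lintegral_finsetSum (f := fun σ ω => ENNReal.ofReal (specWeight G o J β Λ σ ω) *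
    A.indicator 1 (glue Λ ω σ)) _ fun σ _ => (hp σ).mul (hi σ), resample, Measure.finsetSum_apply]
  refine Finset.sum_congr rfl fun σ _ => ?_
  rw [Measure.map_apply (measurable_glue Λ σ) hA,
    ← lintegral_indicator_one (measurable_glue Λ σ hA),
    lintegral_withDensity_eq_lintegral_mul _ (hp σ)
      (measurable_one.indicator (measurable_glue Λ σ hA))]
  rfl

theorem lintegral_specification_freeGibbs (hT : G.IsTree) (Λ : Finset V) {A : Set (V → ℤˣ)}
    (hA : MeasurableSet A) (hA' : IsLocal (A.indicator 1)) :
    ∫⁻ ω, specification G o J β Λ ω A ∂freeGibbs G o J β = freeGibbs G o J β A := by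
  obtain ⟨B, hB⟩ := hA'
  obtain ⟨n, hn⟩ := exists_ball_superset (o := o) hT (Λ ∪ B)
  have hΛ : Λ ⊆ ball G o n := Finset.union_subset_left hn
  have hAn : DependsOn (A.indicator (1 : (V → ℤˣ) → ℝ)) (ball G o (n + 1)) := hB.mono
    (Finset.coe_subset.2 ((Finset.union_subset_right hn).trans (ball_subset_ball hT n.le_succ)))
  have hD := dependsOn_isingDensity (J := J) (β := β) (o := o) hT (n + 1)
  have hAD : DependsOn (fun ζ => A.indicator 1 ζ * isingDensity G o J β (n + 1) ζ)
      (ball G o (n + 1)) := fun x y h => by simp only [hAn h, hD h]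
  set g : (V → ℤˣ) → ℝ := fun ω =>
    avgOver Λ (fun ζ => A.indicator 1 ζ * isingDensity G o J β (n + 1) ζ) ω /
        avgOver Λ (isingDensity G o J β (n + 1)) ω with hg
  have hgd : DependsOn g (ball G o (n + 1)) := fun x y h => by
    simp only [hg, DependsOn.avgOver hAD Λ h, DependsOn.avgOver hD Λ h]
  have hgΛ : DependsOn g (Λ : Set V)ᶜ := fun x y h => by
    simp only [hg, dependsOn_avgOver _ Λ h]
  have hg0 : ∀ ω, 0 ≤ g ω := fun ω => by
    refine div_nonneg (div_nonneg (Finset.sum_nonneg fun σ _ => mul_nonneg ?_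
      (isingDensity_pos _ _).le) (by positivity)) (avgOver_pos (isingDensity_pos _) Λ ω).le
    exact Set.indicator_nonneg (fun _ _ => zero_le_one) _
  simp only [specification_apply_eq hT hΛ _ hA]
  rw [← ofReal_integral_eq_lintegral_ofReal (hgd.isLocal.integrable _) (Eventually.of_forall hg0),
    integral_freeGibbs hT hgd, ← integral_avgOver (hgd.isLocal.mul hD.isLocal) Λ]
  simp only [avgOver_mul_left hgΛ]
  have h1 : ∀ ω, g ω * avgOver Λ (isingDensity G o J β (n + 1)) ω =
      avgOver Λ (fun ζ => A.indicator 1 ζ * isingDensity G o J β (n + 1) ζ) ω := fun ω =>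
    div_mul_cancel₀ _ (avgOver_pos (isingDensity_pos _) Λ ω).ne'
  rw [show (isingDensity G o J β (n + 1)) = fun ζ => isingDensity G o J β (n + 1) ζ from rfl] at h1
  simp only [h1]
  rw [integral_avgOver hAD.isLocal, ← integral_freeGibbs hT hAn, integral_indicator_one hA,
    ofReal_measureReal]

theorem freeGibbs_mem_gibbsMeasures (hT : G.IsTree) :
    freeGibbs G o J β ∈ gibbsMeasures G o J β := by
  refine ⟨inferInstance, fun Λ A hA => ?_⟩
  have hfin : IsFiniteMeasure (resample G o J β Λ (freeGibbs G o J β)) := by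
    constructor
    rw [← lintegral_specification hT Λ _ MeasurableSet.univ,
      lintegral_specification_freeGibbs hT Λ MeasurableSet.univ]
    · finiteness
    · rw [Set.indicator_univ]
      exact isLocal_const 1
  rw [lintegral_specification hT Λ _ hA]
  congr 1
  refine measure_ext_of_isLocal fun B hB hB' => ?_
  rw [← lintegral_specification hT Λ _ hB, lintegral_specification_freeGibbs hT Λ hB hB']

theorem cond_mem_gibbsMeasures {μ : Measure (V → ℤˣ)}
    (hμ : μ ∈ gibbsMeasures G o J β) {A : Set (V → ℤˣ)} (hA : MeasurableSet A) (hA0 : μ A ≠ 0)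
    (htail : ∀ (Λ : Finset V) (ω : V → ℤˣ) (σ : Λ → ℤˣ), glue Λ ω σ ∈ A ↔ ω ∈ A) :
    μ[|A] ∈ gibbsMeasures G o J β := by
  have := hμ.1
  refine ⟨cond_isProbabilityMeasure hA0, fun Λ B hB => ?_⟩
  rw [cond_apply hA, hμ.2 Λ (A ∩ B) (hA.inter hB), ProbabilityTheory.cond, lintegral_smul_measure,
    ← lintegral_indicator hA]
  congr 2
  funext ω
  rw [specification_apply Λ ω (hA.inter hB)]
  by_cases hω : ω ∈ A
  · rw [Set.indicator_of_mem hω, specification_apply Λ ω hB]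
    refine Finset.sum_congr rfl fun σ _ => ?_
    by_cases hσ : glue Λ ω σ ∈ B <;> simp [hσ, (htail Λ ω σ).2 hω]
  · rw [Set.indicator_of_notMem hω]
    refine Finset.sum_eq_zero fun σ _ => ?_
    simp [htail Λ ω σ, hω]

end Specification

/-! ### Extremality -/

theorem abs_prod_add_sub_prod_le {ι : Type*} (s : Finset ι) {a b : ι → ℝ}
    (ha : ∀ i ∈ s, 0 ≤ a i) :
    |∏ i ∈ s, (a i + b i) - ∏ i ∈ s, a i| ≤ ∏ i ∈ s, (a i + |b i|) - ∏ i ∈ s, a i := by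
  induction s using Finset.induction_on with
  | empty => simp
  | insert j s hj ih =>
    rw [Finset.forall_mem_insert] at ha
    rw [Finset.prod_insert hj, Finset.prod_insert hj, Finset.prod_insert hj]
    have h1 := ih ha.2
    set P := ∏ i ∈ s, (a i + b i)
    set Q := ∏ i ∈ s, a i
    set P' := ∏ i ∈ s, (a i + |b i|) with hP'
    have hQ : 0 ≤ Q := Finset.prod_nonneg ha.2
    have hP : |P| ≤ P' := by
      rw [Finset.abs_prod]
      refine Finset.prod_le_prod (fun _ _ => abs_nonneg _) fun i hi => ?_
      exact (abs_add_le _ _).trans_eq (by rw [abs_of_nonneg (ha.2 i hi)])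
    calc |(a j + b j) * P - a j * Q| = |a j * (P - Q) + b j * P| := by congr 1; ring
      _ ≤ a j * |P - Q| + |b j| * |P| := by
        refine (abs_add_le _ _).trans_eq ?_
        rw [abs_mul, abs_mul, abs_of_nonneg ha.1]
      _ ≤ a j * (P' - Q) + |b j| * P' := by
        have := mul_le_mul_of_nonneg_left h1 ha.1
        have := mul_le_mul_of_nonneg_left hP (abs_nonneg (b j))
        linarith
      _ = _ := by ring

section Extremal

variable {V : Type*} {G : SimpleGraph V} [G.LocallyFinite] {o : V} {J : V → ℝ} {β : ℝ}

local notation "ℒ" => likelihood G o J β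

theorem abs_levelDensity_sub_le (n k : ℕ) {f : (V → ℤˣ) → ℝ}
    (hf : DependsOn f (ball G o n)) (hf1 : ∀ η, |f η| ≤ 1) (τ : V → ℤˣ) :
    |levelDensity G o J β n k f τ - (∫ η, f η ∂freeGibbs G o J β) *
        ∏ v ∈ level G o n, ((ℒ k v 1 τ + ℒ k v (-1) τ) / 2)| ≤
      ∏ v ∈ level G o n, ((ℒ k v 1 τ + ℒ k v (-1) τ) / 2 + |ℒ k v 1 τ - ℒ k v (-1) τ| / 2) -
        ∏ v ∈ level G o n, ((ℒ k v 1 τ + ℒ k v (-1) τ) / 2) := by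
  have hloc : IsLocal fun η => f η * ∏ v ∈ level G o n, ℒ k v (η v) τ :=
    hf.isLocal.mul (IsLocal.prod fun v _ => isLocal_eval (fun s => ℒ k v s τ) v)
  rw [levelDensity, ← integral_mul_const,
    ← integral_sub (hloc.integrable _) ((hf.isLocal.integrable _).mul_const _)]
  refine (Real.norm_eq_abs _).symm.trans_le ?_
  refine (norm_integral_le_of_norm_le_const (μ := freeGibbs G o J β) (Eventually.of_forall
    fun η => ?_)).trans_eq (by rw [probReal_univ, mul_one])
  rw [← mul_sub, norm_mul]
  refine (mul_le_of_le_one_left (norm_nonneg _) (hf1 η)).trans ?_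
  have h1 : ∀ v, ℒ k v (η v) τ = (ℒ k v 1 τ + ℒ k v (-1) τ) / 2 +
      spin (η v) * ((ℒ k v 1 τ - ℒ k v (-1) τ) / 2) := by
    intro v
    rcases Int.units_eq_one_or (η v) with h | h
    · rw [h, spin_one]; ring
    · rw [h, spin_neg, spin_one]; ring
  simp only [h1]
  refine (abs_prod_add_sub_prod_le _ fun v _ => ?_).trans_eq ?_
  · exact div_nonneg (add_nonneg (likelihood_nonneg _ _ _ _) (likelihood_nonneg _ _ _ _))
      two_pos.le
  · simp only [abs_mul, abs_spin, one_mul, abs_div, abs_two]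

theorem integral_prod_sub_prod (hT : G.IsTree) (n k : ℕ) :
    ∫ τ, (∏ v ∈ level G o n, ((ℒ k v 1 τ + ℒ k v (-1) τ) / 2 + |ℒ k v 1 τ - ℒ k v (-1) τ| / 2) -
      ∏ v ∈ level G o n, ((ℒ k v 1 τ + ℒ k v (-1) τ) / 2)) ∂fairSpins V =
      ∏ v ∈ level G o n, (1 + influence G o J β k v) - 1 := by
  have h1 := fun v (_ : v ∈ level G o n) => dependsOn_likelihood_comp₂
    (G := G) (o := o) (J := J) (β := β) k v fun a b => (a + b) / 2 + |a - b| / 2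
  have h2 := fun v (_ : v ∈ level G o n) => dependsOn_likelihood_comp₂
    (G := G) (o := o) (J := J) (β := β) k v fun a b => (a + b) / 2
  rw [integral_sub ((IsLocal.prod fun v hv => (h1 v hv).isLocal).integrable _)
    ((IsLocal.prod fun v hv => (h2 v hv).isLocal).integrable _),
    integral_prod_of_disjoint h1 fun _ _ _ _ h => desc_disjoint hT h,
    integral_prod_of_disjoint h2 fun _ _ _ _ h => desc_disjoint hT h]
  simp only [integral_half_likelihood hT, Finset.prod_const_one]
  congr 1
  refine Finset.prod_congr rfl fun v _ => ?_
  rw [integral_add ((isLocal_likelihood_comp₂ k v fun a b => (a + b) / 2).integrable _)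
    ((isLocal_likelihood_comp₂ k v fun a b => |a - b| / 2).integrable _),
    integral_half_likelihood hT]
  rfl

theorem dependsOn_levelDensity (hT : G.IsTree) (n k : ℕ) (f : (V → ℤˣ) → ℝ) :
    DependsOn (levelDensity G o J β n k f) (level G o (n + k)) := by
  intro x y h
  simp only [levelDensity]
  congr 1
  funext η
  congr 1
  refine Finset.prod_congr rfl fun v hv => ?_
  exact dependsOn_likelihood k v _ fun i hi => h i (desc_subset_level hT hv hi)

/-- A Gibbs measure dominated by a multiple of the free boundary Gibbs measure is close to it on
the first `n` levels if distant spins have little influence on level `n`. -/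
theorem abs_measure_sub_le (hT : G.IsTree) {μ : Measure (V → ℤˣ)}
    (hμ : μ ∈ gibbsMeasures G o J β) {C : ℝ≥0} (hC : μ ≤ C • freeGibbs G o J β) {n : ℕ} (k : ℕ)
    {A : Set (V → ℤˣ)} (hA : MeasurableSet A)
    (hAn : DependsOn (A.indicator (1 : (V → ℤˣ) → ℝ)) (ball G o n)) :
    |μ.real A - (freeGibbs G o J β).real A| ≤
      C * (2 * (∏ v ∈ level G o n, (1 + influence G o J β (k + 1) v) - 1)) := by
  have := hμ.1
  set P := freeGibbs G o J β with hP
  set p := P.real A with hp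
  have hp01 : 0 ≤ p ∧ p ≤ 1 := ⟨measureReal_nonneg, measureReal_le_one⟩
  have h1n : DependsOn (fun _ : V → ℤˣ => (1 : ℝ)) (ball G o n) := fun _ _ _ => rfl
  set a := levelDensity G o J β n (k + 1) (A.indicator 1) with ha
  set b := levelDensity G o J β n (k + 1) fun _ => 1 with hb
  have had : DependsOn a (level G o (n + (k + 1))) := dependsOn_levelDensity hT n _ _
  have hbd : DependsOn b (level G o (n + (k + 1))) := dependsOn_levelDensity hT n _ _
  have hbpos : ∀ ω, 0 < b ω := fun ω => by
    rw [hb, ← avgOver_mul_isingDensity hT h1n]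
    exact avgOver_pos (fun η => by rw [one_mul]; exact isingDensity_pos _ _) _ _
  have hanonneg : ∀ ω, 0 ≤ a ω := fun ω => by
    rw [ha, ← avgOver_mul_isingDensity hT hAn]
    refine div_nonneg (Finset.sum_nonneg fun σ _ => mul_nonneg ?_ (isingDensity_pos _ _).le)
      (by positivity)
    exact Set.indicator_nonneg (fun _ _ => zero_le_one) _
  have hspec : ∀ ω, specification G o J β (ball G o (n + k)) ω A =
      ENNReal.ofReal (a ω / b ω) := fun ω => by
    rw [specification_apply_eq hT subset_rfl ω hA, avgOver_mul_isingDensity hT hAn,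
      show isingDensity G o J β (n + k + 1) = fun ζ => 1 * isingDensity G o J β (n + k + 1) ζ from
        funext fun ζ => (one_mul _).symm, avgOver_mul_isingDensity hT h1n]
  have hab : IsLocal fun ω => a ω / b ω := had.isLocal.comp₂ hbd.isLocal fun x y => x / y
  have h1 : μ.real A = ∫ ω, a ω / b ω ∂μ := by
    rw [measureReal_def, hμ.2 (ball G o (n + k)) A hA]
    simp only [hspec]
    rw [← ofReal_integral_eq_lintegral_ofReal (hab.integrable _)
      (Eventually.of_forall fun ω => div_nonneg (hanonneg ω) (hbpos ω).le),
      ENNReal.toReal_ofReal (integral_nonneg fun ω => div_nonneg (hanonneg ω) (hbpos ω).le)]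
  have hh : DependsOn (fun ω => |a ω / b ω - p|) (level G o (n + (k + 1))) := fun x y h => by
    simp only [had h, hbd h]
  calc |μ.real A - p| = |∫ ω, (a ω / b ω - p) ∂μ| := by
        rw [integral_sub (hab.integrable _) (integrable_const _), h1]
        simp
    _ ≤ ∫ ω, |a ω / b ω - p| ∂μ := abs_integral_le_integral_abs
    _ ≤ ∫ ω, |a ω / b ω - p| ∂(C • P) :=
        integral_mono_measure hC (Eventually.of_forall fun _ => abs_nonneg _)
          ((hh.isLocal.integrable _))
    _ = C * ∫ ω, 1 * |a ω / b ω - p| ∂P := by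
        rw [integral_smul_nnreal_measure]
        simp only [one_mul]
        rfl
    _ = C * ∫ τ, |a τ / b τ - p| * b τ ∂fairSpins V := by
        rw [integral_freeGibbs_mul hT h1n hh]
    _ ≤ C * ∫ τ, 2 * (∏ v ∈ level G o n, ((ℒ (k + 1) v 1 τ + ℒ (k + 1) v (-1) τ) / 2 +
          |ℒ (k + 1) v 1 τ - ℒ (k + 1) v (-1) τ| / 2) -
          ∏ v ∈ level G o n, ((ℒ (k + 1) v 1 τ + ℒ (k + 1) v (-1) τ) / 2)) ∂fairSpins V := by
        refine mul_le_mul_of_nonneg_left (integral_mono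
          ((hh.isLocal.mul hbd.isLocal).integrable _) ?_ fun τ => ?_) C.2
        · refine IsLocal.integrable ?_ _
          refine IsLocal.comp (IsLocal.sub (IsLocal.prod fun v _ => ?_)
            (IsLocal.prod fun v _ => ?_)) fun x => 2 * x
          · exact isLocal_likelihood_comp₂ _ v fun x y => (x + y) / 2 + |x - y| / 2
          · exact isLocal_likelihood_comp₂ _ v fun x y => (x + y) / 2
        · have h2 := abs_levelDensity_sub_le (J := J) (β := β) n (k + 1) hAn (fun η => by
            by_cases h : η ∈ A <;> simp [h]) τ
          have h3 := abs_levelDensity_sub_le (J := J) (β := β) n (k + 1) h1n (fun η => by simp) τ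
          rw [integral_indicator_one hA, ← hP, ← hp] at h2
          simp only [integral_const, probReal_univ, one_smul, one_mul] at h3
          beta_reduce
          rw [← ha] at h2
          rw [← hb] at h3
          set Q := ∏ v ∈ level G o n, ((ℒ (k + 1) v 1 τ + ℒ (k + 1) v (-1) τ) / 2)
          have h4 : |a τ / b τ - p| * b τ = |(a τ - p * Q) - p * (b τ - Q)| := by
            conv_lhs => rw [← abs_of_pos (hbpos τ)]
            rw [← abs_mul, abs_of_pos (hbpos τ), sub_mul, div_mul_cancel₀ _ (hbpos τ).ne']
            congr 1
            ring
          rw [h4]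
          refine (abs_sub _ _).trans ?_
          rw [abs_mul, abs_of_nonneg hp01.1]
          have := mul_le_of_le_one_left (abs_nonneg (b τ - Q)) hp01.2
          linarith
    _ = _ := by rw [integral_const_mul, integral_prod_sub_prod hT]

theorem isExtremal_freeGibbs (hT : G.IsTree)
    (h : ∀ v, Tendsto (fun k => influence G o J β k v) atTop (nhds 0)) :
    IsExtremal G o J β (freeGibbs G o J β) := by
  refine ⟨freeGibbs_mem_gibbsMeasures hT, fun μ hμ ν hν hseg => ?_⟩
  obtain ⟨a, b, ha, hb, -, heq⟩ := hseg
  have := hμ.1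
  have hC : μ ≤ a⁻¹ • freeGibbs G o J β := by
    rw [← heq, smul_add, smul_smul, inv_mul_cancel₀ ha.ne', one_smul]
    exact Measure.le_add_right le_rfl
  refine measure_ext_of_isLocal fun A hA hA' => ?_
  have hA'' : IsLocal (A.indicator (1 : (V → ℤˣ) → ℝ)) := hA'
  obtain ⟨B, hB⟩ := hA''
  obtain ⟨n, hn⟩ := exists_ball_superset (o := o) hT B
  have h1 := fun k => abs_measure_sub_le hT hμ hC k hA (hB.mono (Finset.coe_subset.2 hn))
  have h2 : Tendsto (fun k => ((a⁻¹ : ℝ≥0) : ℝ) *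
      (2 * (∏ v ∈ level G o n, (1 + influence G o J β (k + 1) v) - 1))) atTop (nhds 0) := by
    have h3 : Tendsto (fun k => ∏ v ∈ level G o n, (1 + influence G o J β (k + 1) v)) atTop
        (nhds (∏ v ∈ level G o n, (1 + 0))) :=
      tendsto_finsetProd _ fun v _ => ((h v).comp (tendsto_add_atTop_nat 1)).const_add 1
    simpa using ((h3.sub_const 1).const_mul 2).const_mul ((a⁻¹ : ℝ≥0) : ℝ)
  have h4 := ge_of_tendsto' h2 h1
  have h5 := sub_eq_zero.1 (abs_eq_zero.1 (le_antisymm h4 (abs_nonneg _)))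
  rwa [measureReal_eq_measureReal_iff] at h5

end Extremal

/-! ### Linear statistics of a level -/

section LevelSum

variable {V : Type*} {G : SimpleGraph V} [G.LocallyFinite] {o : V} {J : V → ℝ} {β : ℝ}

theorem integral_freeGibbs_prod_spin (hT : G.IsTree) {n : ℕ} {f : (V → ℤˣ) → ℝ}
    (hf : DependsOn f (ball G o n)) {T : Finset V} (hTl : T ⊆ level G o (n + 1)) :
    ∫ η, f η * ∏ w ∈ T, spin (η w) ∂freeGibbs G o J β =
      ∫ η, f η * ∏ w ∈ T, (Real.tanh (β * J w) * spin (η (parent G o w))) ∂freeGibbs G o J β := by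
  have h := integral_freeGibbs_level (J := J) (β := β) hT hf
    fun w t => if w ∈ T then spin t else 1
  have h1 : ∀ η : V → ℤˣ, ∏ w ∈ level G o (n + 1), (if w ∈ T then spin (η w) else 1) =
      ∏ w ∈ T, spin (η w) := fun η => by
    rw [Finset.prod_ite_mem, Finset.inter_eq_right.2 hTl]
  have h2 : ∀ η : V → ℤˣ, ∏ v ∈ level G o n, ∏ w ∈ children G o v,
      (∑ t, (1 + Real.tanh (β * J w) * spin (η v) * spin t) * if w ∈ T then spin t else 1) / 2 =
      ∏ w ∈ T, (Real.tanh (β * J w) * spin (η (parent G o w))) := fun η => by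
    have h3 : ∏ w ∈ T, (Real.tanh (β * J w) * spin (η (parent G o w))) =
        ∏ w ∈ level G o (n + 1),
          if w ∈ T then Real.tanh (β * J w) * spin (η (parent G o w)) else 1 := by
      rw [Finset.prod_ite_mem, Finset.inter_eq_right.2 hTl]
    rw [h3, prod_level_succ hT]
    refine Finset.prod_congr rfl fun v _ => Finset.prod_congr rfl fun w hw => ?_
    rw [(mem_children.1 hw).parent_eq hT, sum_spin, spin_neg, spin_one]
    split_ifs <;> ring
  simpa only [h1, h2] using h

/-- The linear statistic of level `N` with coefficients `c`. -/
noncomputable def levelSum (G : SimpleGraph V) [G.LocallyFinite] (o : V) (c : V → ℝ) (N : ℕ)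
    (η : V → ℤˣ) : ℝ := ∑ x ∈ level G o N, c x * spin (η x)

variable {c : V → ℝ}

theorem dependsOn_levelSum (N : ℕ) : DependsOn (levelSum G o c N) (level G o N) :=
  fun _ _ h => Finset.sum_congr rfl fun v hv => by rw [h v hv]

theorem isLocal_levelSum (N : ℕ) : IsLocal (levelSum G o c N) := (dependsOn_levelSum N).isLocal

theorem levelSum_eq_sum_parent (hT : G.IsTree)
    (hc : ∀ v, ∑ w ∈ children G o v, c w * Real.tanh (β * J w) = c v) (N : ℕ) (η : V → ℤˣ) :
    levelSum G o c N η =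
      ∑ w ∈ level G o (N + 1), c w * (Real.tanh (β * J w) * spin (η (parent G o w))) := by
  rw [levelSum, sum_level_succ hT]
  refine Finset.sum_congr rfl fun v _ => ?_
  rw [← hc v, Finset.sum_mul]
  refine Finset.sum_congr rfl fun w hw => ?_
  rw [(mem_children.1 hw).parent_eq hT, mul_assoc]

theorem integral_mul_levelSum_succ (hT : G.IsTree)
    (hc : ∀ v, ∑ w ∈ children G o v, c w * Real.tanh (β * J w) = c v) {N : ℕ}
    {f : (V → ℤˣ) → ℝ} (hf : DependsOn f (ball G o N)) :
    ∫ η, f η * levelSum G o c (N + 1) η ∂freeGibbs G o J β =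
      ∫ η, f η * levelSum G o c N η ∂freeGibbs G o J β := by
  simp only [levelSum_eq_sum_parent hT hc N]
  simp only [levelSum, Finset.mul_sum]
  rw [integral_finsetSum _ fun w _ => (hf.isLocal.mul (isLocal_eval (fun s => c w * spin s) w)
    ).integrable _, integral_finsetSum _ fun w _ => (hf.isLocal.mul (isLocal_eval
      (fun s => c w * (Real.tanh (β * J w) * spin s)) (parent G o w))).integrable _]
  refine Finset.sum_congr rfl fun w hw => ?_
  have h := integral_freeGibbs_prod_spin (J := J) (β := β) hT hf (Finset.singleton_subset_iff.2 hw)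
  simp only [Finset.prod_singleton] at h
  simp only [mul_left_comm _ (c w)]
  rw [integral_const_mul, integral_const_mul, h]

theorem integral_mul_levelSum (hT : G.IsTree)
    (hc : ∀ v, ∑ w ∈ children G o v, c w * Real.tanh (β * J w) = c v) {N M : ℕ} (hNM : N ≤ M)
    {f : (V → ℤˣ) → ℝ} (hf : DependsOn f (ball G o N)) :
    ∫ η, f η * levelSum G o c M η ∂freeGibbs G o J β =
      ∫ η, f η * levelSum G o c N η ∂freeGibbs G o J β := by
  induction M, hNM using Nat.le_induction with
  | base => rfl
  | succ M hM ih =>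
    rw [integral_mul_levelSum_succ hT hc (hf.mono (Finset.coe_subset.2 (ball_subset_ball hT hM))),
      ih]

theorem levelSum_zero (hT : G.IsTree) (η : V → ℤˣ) :
    levelSum G o c 0 η = c o * spin (η o) := by
  rw [levelSum, level_zero hT, Finset.sum_singleton]

theorem integral_levelSum (hT : G.IsTree)
    (hc : ∀ v, ∑ w ∈ children G o v, c w * Real.tanh (β * J w) = c v) (N : ℕ) :
    ∫ η, levelSum G o c N η ∂freeGibbs G o J β = 0 := by
  have h := integral_mul_levelSum (J := J) (β := β) hT hc N.zero_le (f := fun _ => 1)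
    fun _ _ _ => rfl
  simp only [one_mul, levelSum_zero hT] at h
  rw [h, integral_freeGibbs_root hT fun s => c o * spin s, spin_neg, spin_one]
  ring

theorem integral_spin_root_mul_levelSum (hT : G.IsTree)
    (hc : ∀ v, ∑ w ∈ children G o v, c w * Real.tanh (β * J w) = c v) (N : ℕ) :
    ∫ η, spin (η o) * levelSum G o c N η ∂freeGibbs G o J β = c o := by
  have h := integral_mul_levelSum (J := J) (β := β) hT hc N.zero_le (f := fun η => spin (η o))
    fun x y hxy => by simp only [hxy o (root_mem_ball hT 0)]
  simp only [levelSum_zero hT] at h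
  rw [h, integral_freeGibbs_root hT fun s => spin s * (c o * spin s), spin_neg, spin_one]
  ring

theorem integral_levelSum_sq_succ (hT : G.IsTree)
    (hc : ∀ v, ∑ w ∈ children G o v, c w * Real.tanh (β * J w) = c v) (N : ℕ) :
    ∫ η, levelSum G o c (N + 1) η ^ 2 ∂freeGibbs G o J β =
      ∫ η, levelSum G o c N η ^ 2 ∂freeGibbs G o J β +
        ∑ w ∈ level G o (N + 1), c w ^ 2 * (1 - Real.tanh (β * J w) ^ 2) := by
  have h1 : ∀ η, levelSum G o c (N + 1) η ^ 2 = ∑ w ∈ level G o (N + 1),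
      ∑ w' ∈ level G o (N + 1), c w * c w' * (spin (η w) * spin (η w')) := fun η => by
    rw [pow_two, levelSum, Finset.sum_mul_sum]
    exact Finset.sum_congr rfl fun _ _ => Finset.sum_congr rfl fun _ _ => by ring
  have h2 : ∀ η, levelSum G o c N η ^ 2 = ∑ w ∈ level G o (N + 1),
      ∑ w' ∈ level G o (N + 1), c w * c w' * ((Real.tanh (β * J w) * spin (η (parent G o w))) *
        (Real.tanh (β * J w') * spin (η (parent G o w')))) := fun η => by
    rw [pow_two, levelSum_eq_sum_parent hT hc, Finset.sum_mul_sum]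
    exact Finset.sum_congr rfl fun _ _ => Finset.sum_congr rfl fun _ _ => by ring
  have hl1 : ∀ w w', IsLocal fun η : V → ℤˣ => c w * c w' * (spin (η w) * spin (η w')) :=
    fun w w' => ((isLocal_eval spin w).mul (isLocal_eval spin w')).comp fun x => c w * c w' * x
  have hl2 : ∀ w w', IsLocal fun η : V → ℤˣ =>
      c w * c w' * ((Real.tanh (β * J w) * spin (η (parent G o w))) *
        (Real.tanh (β * J w') * spin (η (parent G o w')))) := fun w w' =>
    ((isLocal_eval (fun s => Real.tanh (β * J w) * spin s) (parent G o w)).mul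
      (isLocal_eval (fun s => Real.tanh (β * J w') * spin s) (parent G o w'))).comp
        fun x => c w * c w' * x
  simp only [h1, h2]
  rw [integral_finsetSum _ fun w _ => (IsLocal.sum fun w' _ => hl1 w w').integrable _,
    integral_finsetSum _ fun w _ => (IsLocal.sum fun w' _ => hl2 w w').integrable _,
    ← Finset.sum_add_distrib]
  refine Finset.sum_congr rfl fun w hw => ?_
  rw [integral_finsetSum _ fun w' _ => (hl1 w w').integrable _,
    integral_finsetSum _ fun w' _ => (hl2 w w').integrable _,
    ← Finset.add_sum_erase _ _ hw, ← Finset.add_sum_erase _ _ hw]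
  have h3 : ∀ w' ∈ (level G o (N + 1)).erase w,
      ∫ η, c w * c w' * (spin (η w) * spin (η w')) ∂freeGibbs G o J β =
      ∫ η, c w * c w' * ((Real.tanh (β * J w) * spin (η (parent G o w))) *
        (Real.tanh (β * J w') * spin (η (parent G o w')))) ∂freeGibbs G o J β := by
    intro w' hw'
    have hne : w ≠ w' := (Finset.ne_of_mem_erase hw').symm
    have h4 := integral_freeGibbs_prod_spin (J := J) (β := β) (o := o) (n := N) hT
      (f := fun _ => c w * c w') (fun _ _ _ => rfl) (T := {w, w'})
      (Finset.insert_subset hw (Finset.singleton_subset_iff.2 (Finset.mem_of_mem_erase hw')))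
    simpa only [Finset.prod_pair hne] using h4
  rw [Finset.sum_congr rfl h3]
  have h5 : ∀ η : V → ℤˣ, c w * c w * ((Real.tanh (β * J w) * spin (η (parent G o w))) *
      (Real.tanh (β * J w) * spin (η (parent G o w)))) = c w ^ 2 * Real.tanh (β * J w) ^ 2 := by
    intro η
    have := spin_mul_self (η (parent G o w))
    linear_combination (c w ^ 2 * Real.tanh (β * J w) ^ 2) * this
  simp only [h5, spin_mul_self, integral_const, probReal_univ, one_smul]
  ring

theorem integral_sub_levelSum_sq (hT : G.IsTree)
    (hc : ∀ v, ∑ w ∈ children G o v, c w * Real.tanh (β * J w) = c v) {N M : ℕ} (hNM : N ≤ M) :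
    ∫ η, (levelSum G o c M η - levelSum G o c N η) ^ 2 ∂freeGibbs G o J β =
      ∫ η, levelSum G o c M η ^ 2 ∂freeGibbs G o J β -
        ∫ η, levelSum G o c N η ^ 2 ∂freeGibbs G o J β := by
  have h := integral_mul_levelSum (J := J) (β := β) hT hc hNM
    ((dependsOn_levelSum (G := G) (o := o) (c := c) N).mono
      (Finset.coe_subset.2 level_subset_ball))
  have h1 : ∀ η, (levelSum G o c M η - levelSum G o c N η) ^ 2 = levelSum G o c M η ^ 2 +
      (levelSum G o c N η * levelSum G o c N η -
        2 * (levelSum G o c N η * levelSum G o c M η)) := fun η => by ring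
  have i1 : ∀ N, Integrable (fun η => levelSum G o c N η ^ 2) (freeGibbs G o J β) := fun N =>
    ((isLocal_levelSum N).comp fun x => x ^ 2).integrable _
  have i2 : ∀ N M, Integrable (fun η => levelSum G o c N η * levelSum G o c M η)
      (freeGibbs G o J β) := fun N M => ((isLocal_levelSum N).mul (isLocal_levelSum M)).integrable _
  simp only [h1]
  rw [integral_add (g := fun η => levelSum G o c N η * levelSum G o c N η -
      2 * (levelSum G o c N η * levelSum G o c M η)) (i1 M)
      ((i2 N N).sub ((i2 N M).const_mul 2)), integral_sub (i2 N N) ((i2 N M).const_mul 2), integral_const_mul, h]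
  simp only [pow_two]
  ring

end LevelSum

/-! ### Coefficients from a flow -/

section Flow

variable {V : Type*} {G : SimpleGraph V} [G.LocallyFinite] {o : V} {J : V → ℝ} {β : ℝ}

/-- If the tree has positive capacity, there is a linear statistic of the levels that is correlated
with the root and bounded in `L²`. -/
theorem exists_coeff_of_capacity_ne_zero [Infinite V] (hT : G.IsTree)
    (hleaf : ∀ v, v ≠ o → G.degree v ≠ 1) (hJ : ∀ w, w ≠ o → 0 < Real.tanh (β * J w))
    (h : capacity G o (resistance G o J β) 2 ≠ 0) :
    ∃ c : V → ℝ, (∀ v, ∑ w ∈ children G o v, c w * Real.tanh (β * J w) = c v) ∧ 0 < c o ∧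
      ∀ N, ∫ η, levelSum G o c N η ^ 2 ∂freeGibbs G o J β ≤ c o ^ 2 + c o := by
  obtain ⟨μ, hμ, hV, hm⟩ := capacity_two_ne_zero_iff.1 h
  set R := resistance G o J β with hR
  set m : ℝ := ∑ w ∈ children G o o, (μ w : ℝ) with hmdef
  set fl : V → ℝ := fun v => if v = o then m else μ v with hfl
  have hflow : ∀ v, fl v = ∑ w ∈ children G o v, fl w := by
    intro v
    have h1 : ∑ w ∈ children G o v, fl w = ∑ w ∈ children G o v, (μ w : ℝ) :=
      Finset.sum_congr rfl fun w hw => if_neg (mem_children.1 hw).ne_root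
    rw [h1]
    by_cases hv : v = o
    · simp only [hfl, if_pos hv]
      rw [hv]
    · simp only [hfl, if_neg hv]
      rw [hμ v hv, NNReal.coe_sum]
  have hmpos : 0 < m := by
    refine (Finset.sum_nonneg fun w _ => NNReal.zero_le_coe).lt_of_ne' fun h0 => hm ?_
    rw [Finset.sum_eq_zero_iff_of_nonneg fun w _ => NNReal.zero_le_coe] at h0
    exact Finset.sum_eq_zero fun w hw => by exact_mod_cast h0 w hw
  have hfl0 : ∀ v, 0 ≤ fl v := fun v => by
    simp only [hfl]
    split_ifs
    · exact hmpos.le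
    · exact NNReal.zero_le_coe
  set Θ : V → ℝ := fun v => ∏ y ∈ (ancestors G o v).erase o, Real.tanh (β * J y) with hΘ
  have hΘ0 : ∀ v, 0 < Θ v := fun v =>
    Finset.prod_pos fun y hy => hJ y (Finset.ne_of_mem_erase hy)
  have hΘc : ∀ v w, IsParent G o v w → Θ w = Real.tanh (β * J w) * Θ v := fun v w hp => by
    simp only [hΘ]
    rw [prod_ancestors_child hT hp]
  have hΘo : Θ o = 1 := by simp [hΘ, ancestors_root hT]
  have hΘR : ∀ v, (R v : ℝ) = (Θ v ^ 2)⁻¹ := fun v => by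
    simp only [hR, resistance, hΘ, NNReal.coe_prod]
    rw [← Finset.prod_pow, ← Finset.prod_inv_distrib]
    exact Finset.prod_congr rfl fun y _ => Real.coe_toNNReal _ (inv_nonneg.2 (sq_nonneg _))
  set ρ : V → ℝ := fun v => ∑ y ∈ (ancestors G o v).erase o, (μ y : ℝ) * R y with hρ
  have hρc : ∀ v w, IsParent G o v w → ρ w = μ w * R w + ρ v := fun v w hp => by
    simp only [hρ]
    rw [ancestors_child hT hp, Finset.erase_insert_of_ne hp.ne_root, Finset.sum_insert]
    exact fun hw => notMem_ancestors hT hp (Finset.mem_of_mem_erase hw)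
  have hρo : ρ o = 0 := by simp [hρ, ancestors_root hT]
  have hρ1 : ∀ x, ρ x ≤ 1 := by
    intro x
    obtain ⟨y, hy, hyx⟩ := exists_isRay (o := o) hT hleaf x
    have h1 : ∀ n, ρ (y n) = ∑ i ∈ Finset.range n, (μ (y (i + 1)) : ℝ) * R (y (i + 1)) := by
      intro n
      induction n with
      | zero => simp [hy.1, hρo]
      | succ n ih => rw [Finset.sum_range_succ, hρc _ _ (hy.2 n), ih, add_comm]
    have h2 : rayPotential R 1 μ y ≤ 1 := hV ▸ le_iSup₂_of_le y hy le_rfl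
    rw [rayPotential_one] at h2
    have h3 := (ENNReal.sum_le_tsum (Finset.range (G.dist o x))).trans h2
    rw [← hyx, h1]
    have h4 : ∑ i ∈ Finset.range (G.dist o x), μ (y (i + 1)) * R (y (i + 1)) ≤ 1 := by
      rw [← ENNReal.coe_le_coe]
      push_cast
      exact h3
    exact_mod_cast h4
  have hharm : ∀ v, ∑ w ∈ children G o v, fl w / Θ w * Real.tanh (β * J w) = fl v / Θ v := by
    intro v
    rw [hflow v, Finset.sum_div]
    refine Finset.sum_congr rfl fun w hw => ?_
    have hp := mem_children.1 hw
    rw [hΘc v w hp]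
    have := (hΘ0 v).ne'
    have := (hJ w hp.ne_root).ne'
    field_simp
  refine ⟨fun v => fl v / Θ v, hharm, ?_, fun N => ?_⟩
  · simpa [hfl, hΘo] using hmpos
  · beta_reduce
    have hco : fl o / Θ o = m := by simp [hfl, hΘo]
    have hsum : ∀ N, ∑ x ∈ level G o N, fl x = m := by
      intro N
      induction N with
      | zero => simp [level_zero hT, hfl]
      | succ N ih =>
        rw [sum_level_succ hT, ← ih]
        exact Finset.sum_congr rfl fun v _ => (hflow v).symm
    have hbound : ∀ N, ∫ η, levelSum G o (fun v => fl v / Θ v) N η ^ 2 ∂freeGibbs G o J β ≤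
        m ^ 2 + ∑ x ∈ level G o N, fl x * ρ x := by
      intro N
      induction N with
      | zero =>
        have h1 : ∀ η : V → ℤˣ, (m * spin (η o)) ^ 2 = m ^ 2 := fun η => by
          rw [mul_pow, pow_two (spin _), spin_mul_self, mul_one]
        simp only [levelSum_zero hT, hco, h1, level_zero hT, Finset.sum_singleton, hρo]
        simp
      | succ N ih =>
        rw [integral_levelSum_sq_succ hT hharm, sum_level_succ hT]
        have h1 : ∀ v ∈ level G o N, fl v * ρ v + ∑ w ∈ children G o v,
            (fl w / Θ w) ^ 2 * (1 - Real.tanh (β * J w) ^ 2) ≤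
            ∑ w ∈ children G o v, fl w * ρ w := by
          intro v _
          conv_lhs => rw [hflow v, Finset.sum_mul]
          rw [← Finset.sum_add_distrib]
          refine Finset.sum_le_sum fun w hw => ?_
          have hp := mem_children.1 hw
          have h2 : fl w = μ w := if_neg hp.ne_root
          have h3 : (fl w / Θ w) ^ 2 * (1 - Real.tanh (β * J w) ^ 2) ≤ (fl w / Θ w) ^ 2 :=
            mul_le_of_le_one_right (sq_nonneg _) (by linarith [sq_nonneg (Real.tanh (β * J w))])
          rw [hρc v w hp, hΘR, ← h2]
          have h4 : (fl w / Θ w) ^ 2 = fl w * (fl w * (Θ w ^ 2)⁻¹) := by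
            rw [div_pow, div_eq_mul_inv]
            ring
          linarith
        have h2 := Finset.sum_le_sum h1
        rw [Finset.sum_add_distrib] at h2
        rw [sum_level_succ hT]
        linarith
    rw [hco]
    refine (hbound N).trans (add_le_add_right ?_ _)
    rw [← hsum N]
    exact Finset.sum_le_sum fun x _ => mul_le_of_le_one_right (hfl0 x) (hρ1 x)

end Flow

/-! ### Tail events -/

section Tail

variable {V : Type*} {G : SimpleGraph V} [G.LocallyFinite] {o : V} {J : V → ℝ} {β : ℝ}

/-- An extremal Gibbs measure is trivial on tail events. -/
theorem measure_compl_eq_zero_of_isExtremal {μ : Measure (V → ℤˣ)} (hμ : IsExtremal G o J β μ)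
    {A : Set (V → ℤˣ)} (hA : MeasurableSet A)
    (htail : ∀ (Λ : Finset V) (ω : V → ℤˣ) (σ : Λ → ℤˣ), glue Λ ω σ ∈ A ↔ ω ∈ A)
    (hA0 : μ A ≠ 0) : μ Aᶜ = 0 := by
  have := hμ.1.1
  by_contra hA1
  have h1 := cond_mem_gibbsMeasures hμ.1 hA hA0 htail
  have h2 := cond_mem_gibbsMeasures hμ.1 hA.compl hA1 fun Λ ω σ => (htail Λ ω σ).not
  have h3 : ∀ B : Set (V → ℤˣ), μ B ≠ 0 →
      (μ B).toNNReal • μ[|B] = μ.restrict B := fun B hB => by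
    rw [ProbabilityTheory.cond, ENNReal.smul_def, ENNReal.coe_toNNReal (measure_ne_top _ _),
      smul_smul, ENNReal.mul_inv_cancel hB (measure_ne_top _ _), one_smul]
  have h4 : μ ∈ openSegment ℝ≥0 μ[|A] μ[|Aᶜ] := by
    refine ⟨(μ A).toNNReal, (μ Aᶜ).toNNReal, ENNReal.toNNReal_pos hA0 (measure_ne_top _ _),
      ENNReal.toNNReal_pos hA1 (measure_ne_top _ _), ?_, ?_⟩
    · rw [← ENNReal.toNNReal_add (measure_ne_top _ _) (measure_ne_top _ _), measure_add_measure_compl hA,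
        measure_univ, ENNReal.toNNReal_one]
    · rw [h3 A hA0, h3 _ hA1, Measure.restrict_add_restrict_compl hA]
  have h5 : μ[|A] = μ := hμ.2 h1 h2 h4
  apply hA1
  rw [← h5, cond_apply hA, Set.inter_compl_self, measure_empty, mul_zero]

variable {c : V → ℝ}

theorem exists_ae_tendsto_levelSum (hT : G.IsTree)
    (hc : ∀ v, ∑ w ∈ children G o v, c w * Real.tanh (β * J w) = c v) {C : ℝ}
    (hC : ∀ N, ∫ η, levelSum G o c N η ^ 2 ∂freeGibbs G o J β ≤ C) :
    ∃ (S : (V → ℤˣ) → ℝ) (ns : ℕ → ℕ), StrictMono ns ∧ Integrable S (freeGibbs G o J β) ∧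
      (∀ᵐ η ∂freeGibbs G o J β, Tendsto (fun i => levelSum G o c (ns i) η) atTop (nhds (S η))) ∧
      ∫ η, S η ∂freeGibbs G o J β = 0 ∧ ∫ η, spin (η o) * S η ∂freeGibbs G o J β = c o := by
  set P := freeGibbs G o J β with hP
  have hmem : ∀ f : (V → ℤˣ) → ℝ, IsLocal f → MemLp f 2 P := fun f hf => by
    obtain ⟨K, hK⟩ := hf.bounded
    exact MemLp.of_bound hf.measurable.aestronglyMeasurable K (Eventually.of_forall hK)
  set F : ℕ → Lp ℝ 2 P := fun N => (hmem _ (isLocal_levelSum (G := G) (o := o) (c := c) N)).toLp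
    with hF
  have hFae : ∀ N, F N =ᵐ[P] levelSum G o c N := fun N => MemLp.coeFn_toLp _
  have hdist : ∀ N M, N ≤ M → ‖F M - F N‖ ^ 2 =
      ∫ η, levelSum G o c M η ^ 2 ∂P - ∫ η, levelSum G o c N η ^ 2 ∂P := by
    intro N M hNM
    rw [← integral_sub_levelSum_sq hT hc hNM, ← real_inner_self_eq_norm_sq, L2.inner_def]
    refine integral_congr_ae ?_
    filter_upwards [hFae N, hFae M, Lp.coeFn_sub (F M) (F N)] with η h1 h2 h3
    rw [real_inner_self_eq_norm_sq, h3, Pi.sub_apply, h1, h2, Real.norm_eq_abs, sq_abs]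
  set a : ℕ → ℝ := fun N => ∫ η, levelSum G o c N η ^ 2 ∂P with ha
  have hmono : Monotone a := fun N M hNM => by
    have := hdist N M hNM
    have := sq_nonneg ‖F M - F N‖
    simp only [ha]
    linarith
  have hconv : CauchySeq a := by
    refine (tendsto_atTop_ciSup hmono ⟨C, ?_⟩).cauchySeq
    rintro _ ⟨N, rfl⟩
    exact hC N
  have hcau : CauchySeq F := by
    rw [Metric.cauchySeq_iff'] at hconv ⊢
    intro ε hε
    obtain ⟨N, hN⟩ := hconv (ε ^ 2) (by positivity)
    refine ⟨N, fun M hM => ?_⟩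
    have h1 := hN M hM
    rw [Real.dist_eq] at h1
    rw [dist_eq_norm]
    refine lt_of_pow_lt_pow_left₀ 2 hε.le ?_
    rw [hdist N M hM]
    exact (le_abs_self _).trans_lt h1
  obtain ⟨S, hS⟩ := cauchySeq_tendsto_of_complete hcau
  obtain ⟨ns, hns, hae⟩ := (tendstoInMeasure_of_tendsto_Lp hS).exists_seq_tendsto_ae
  have hlim : ∀ g : (V → ℤˣ) → ℝ, IsLocal g → Tendsto
      (fun N => ∫ η, g η * levelSum G o c N η ∂P) atTop (nhds (∫ η, g η * S η ∂P)) := by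
    intro g hg
    have h1 : Tendsto (fun N => inner ℝ ((hmem g hg).toLp) (F N)) atTop
        (nhds (inner ℝ ((hmem g hg).toLp) S)) := tendsto_const_nhds.inner hS
    have h2 : ∀ f : Lp ℝ 2 P, inner ℝ ((hmem g hg).toLp) f = ∫ η, g η * f η ∂P := by
      intro f
      rw [L2.inner_def]
      refine integral_congr_ae ?_
      filter_upwards [(hmem g hg).coeFn_toLp] with η h
      rw [h]
      simp [mul_comm]
    simp only [h2] at h1
    refine h1.congr fun N => integral_congr_ae ?_
    filter_upwards [hFae N] with η h
    rw [h]
  refine ⟨S, ns, hns, (Lp.memLp S).integrable one_le_two, ?_, ?_, ?_⟩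
  · filter_upwards [hae, ae_all_iff.2 hFae] with η h1 h2
    simpa only [h2] using h1
  · have h1 := hlim (fun _ => 1) (isLocal_const 1)
    simp only [one_mul, hP, integral_levelSum hT hc] at h1
    exact (tendsto_nhds_unique h1 tendsto_const_nhds)
  · have h1 := hlim (fun η => spin (η o)) (isLocal_eval spin o)
    simp only [hP, integral_spin_root_mul_levelSum hT hc] at h1
    exact (tendsto_nhds_unique h1 tendsto_const_nhds)

theorem not_isExtremal_of_levelSum (hT : G.IsTree)
    (hc : ∀ v, ∑ w ∈ children G o v, c w * Real.tanh (β * J w) = c v) (hco : 0 < c o) {C : ℝ}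
    (hC : ∀ N, ∫ η, levelSum G o c N η ^ 2 ∂freeGibbs G o J β ≤ C) :
    ¬ IsExtremal G o J β (freeGibbs G o J β) := by
  intro hext
  obtain ⟨S, ns, hns, hSi, hae, hS0, hS1⟩ := exists_ae_tendsto_levelSum hT hc hC
  set A : Set (V → ℤˣ) := {η | ∀ᶠ i in atTop, 0 < levelSum G o c (ns i) η} with hAdef
  have hA : MeasurableSet A := by
    have : A = ⋃ n, ⋂ i, ⋂ (_ : n ≤ i), {η | 0 < levelSum G o c (ns i) η} := by
      ext η
      simp [hAdef, eventually_atTop]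
    rw [this]
    exact MeasurableSet.iUnion fun n => MeasurableSet.iInter fun i => MeasurableSet.iInter fun _ =>
      measurableSet_lt measurable_const (isLocal_levelSum (ns i)).measurable
  have htail : ∀ (Λ : Finset V) (ω : V → ℤˣ) (σ : Λ → ℤˣ), glue Λ ω σ ∈ A ↔ ω ∈ A := by
    intro Λ ω σ
    obtain ⟨n, hn⟩ := exists_ball_superset (o := o) hT Λ
    refine eventually_congr ((eventually_gt_atTop n).mono fun i hi => ?_)
    have h1 : levelSum G o c (ns i) (glue Λ ω σ) = levelSum G o c (ns i) ω := by
      refine dependsOn_levelSum (ns i) fun v hv => glue_of_notMem (fun hv' => ?_) _ _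
      exact Finset.disjoint_left.1 (disjoint_ball_level hT (hi.trans_le (hns.id_le i))) (hn hv') hv
    rw [h1]
  have hpos : ∀ᵐ η ∂freeGibbs G o J β, 0 < S η → η ∈ A := by
    filter_upwards [hae] with η h1 h2
    exact h1.eventually_const_lt h2
  have hneg : ∀ᵐ η ∂freeGibbs G o J β, S η < 0 → η ∉ A := by
    filter_upwards [hae] with η h1 h2 h3
    obtain ⟨i, hi, hi'⟩ := ((h1.eventually_lt_const h2).and h3).exists
    linarith
  have hzero : S =ᵐ[freeGibbs G o J β] 0 := by
    by_cases hA0 : freeGibbs G o J β A = 0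
    · have h1 : 0 ≤ᵐ[freeGibbs G o J β] fun η => -S η := by
        filter_upwards [hpos, measure_eq_zero_iff_ae_notMem.1 hA0] with η h2 h3
        have h4 : ¬ 0 < S η := fun h => h3 (h2 h)
        simpa using h4
      rw [← neg_eq_zero, ← integral_neg, integral_eq_zero_iff_of_nonneg_ae h1 hSi.neg] at hS0
      filter_upwards [hS0] with η h
      simpa using h
    · have hA1 := measure_compl_eq_zero_of_isExtremal hext hA htail hA0
      have h1 : 0 ≤ᵐ[freeGibbs G o J β] S := by
        filter_upwards [hneg, measure_eq_zero_iff_ae_notMem.1 hA1] with η h2 h3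
        by_contra h4
        exact h3 (h2 (not_le.1 h4))
      exact (integral_eq_zero_iff_of_nonneg_ae h1 hSi).1 hS0
  have : ∫ η, spin (η o) * S η ∂freeGibbs G o J β = 0 := by
    rw [← integral_zero (V → ℤˣ) ℝ]
    refine integral_congr_ae ?_
    filter_upwards [hzero] with η h
    simp [h]
  rw [hS1] at this
  exact hco.ne' this

end Tail

/-! ### The law of the log-likelihood ratio -/

section LogLikelihood

variable {V : Type*} {G : SimpleGraph V} [G.LocallyFinite] {o : V} {J : V → ℝ} {β : ℝ}

local notation "ℒ" => likelihood G o J β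

variable (G o J β) in
/-- The squared magnetization of the root given the spins on level `k`. -/
noncomputable def rootMagnetizationSq (k : ℕ) (η : V → ℤˣ) : ℝ :=
  ((ℒ k o 1 η - ℒ k o (-1) η) / (ℒ k o 1 η + ℒ k o (-1) η)) ^ 2

theorem desc_root_subset (hT : G.IsTree) (k : ℕ) : desc G o k o ⊆ level G o k := by
  have := desc_subset_level (G := G) (o := o) (v := o) (n := 0) (k := k) hT
    (by rw [level_zero hT]; exact Finset.mem_singleton_self o)
  rwa [zero_add] at this

theorem dependsOn_likelihood_root (hT : G.IsTree) (k : ℕ) (F : ℝ → ℝ → ℝ) :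
    DependsOn (fun η => F (ℒ k o 1 η) (ℒ k o (-1) η)) (level G o (0 + k)) := by
  rw [zero_add]
  exact (dependsOn_likelihood_comp₂ k o F).mono (Finset.coe_subset.2 (desc_root_subset hT k))

theorem isLocal_rootMagnetizationSq (k : ℕ) : IsLocal (rootMagnetizationSq G o J β k) :=
  isLocal_likelihood_comp₂ k o fun a b => ((a - b) / (a + b)) ^ 2

theorem integral_freeGibbs_root_mul (hT : G.IsTree) {k : ℕ} (f : ℤˣ → ℝ) {h : (V → ℤˣ) → ℝ}
    (hh : DependsOn h (level G o (0 + (k + 1)))) :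
    ∫ η, f (η o) * h η ∂freeGibbs G o J β =
      ∫ τ, h τ * ((f 1 * ℒ (k + 1) o 1 τ + f (-1) * ℒ (k + 1) o (-1) τ) / 2) ∂fairSpins V := by
  rw [integral_freeGibbs_mul hT (f := fun η => f (η o))
    (fun x y h => by simp only [h o (root_mem_ball hT 0)]) hh]
  simp only [levelDensity_root hT]

theorem integral_rootMagnetizationSq_le (hT : G.IsTree) (k : ℕ) :
    ∫ η, rootMagnetizationSq G o J β (k + 1) η ∂freeGibbs G o J β ≤
      influence G o J β (k + 1) o := by
  have h := integral_freeGibbs_root_mul (o := o) (J := J) (β := β) (k := k) hT (fun _ => 1)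
    (dependsOn_likelihood_root (o := o) (J := J) (β := β) hT (k + 1) fun a b => ((a - b) / (a + b)) ^ 2)
  simp only [one_mul] at h
  refine h.trans_le (integral_mono
    ((isLocal_likelihood_comp₂ _ o fun a b => ((a - b) / (a + b)) ^ 2 * ((a + b) / 2)).integrable _)
    ((isLocal_likelihood_comp₂ _ o fun a b => |a - b| / 2).integrable _) fun τ => ?_)
  have h1 := (likelihood_add_pos (G := G) (o := o) (J := J) (β := β) k o τ).2
  have ha := h1 1
  have hb := h1 (-1)
  beta_reduce
  set a := ℒ (k + 1) o 1 τ
  set b := ℒ (k + 1) o (-1) τ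
  have h2 : |a - b| ≤ a + b := abs_le.2 ⟨by linarith, by linarith⟩
  have h3 : ((a - b) / (a + b)) ^ 2 * ((a + b) / 2) = |a - b| / 2 * (|a - b| / (a + b)) := by
    rw [div_pow, ← sq_abs (a - b)]
    field_simp
  rw [h3]
  exact mul_le_of_le_one_right (by positivity) (by rwa [div_le_one (by positivity)])

theorem le_integral_rootMagnetizationSq (hT : G.IsTree) {c : V → ℝ}
    (hc : ∀ v, ∑ w ∈ children G o v, c w * Real.tanh (β * J w) = c v) (hco : 0 < c o)
    (hC : ∀ N, ∫ η, levelSum G o c N η ^ 2 ∂freeGibbs G o J β ≤ c o ^ 2 + c o) (k : ℕ) :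
    c o / (c o + 1) ≤ ∫ η, rootMagnetizationSq G o J β (k + 1) η ∂freeGibbs G o J β := by
  set M : (V → ℤˣ) → ℝ := fun η => (ℒ (k + 1) o 1 η - ℒ (k + 1) o (-1) η) /
    (ℒ (k + 1) o 1 η + ℒ (k + 1) o (-1) η) with hM
  set S := levelSum G o c (k + 1) with hS
  have hSd : DependsOn S (level G o (0 + (k + 1))) := by
    rw [zero_add]
    exact dependsOn_levelSum (k + 1)
  have hMd : DependsOn M (level G o (0 + (k + 1))) :=
    dependsOn_likelihood_root hT (k + 1) fun a b => (a - b) / (a + b)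
  have h1 : ∫ η, M η * S η ∂freeGibbs G o J β = c o := by
    rw [← integral_spin_root_mul_levelSum hT hc (k + 1), ← hS,
      integral_freeGibbs_root_mul hT spin hSd]
    have h2 := integral_freeGibbs_root_mul (o := o) (J := J) (β := β) (k := k) hT (fun _ => 1)
      (h := fun η => M η * S η) fun x y h => by simp only [hMd h, hSd h]
    simp only [one_mul] at h2
    rw [h2]
    congr 1
    funext τ
    have h3 := (likelihood_add_pos (G := G) (o := o) (J := J) (β := β) (k + 1) o τ).1.ne'
    rw [hM, spin_neg, spin_one]
    field_simp
    ring
  have i1 : Integrable (fun η => M η ^ 2) (freeGibbs G o J β) :=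
    (hMd.isLocal.comp fun x => x ^ 2).integrable _
  have i2 : Integrable (fun η => S η ^ 2) (freeGibbs G o J β) :=
    (hSd.isLocal.comp fun x => x ^ 2).integrable _
  have i3 : Integrable (fun η => M η * S η) (freeGibbs G o J β) :=
    (hMd.isLocal.mul hSd.isLocal).integrable _
  set l : ℝ := (c o + 1)⁻¹ with hl
  have h2 : 0 ≤ ∫ η, (M η - l * S η) ^ 2 ∂freeGibbs G o J β := integral_nonneg fun _ => sq_nonneg _
  have h3 : ∀ η, (M η - l * S η) ^ 2 = (M η ^ 2 + l ^ 2 * S η ^ 2) - 2 * l * (M η * S η) :=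
    fun η => by ring
  simp only [h3] at h2
  rw [integral_sub (f := fun η => M η ^ 2 + l ^ 2 * S η ^ 2) (i1.add (i2.const_mul _))
    (i3.const_mul _), integral_add i1 (i2.const_mul _),
    integral_const_mul, integral_const_mul, h1] at h2
  have h4 := mul_le_mul_of_nonneg_left (hC (k + 1)) (sq_nonneg l)
  have h5 : l ^ 2 * (c o ^ 2 + c o) - 2 * l * c o = - (c o / (c o + 1)) := by
    rw [hl]
    field_simp
    ring
  have h6 : ∫ η, rootMagnetizationSq G o J β (k + 1) η ∂freeGibbs G o J β =
    ∫ η, M η ^ 2 ∂freeGibbs G o J β := rfl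
  rw [h6]
  linarith

theorem freeIsing_real_boundary (hT : G.IsTree) (k : ℕ) (η : V → ℤˣ) :
    ∃ c : ℝ, 0 < c ∧ ∀ s, (freeIsing G o J β (k + 1)).real
      (agreeOnBoundary G o (k + 1) ((ball G o (k + 1)).restrict η) ∩ rootSpin G o (k + 1) s) =
        c * ℒ (k + 1) o s η := by
  set B : Set (V → ℤˣ) := {ζ | ∀ v ∈ level G o (k + 1), ζ v = η v} with hB
  have hBd : DependsOn (B.indicator (1 : (V → ℤˣ) → ℝ)) (level G o (k + 1)) := by
    intro x y h
    have : x ∈ B ↔ y ∈ B := forall₂_congr fun v hv => by rw [h v hv]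
    simp only [Set.indicator, this, Pi.one_apply]
  refine ⟨(∫ τ, B.indicator 1 τ ∂fairSpins V) / 2, half_pos ?_, fun s => ?_⟩
  · rw [← avgOver_eq_integral hBd 1]
    refine div_pos (Finset.sum_pos' (fun σ _ => Set.indicator_nonneg (fun _ _ => zero_le_one) _)
      ⟨(level G o (k + 1)).restrict η, Finset.mem_univ _, ?_⟩) (by positivity)
    have h1 : glue (level G o (k + 1)) 1 ((level G o (k + 1)).restrict η) ∈ B :=
      fun v hv => glue_of_mem hv _ _
    rw [Set.indicator_of_mem h1]
    exact zero_lt_one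
  · rw [← freeGibbs_map_restrict hT, map_measureReal_apply (Finset.measurable_restrict _)
      (Set.toFinite _).measurableSet]
    have h1 : (ball G o (k + 1)).restrict ⁻¹' (agreeOnBoundary G o (k + 1)
        ((ball G o (k + 1)).restrict η) ∩ rootSpin G o (k + 1) s) = {ζ | ζ o = s} ∩ B := by
      ext ζ
      simp only [Set.mem_preimage, Set.mem_inter_iff, agreeOnBoundary, rootSpin, Set.mem_ofPred_eq,
        Subtype.forall, Finset.restrict, hB, mem_level hT]
      constructor
      · rintro ⟨h2, h3⟩
        exact ⟨h3 o (root_mem_ball hT _) rfl, fun v hv =>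
          h2 v (level_subset_ball ((mem_level hT).2 hv)) hv⟩
      · rintro ⟨h2, h3⟩
        exact ⟨fun v _ hv => h3 v hv, fun v _ hv => hv ▸ h2⟩
    have hm1 : MeasurableSet {ζ : V → ℤˣ | ζ o = s} := by
      change MeasurableSet ((fun ζ : V → ℤˣ => ζ o) ⁻¹' {s})
      exact measurable_pi_apply o (measurableSet_singleton s)
    have hm2 : MeasurableSet B := by
      have : B = B.indicator (1 : (V → ℤˣ) → ℝ) ⁻¹' {1} := by
        ext ζ
        by_cases h : ζ ∈ B <;> simp [h]
      rw [this]
      exact hBd.isLocal.measurable (measurableSet_singleton 1)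
    rw [h1, ← integral_indicator_one (hm1.inter hm2)]
    have h2 : ∀ ζ : V → ℤˣ, ({ζ | ζ o = s} ∩ B).indicator (1 : (V → ℤˣ) → ℝ) ζ =
        (fun t => if t = s then (1 : ℝ) else 0) (ζ o) * B.indicator 1 ζ := by
      intro ζ
      by_cases h : ζ o = s <;> by_cases h' : ζ ∈ B <;> simp [h, h']
    simp only [h2]
    have h3 := integral_freeGibbs_root_mul (J := J) (β := β) (k := k) hT
      (fun t => if t = s then (1 : ℝ) else 0) (h := B.indicator 1) (by rwa [zero_add])
    refine h3.trans ?_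
    rw [← integral_div, ← integral_mul_const]
    congr 1
    funext τ
    by_cases hτ : τ ∈ B
    · have h4 : ∀ t, ℒ (k + 1) o t τ = ℒ (k + 1) o t η := fun t =>
        dependsOn_likelihood _ _ _ fun v hv => hτ v (desc_root_subset hT _ hv)
      rw [h4, h4]
      rcases Int.units_eq_one_or s with rfl | rfl <;> simp [hτ] <;> ring
    · simp [hτ]

theorem rootLogLikelihood_eq (hT : G.IsTree) (k : ℕ) (η : V → ℤˣ) :
    rootLogLikelihood G o J β (k + 1) ((ball G o (k + 1)).restrict η) =
      Real.log (ℒ (k + 1) o 1 η / ℒ (k + 1) o (-1) η) := by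
  obtain ⟨c, hc, h⟩ := freeIsing_real_boundary (o := o) (J := J) (β := β) hT k η
  have hL := (likelihood_add_pos (G := G) (o := o) (J := J) (β := β) k o η).2
  have h0 : (freeIsing G o J β (k + 1)).real
      (agreeOnBoundary G o (k + 1) ((ball G o (k + 1)).restrict η)) ≠ 0 := by
    have h1 : 0 < c * ℒ (k + 1) o 1 η := mul_pos hc (hL 1)
    rw [← h 1] at h1
    exact (h1.trans_le (measureReal_mono Set.inter_subset_left)).ne'
  rw [rootLogLikelihood, measureReal_def, measureReal_def, cond_apply (Set.toFinite _).measurableSet,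
    cond_apply (Set.toFinite _).measurableSet, ENNReal.toReal_mul, ENNReal.toReal_mul,
    ENNReal.toReal_inv, ← measureReal_def, ← measureReal_def, ← measureReal_def, h, h,
    mul_div_mul_left _ _ (inv_ne_zero h0), mul_div_mul_left _ _ hc.ne']

/-- The square of `tanh (x / 2)`. -/
noncomputable def tanhHalfSq (x : ℝ) : ℝ := 1 - (Real.cosh (x / 2) ^ 2)⁻¹

theorem tanhHalfSq_nonneg (x : ℝ) : 0 ≤ tanhHalfSq x :=
  sub_nonneg.2 (inv_le_one_of_one_le₀ (one_le_pow₀ (Real.one_le_cosh _)))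

theorem tanhHalfSq_le_one (x : ℝ) : tanhHalfSq x ≤ 1 :=
  sub_le_self _ (inv_nonneg.2 (sq_nonneg _))

theorem tanhHalfSq_pos {x : ℝ} (hx : x ≠ 0) : 0 < tanhHalfSq x :=
  sub_pos.2 (inv_lt_one_of_one_lt₀
    (one_lt_pow₀ (Real.one_lt_cosh.2 (div_ne_zero hx two_ne_zero)) two_ne_zero))

theorem tanhHalfSq_mono {x y : ℝ} (h : |x| ≤ |y|) : tanhHalfSq x ≤ tanhHalfSq y := by
  have h1 : Real.cosh (x / 2) ≤ Real.cosh (y / 2) := by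
    rw [Real.cosh_le_cosh, abs_div, abs_div]
    gcongr
  have h2 := Real.cosh_pos (x / 2)
  unfold tanhHalfSq
  gcongr

theorem continuous_tanhHalfSq : Continuous tanhHalfSq := by
  unfold tanhHalfSq
  refine continuous_const.sub (Continuous.inv₀ (by fun_prop) fun x => ?_)
  have := Real.cosh_pos (x / 2)
  positivity

theorem tanhHalfSq_log {a b : ℝ} (ha : 0 < a) (hb : 0 < b) :
    tanhHalfSq (Real.log (a / b)) = ((a - b) / (a + b)) ^ 2 := by
  have h1 : Real.cosh (Real.log (a / b) / 2) ^ 2 = (a + b) ^ 2 / (4 * a * b) := by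
    rw [Real.cosh_sq', Real.sinh_sq, ← sub_eq_zero]
    have h2 := Real.cosh_two_mul (Real.log (a / b) / 2)
    have h3 := Real.cosh_sq (Real.log (a / b) / 2)
    rw [mul_div_cancel₀ _ two_ne_zero, Real.cosh_log (by positivity)] at h2
    have h4 : (a + b) ^ 2 / (4 * a * b) = (a / b + (a / b)⁻¹ + 2) / 4 := by
      field_simp
      ring
    rw [h4]
    linarith
  rw [tanhHalfSq, h1]
  field_simp
  ring

theorem tanhHalfSq_rootLogLikelihood (hT : G.IsTree) (k : ℕ) (η : V → ℤˣ) :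
    tanhHalfSq (rootLogLikelihood G o J β (k + 1) ((ball G o (k + 1)).restrict η)) =
      rootMagnetizationSq G o J β (k + 1) η := by
  have hL := (likelihood_add_pos (G := G) (o := o) (J := J) (β := β) k o η).2
  rw [rootLogLikelihood_eq hT, tanhHalfSq_log (hL 1) (hL (-1))]
  rfl

/-- The log-likelihood ratio tends to `0` in law if and only if the mean squared magnetization of
the root tends to `0`. -/
theorem tendstoInDistribution_rootLogLikelihood_iff (hT : G.IsTree) :
    TendstoInDistribution (fun N : ℕ => rootLogLikelihood G o J β N) atTop
        (fun _ : Unit => (0 : ℝ)) (fun N : ℕ => freeIsing G o J β N) (Measure.dirac ()) ↔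
      Tendsto (fun k => ∫ η, rootMagnetizationSq G o J β (k + 1) η ∂freeGibbs G o J β) atTop
        (nhds 0) := by
  have hmeas : ∀ N, Measurable (rootLogLikelihood G o J β N) := fun N => measurable_of_finite _
  have hzero : tanhHalfSq 0 = 0 := by simp [tanhHalfSq]
  constructor
  · intro h
    have h1 := ProbabilityMeasure.tendsto_iff_forall_integral_tendsto.1 h.tendsto
      (BoundedContinuousFunction.ofNormedAddCommGroup tanhHalfSq continuous_tanhHalfSq 1 fun x => by
        rw [Real.norm_eq_abs, abs_of_nonneg (tanhHalfSq_nonneg x)]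
        exact tanhHalfSq_le_one x)
    have h2 := h1.comp (tendsto_add_atTop_nat 1)
    simp only [Function.comp_def, ProbabilityMeasure.coe_mk,
      BoundedContinuousFunction.coe_ofNormedAddCommGroup] at h2
    rw [Measure.map_dirac' measurable_const, integral_dirac, hzero] at h2
    refine h2.congr fun k => ?_
    rw [integral_map (hmeas _).aemeasurable continuous_tanhHalfSq.aestronglyMeasurable,
      ← freeGibbs_map_restrict hT, integral_map (Finset.measurable_restrict _).aemeasurable
        (measurable_of_finite _).aestronglyMeasurable]
    simp only [tanhHalfSq_rootLogLikelihood hT]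
  · intro h
    set X : ℕ → (V → ℤˣ) → ℝ := fun N η =>
      rootLogLikelihood G o J β N ((ball G o N).restrict η) with hX
    have hXm : ∀ N, Measurable (X N) := fun N => (hmeas N).comp (Finset.measurable_restrict _)
    have h1 : TendstoInMeasure (freeGibbs G o J β) X atTop fun _ => 0 := by
      rw [tendstoInMeasure_iff_measureReal_norm]
      intro ε hε
      rw [← tendsto_add_atTop_iff_nat 1]
      have hpos := tanhHalfSq_pos hε.ne'
      have h2 := h.const_mul (tanhHalfSq ε)⁻¹
      rw [mul_zero] at h2
      refine squeeze_zero (fun _ => measureReal_nonneg) (fun k => ?_) h2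
      rw [inv_mul_eq_div, le_div_iff₀' hpos]
      have h3 := mul_meas_ge_le_integral_of_nonneg (μ := freeGibbs G o J β)
        (f := rootMagnetizationSq G o J β (k + 1)) (Eventually.of_forall fun _ => sq_nonneg _)
        ((isLocal_rootMagnetizationSq (k + 1)).integrable _) (tanhHalfSq ε)
      refine le_trans (mul_le_mul_of_nonneg_left (measureReal_mono fun η hη => ?_) hpos.le) h3
      rw [Set.mem_ofPred_eq, sub_zero, Real.norm_eq_abs] at hη
      rw [Set.mem_ofPred_eq, ← tanhHalfSq_rootLogLikelihood hT]
      exact tanhHalfSq_mono (by rwa [abs_of_pos hε])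
    have h2 := h1.tendstoInDistribution_of_aemeasurable (fun N => (hXm N).aemeasurable)
      aemeasurable_const
    refine ⟨fun N => (hmeas N).aemeasurable, aemeasurable_const, ?_⟩
    have h3 := h2.tendsto
    have h4 : ∀ N, (freeGibbs G o J β).map (X N) =
        (freeIsing G o J β N).map (rootLogLikelihood G o J β N) := fun N => by
      rw [← freeGibbs_map_restrict hT, Measure.map_map (hmeas N) (Finset.measurable_restrict _)]
      rfl
    simp only [h4] at h3
    convert h3 using 2
    congr 1
    apply Subtype.ext
    simp

end LogLikelihood

end IsingTree

/-- For every `N` the free boundary Gibbs measure restricts to the free Ising model on the first `N`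
levels; it is extremal if and only if the tree has zero `L^2` capacity, and this is so if and only
if the log-likelihood ratio at the root given the boundary of the first `N` levels tends to `0`
in law. -/
theorem theorem2p1 {V : Type*} [Infinite V] (G : SimpleGraph V) [G.LocallyFinite]
    (hT : G.IsTree) (o : V) (hleaf : ∀ v, v ≠ o → G.degree v ≠ 1)
    (J : V → ℝ) (β Jmin Jmax : ℝ) (hβ : 0 < β) (hJmin : 0 < Jmin)
    (hJ : ∀ v, v ≠ o → Jmin ≤ J v ∧ J v ≤ Jmax) :
    (∀ N : ℕ, (IsingTree.freeGibbs G o J β).map (Finset.restrict (IsingTree.ball G o N)) =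
        IsingTree.freeIsing G o J β N) ∧
    (IsingTree.IsExtremal G o J β (IsingTree.freeGibbs G o J β) ↔
      IsingTree.capacity G o (IsingTree.resistance G o J β) 2 = 0) ∧
    (TendstoInDistribution (fun N : ℕ => IsingTree.rootLogLikelihood G o J β N) atTop
        (fun _ : Unit => (0 : ℝ)) (fun N : ℕ => IsingTree.freeIsing G o J β N)
        (Measure.dirac ()) ↔
      IsingTree.capacity G o (IsingTree.resistance G o J β) 2 = 0) := by
  have hcosh : ∀ x, Real.tanh x ^ 2 = 1 - (Real.cosh x ^ 2)⁻¹ := fun x => by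
    have h := Real.cosh_pos x
    rw [Real.tanh_eq_sinh_div_cosh, div_pow, Real.sinh_sq]
    field_simp
  have hpos : ∀ w, w ≠ o → 0 < β * J w := fun w hw => mul_pos hβ (hJmin.trans_le (hJ w hw).1)
  have htanh : ∀ w, w ≠ o → 0 < Real.tanh (β * J w) := fun w hw => by
    rw [Real.tanh_eq_sinh_div_cosh]
    exact div_pos (Real.sinh_pos_iff.2 (hpos w hw)) (Real.cosh_pos _)
  have hc : 0 < (Real.cosh (β * Jmax) ^ 2)⁻¹ := inv_pos.2 (pow_pos (Real.cosh_pos _) 2)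
  have hle : ∀ w, w ≠ o → (Real.cosh (β * Jmax) ^ 2)⁻¹ ≤ 1 - Real.tanh (β * J w) ^ 2 :=
    fun w hw => by
      have h1 : β * J w ≤ β * Jmax := mul_le_mul_of_nonneg_left (hJ w hw).2 hβ.le
      have h2 : Real.cosh (β * J w) ≤ Real.cosh (β * Jmax) := by
        rw [Real.cosh_le_cosh, abs_of_pos (hpos w hw), abs_of_pos ((hpos w hw).trans_le h1)]
        exact h1
      have h3 := Real.cosh_pos (β * J w)
      rw [hcosh, sub_sub_cancel]
      gcongr
  have hinf := fun h : IsingTree.capacity G o (IsingTree.resistance G o J β) 2 = 0 =>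
    IsingTree.tendsto_influence_of_capacity_eq_zero hT hleaf hc hle
      (fun w hw => pow_pos (htanh w hw) 2) h
  refine ⟨fun N => IsingTree.freeGibbs_map_restrict hT N, ⟨fun h => ?_, fun h =>
    IsingTree.isExtremal_freeGibbs hT (hinf h)⟩, ?_⟩
  · by_contra hcap
    obtain ⟨c, h1, h2, h3⟩ := IsingTree.exists_coeff_of_capacity_ne_zero hT hleaf htanh hcap
    exact IsingTree.not_isExtremal_of_levelSum hT h1 h2 h3 h
  · rw [IsingTree.tendstoInDistribution_rootLogLikelihood_iff hT]
    refine ⟨fun h => ?_, fun h => ?_⟩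
    · by_contra hcap
      obtain ⟨c, h1, h2, h3⟩ := IsingTree.exists_coeff_of_capacity_ne_zero hT hleaf htanh hcap
      have h4 := ge_of_tendsto' h (IsingTree.le_integral_rootMagnetizationSq hT h1 h2 h3)
      exact h4.not_gt (by positivity)
    · exact squeeze_zero (fun k => integral_nonneg fun η => sq_nonneg _)
        (IsingTree.integral_rootMagnetizationSq_le hT)
        ((hinf h o).comp (tendsto_add_atTop_nat 1))
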